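/- **Setting.** Let $\mathcal U\subset\mathbb R^N$ be open and convex and let $f:\mathcal U\to\mathbb R^N$ be smooth. A convex (strictly convex) entropy pair is a pair of $C^2$ functions $(U,F):\mathcal U\to\mathbb R\times\mathbb R$ with $\nabla F^T=\nabla U^T\nabla f$ and $\nabla^2U$ non-negative (positive definite). Assume that at least one strictly convex entropy pair exists. Let $\mathcal D\subset\mathbb R^N$ be a set of states such that for all $v,w\in\mathcal D$ the Riemann problem for $\partial_tu+\partial_xf(u)=0$ with left state $v$ and right state $w$ has a self-similar entropy solution $u(x,t)=\sigma(x/t)$ with values in a compact subset of $\mathcal U$ (the equation, and $\partial_tU(u)+\partial_xF(u)\le0$ for all convex entropy pairs, in the weak sense), with $\sigma(\xi)=v$ for $\xi<-\Lambda$ and $\sigma(\xi)=w$ for $\xi>\Lambda$, and with a limit $R(v,w)=\sigma(0+)$; here $\Lambda$ does not depend on $v,w$, one such solution is selected for each $(v,w)$, and $R$ is Borel measurable. Let $\lambda>0$ with $\lambda\Lambda<1/2$. For mesh sizes $h>0$ and $\tau=\lambda h$, let $u^h(x,t)$, $x\ge0$, $t\ge0$, be the Godunov approximation: $$u^h(x,t+\tau)=u^h(x,t)-\lambda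 f\big(R(u^h(x,t),u^h(x+h,t))\big)+\lambda f\big(R(u^h(x-h,t),u^h(x,t))\big)\qquad(x\ge h,\ t\ge 0),$$ with $u^h(x,t)=u_B(t)$ for $x<h$, where $u_B$ is measurable (for instance of locally bounded variation), and $u^h(x,t)=u_I^h(x)$ for $x\ge h$, $t<\tau$, where $u_I^h$ is constant on each cell $[jh,(j+1)h)$ (an arbitrary discretization of the initial data). Put $v^h(y,t)=u^h(yh,t)$ and, for $y\ge1/2$, $$w^h(y,t)=R\big(u^h(yh-\tfrac h2,t),\,u^h(yh+\tfrac h2,t)\big),$$ so that for $y\in[k-1/2,k+1/2)$ this is the Riemann value at the interface $x=kh$. Along a sequence $h\to0$, assume that all values of $u^h$ lie in $K\cap\mathcal D$ and all values of $w^h$ lie in $K$, for one fixed compact set $K\subset\mathcal U$. Let $\nu_{x,t}$ be a Young measure associated with $u^h$ on $x>0,\ t>0$, and $\pi_{y,t}$ a Young measure associated with $w^h$ on $y>1/2,\ t>0$. **Theorem 2.4.** After modification on a null set, $\pi_{y,t}$ is defined for all $y\ge1/2$ and almost every $t>0$, as a probability measure on $K$ depending weak-$\star$ measurably on $t$, and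 it is constant in $y\in[k-1/2,k+1/2)$ for each integer $k\ge1$. There is a weak-$\star$ measurable family $\nu_{0,t}$ of probability measures on $K$, the trace of $\nu$ at $x=0$, such that for all convex entropy pairs $(U,F)$, all $0\le T_1<T_2$ and all $\theta\ge0$ of locally bounded variation on $[0,\infty)$, $$\operatorname*{ess\,lim}_{x\to0+}\int_{T_1}^{T_2}\langle\nu_{x,t},F\rangle\,\theta(t)\,dt=\int_{T_1}^{T_2}\langle\nu_{0,t},F\rangle\,\theta(t)\,dt ,$$ and for all convex entropy pairs $(U,F)$ and all $y\ge1/2$ $$\langle\pi_{1/2,t},F\rangle\ \ge\ \langle\pi_{y,t},F\rangle\ \ge\ \langle\pi_{y+1,t},F\rangle\ \ge\ \langle\nu_{0,t},F\rangle, \tag{2.44}$$ $$\langle\pi_{1/2,t},F\rangle=\lim_{h\to0}F\big(R(u_B(t),v^h(1,t))\big), \tag{2.45}$$ $$\lim_{y\to\infty}\langle\pi_{y,t},F\rangle\ \ge\ \langle\nu_{0,t},F\rangle. \tag{2.46}$$ Here (2.44)–(2.46), the existence of the limit in (2.46) included, are understood after multiplication by $\theta$ and integration over $(T_1,T_2)$,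 for all $0\le T_1<T_2$ and all $\theta$ of locally bounded variation on $[0,\infty)$, with $\theta\ge0$ in (2.44) and (2.46). -/

import Mathlib

open MeasureTheory Set Filter
open scoped ContDiff Topology

/-- The space `ℝᴺ` of states, with its Euclidean norm. -/
abbrev State (N : ℕ) := EuclideanSpace ℝ (Fin N)

/-- `(U, F)` is a convex entropy pair on `𝒰` for the flux `f`: both functions are of class `C²`,
`∇Fᵀ = ∇Uᵀ ∇f`, and the Hessian of `U` is non-negative. -/
structure IsConvexEntropyPair {N : ℕ} (f : State N → State N) (𝒰 : Set (State N))
    (U F : State N → ℝ) : Prop where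
  contDiff_entropy : ContDiffOn ℝ 2 U 𝒰
  contDiff_flux : ContDiffOn ℝ 2 F 𝒰
  compatible : ∀ u ∈ 𝒰, fderiv ℝ F u = (fderiv ℝ U u).comp (fderiv ℝ f u)
  hessian_nonneg : ∀ u ∈ 𝒰, ∀ z : State N, 0 ≤ fderiv ℝ (fderiv ℝ U) u z z

/-- A convex entropy pair whose entropy has a positive definite Hessian. -/
structure IsStrictlyConvexEntropyPair {N : ℕ} (f : State N → State N) (𝒰 : Set (State N))
    (U F : State N → ℝ) : Prop extends IsConvexEntropyPair f 𝒰 U F where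
  hessian_pos : ∀ u ∈ 𝒰, ∀ z : State N, z ≠ 0 → 0 < fderiv ℝ (fderiv ℝ U) u z z

/-- `u` is an entropy solution of `∂ₜ u + ∂ₓ f(u) = 0`, `x ∈ ℝ`, `t > 0`, with `u(·, 0) = u₀`: it is
measurable, takes its values in a compact subset of `𝒰`, and for all convex entropy pairs it
satisfies `∂ₜ U(u) + ∂ₓ F(u) ≤ 0` with initial value `U(u₀)`, in the weak sense. The equation
itself, in the weak sense, is the case of the pairs `± (uⱼ, fⱼ)`. Test functions are functions of
the pair `(x, t)`. -/
def IsEntropySolution {N : ℕ} (f : State N → State N) (𝒰 : Set (State N))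
    (u₀ : ℝ → State N) (u : ℝ → ℝ → State N) : Prop :=
  Measurable (fun p : ℝ × ℝ => u p.1 p.2) ∧
  (∃ C : Set (State N), IsCompact C ∧ C ⊆ 𝒰 ∧ ∀ x t, 0 < t → u x t ∈ C) ∧
  ∀ U F : State N → ℝ, IsConvexEntropyPair f 𝒰 U F →
    ∀ φ : ℝ × ℝ → ℝ, ContDiff ℝ ∞ φ → HasCompactSupport φ → (∀ p, 0 ≤ φ p) →
      0 ≤ (∫ p in {p : ℝ × ℝ | 0 < p.2},
            (U (u p.1 p.2) * fderiv ℝ φ p (0, 1) + F (u p.1 p.2) * fderiv ℝ φ p (1, 0)))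
          + ∫ x : ℝ, U (u₀ x) * φ (x, 0)

/-- `σ` is the profile of a self-similar entropy solution `u(x, t) = σ(x / t)` of the Riemann
problem with left state `v` and right state `w`, whose wave speeds are at most `Λ`. -/
def IsRiemannSolution {N : ℕ} (f : State N → State N) (𝒰 : Set (State N)) (Λ : ℝ)
    (v w : State N) (σ : ℝ → State N) : Prop :=
  IsEntropySolution f 𝒰 (fun x => if x < 0 then v else w) (fun x t => σ (x / t)) ∧
  (∀ ξ, ξ < -Λ → σ ξ = v) ∧ (∀ ξ, Λ < ξ → σ ξ = w)

/-- `R v w` is the value at `x / t = 0+` of a solution of the Riemann problem with left state `v`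
and right state `w`, for all states `v`, `w` in `𝒟`. -/
def IsRiemannSolver {N : ℕ} (f : State N → State N) (𝒰 𝒟 : Set (State N)) (Λ : ℝ)
    (R : State N → State N → State N) : Prop :=
  ∀ v ∈ 𝒟, ∀ w ∈ 𝒟, ∃ σ : ℝ → State N,
    IsRiemannSolution f 𝒰 Λ v w σ ∧ Tendsto σ (𝓝[>] 0) (𝓝 (R v w))

/-- The Godunov recursion on the mesh: the value in the cell `j` after `n` steps. The cell `0`
carries the boundary values `b n`, the cells `j ≥ 1` start from `a j`. -/
def godunovLattice {N : ℕ} (f : State N → State N) (R : State N → State N → State N) (lam : ℝ)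
    (a b : ℕ → State N) : ℕ → ℕ → State N
  | n, 0 => b n
  | 0, j + 1 => a (j + 1)
  | n + 1, j + 1 =>
      godunovLattice f R lam a b n (j + 1)
        - lam • f (R (godunovLattice f R lam a b n (j + 1)) (godunovLattice f R lam a b n (j + 2)))
        + lam • f (R (godunovLattice f R lam a b n j) (godunovLattice f R lam a b n (j + 1)))

/-- The Godunov approximation `uʰ(x, t)`, `x ≥ 0`, `t ≥ 0`, with mesh sizes `h` and `τ = lam * h`.
It equals `u_B(t)` for `x < h`, it equals the initial value `a j` for `t < τ` and `x` in the cell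
`[j h, (j + 1) h)`, `j ≥ 1`, and for `x ≥ h` and `t ≥ 0`
`uʰ(x, t + τ) = uʰ(x, t) - lam g(uʰ(x, t), uʰ(x + h, t)) + lam g(uʰ(x - h, t), uʰ(x, t))`
with the numerical flux `g(v, w) = f(R(v, w))`. -/
noncomputable def godunov {N : ℕ} (f : State N → State N) (R : State N → State N → State N)
    (lam h : ℝ) (a : ℕ → State N) (uB : ℝ → State N) (x t : ℝ) : State N :=
  godunovLattice f R lam a
    (fun m => uB (t - (⌊t / (lam * h)⌋₊ : ℝ) * (lam * h) + (m : ℝ) * (lam * h)))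
    ⌊t / (lam * h)⌋₊ ⌊x / h⌋₊

/-- The rescaled Godunov approximation `vʰ(y, t) = uʰ(y h, t)`. -/
noncomputable def godunovScaled {N : ℕ} (f : State N → State N)
    (R : State N → State N → State N)
    (lam h : ℝ) (a : ℕ → State N) (uB : ℝ → State N) (y t : ℝ) : State N :=
  godunov f R lam h a uB (y * h) t

/-- The interface Riemann values
`wʰ(y, t) = R(uʰ(y h - h / 2, t), uʰ(y h + h / 2, t))`, `y ≥ 1 / 2`: for
`y ∈ [k - 1 / 2, k + 1 / 2)` this is the Riemann value at the interface `x = k h`. -/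
noncomputable def godunovInterface {N : ℕ} (f : State N → State N)
    (R : State N → State N → State N)
    (lam h : ℝ) (a : ℕ → State N) (uB : ℝ → State N) (y t : ℝ) : State N :=
  R (godunov f R lam h a uB (y * h - h / 2) t) (godunov f R lam h a uB (y * h + h / 2) t)

/-- `ν` is a weak-star measurable map from `Ω` to the probability measures on `S`, defined up to
null sets. -/
structure IsYoungFamily {N : ℕ} {α : Type*} [MeasureSpace α] (S : Set (State N)) (Ω : Set α)
    (ν : α → Measure (State N)) : Prop where
  prob : ∀ᵐ p ∂(volume.restrict Ω), IsProbabilityMeasure (ν p) ∧ ν p Sᶜ = 0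
  measurable : ∀ g : State N → ℝ, ContinuousOn g S →
    AEStronglyMeasurable (fun p => ∫ z, g z ∂(ν p)) (volume.restrict Ω)

/-- `ν` is a Young measure on `Ω` associated with the sequence `u` of functions with values in
`S`: for all continuous `g : S → ℝ` one has `g(uₙ) ⇀ ⟨ν, g⟩` weakly-star in `L^∞(Ω)`. -/
structure IsYoungMeasure {N : ℕ} {α : Type*} [MeasureSpace α] (S : Set (State N)) (Ω : Set α)
    (u : ℕ → α → State N) (ν : α → Measure (State N)) : Prop
    extends IsYoungFamily S Ω ν where
  tendsto : ∀ g : State N → ℝ, ContinuousOn g S →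
    ∀ φ : α → ℝ, Integrable φ (volume.restrict Ω) →
      Tendsto (fun n => ∫ p in Ω, g (u n p) * φ p) atTop
        (𝓝 (∫ p in Ω, (∫ z, g z ∂(ν p)) * φ p))

/-- The time average `∫_{T₁}^{T₂} ⟨m_t, g⟩ θ(t) dt`. -/
noncomputable def timeAverage {N : ℕ} (T₁ T₂ : ℝ) (θ : ℝ → ℝ) (g : State N → ℝ)
    (m : ℝ → Measure (State N)) : ℝ :=
  ∫ t in T₁..T₂, (∫ z, g z ∂(m t)) * θ t

/-! Everything rests on the cell entropy inequality (`cell_entropy`): over one time step the entropy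
in a cell changes by at most a difference of interface entropy fluxes. Integrate it in time against
a weight `θ ≥ 0` of bounded variation. The entropy difference over one step is a time shift by `lam
* h`, and the shift can be moved onto `θ`, so it contributes only O(h). Hence the averaged flux
increases by at most O(h) from one interface to the next (`IsEntropyScheme.exists_flux_le`). Over a
fixed number of interfaces this error vanishes as h → 0, which makes the flux of `π` nonincreasing
in `y`. Over a macroscopic distance d it adds up to O(d). Once interface fluxes can be compared with
cell fluxes, the flux of `ν` is therefore nonincreasing in x up to a linear error, so it has an
essential limit at x = 0 (`exists_ess_limit`), and this limit lies below the flux at every fixed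
interface.

The comparison of interfaces with cells cannot use strong convergence; it comes from the dissipation
of a strictly convex entropy. Let `a` be the updated cell value. The relative entropies with respect
to `a` of the parts of the two neighbouring Riemann solutions inside the cell are bounded by the
dissipation in the cell (`cell_relative_entropy`). Relative entropy controls the distance to `a` up
to an arbitrarily small error (`IsStrictlyConvexEntropyPair.norm_sub_le`), so these parts are close
in L¹ to the old cell value, and the entropy flux can increase only little across each half of the
cell (`cell_consistency`). The space-time integral of the dissipation is O(h), so the increases
vanish in the limit (`IsEntropyScheme.tendsto_defect`). The inequalities for half a Riemann solution
come from the weak formulation with test functions χ(t) ψ(x/t) (`IsEntropySolution.weak_profile`,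
`profile_bounds`).

One measure `ν₀` must represent the limits for all entropy pairs and weights at once. It comes from
compactness: the joint laws of time and state over thin layers at the boundary have a limit point,
which is disintegrated in time (`IsYoungMeasure.exists_boundary_measure`). The essential limits
already exist, so every limit point gives the same flux averages. For `π`, the interface values
depend on `y` only through the index of the interface; on each unit strip the Young measure is then
independent of `y` (`IsYoungMeasure.exists_layer`). -/

/-! ### Convex entropies and relative entropy -/

namespace IsConvexEntropyPair

variable {N : ℕ} {f : State N → State N} {𝒰 : Set (State N)} {U F : State N → ℝ}

lemma continuousOn_entropy (hp : IsConvexEntropyPair f 𝒰 U F) : ContinuousOn U 𝒰 :=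
  hp.contDiff_entropy.continuousOn

lemma continuousOn_flux (hp : IsConvexEntropyPair f 𝒰 U F) : ContinuousOn F 𝒰 :=
  hp.contDiff_flux.continuousOn

lemma contDiffOn_fderiv (hp : IsConvexEntropyPair f 𝒰 U F) (h𝒰 : IsOpen 𝒰) :
    ContDiffOn ℝ 1 (fderiv ℝ U) 𝒰 :=
  hp.contDiff_entropy.fderiv_of_isOpen h𝒰 (by norm_num)

/-- Taylor's formula for the entropy, with the second derivative at an intermediate point. -/
lemma exists_taylor (hp : IsConvexEntropyPair f 𝒰 U F) (h𝒰 : IsOpen 𝒰) (hc : Convex ℝ 𝒰)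
    {a z : State N} (ha : a ∈ 𝒰) (hz : z ∈ 𝒰) :
    ∃ c : ℝ, 0 < c ∧ ∃ p ∈ 𝒰,
      U z - U a - fderiv ℝ U a (z - a) = c * fderiv ℝ (fderiv ℝ U) p (z - a) (z - a) := by
  have hmem : ∀ t ∈ Icc (0 : ℝ) 1, a + t • (z - a) ∈ 𝒰 := fun t ht =>
    hc.add_smul_sub_mem ha hz ht
  have hline : ∀ t : ℝ, HasDerivAt (fun t : ℝ => a + t • (z - a)) (z - a) t := fun t => by
    simpa using ((hasDerivAt_id t).smul_const (z - a)).const_add a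
  have h1 : ∀ t ∈ Icc (0 : ℝ) 1, HasDerivAt (fun t : ℝ => U (a + t • (z - a)))
      (fderiv ℝ U (a + t • (z - a)) (z - a)) t := fun t ht => by
    have hd : DifferentiableAt ℝ U (a + t • (z - a)) :=
      (hp.contDiff_entropy.differentiableOn (by norm_num)).differentiableAt
        (h𝒰.mem_nhds (hmem t ht))
    exact hd.hasFDerivAt.comp_hasDerivAt t (hline t)
  have h2 : ∀ t ∈ Icc (0 : ℝ) 1, HasDerivAt
      (fun t : ℝ => fderiv ℝ U (a + t • (z - a)) (z - a))
      (fderiv ℝ (fderiv ℝ U) (a + t • (z - a)) (z - a) (z - a)) t := fun t ht => by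
    have hd : DifferentiableAt ℝ (fderiv ℝ U) (a + t • (z - a)) :=
      ((hp.contDiffOn_fderiv h𝒰).differentiableOn (by norm_num)).differentiableAt
        (h𝒰.mem_nhds (hmem t ht))
    have hd' : HasDerivAt (fun t : ℝ => fderiv ℝ U (a + t • (z - a)))
        (fderiv ℝ (fderiv ℝ U) (a + t • (z - a)) (z - a)) t :=
      hd.hasFDerivAt.comp_hasDerivAt t (hline t)
    exact ((ContinuousLinearMap.apply ℝ ℝ (z - a)).hasFDerivAt.comp_hasDerivAt t hd')
  -- The mean value theorem is used twice, on [0, 1] for the function and on [0, c] for its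
  -- derivative. The factor is then `c` rather than 1/2, but only its sign matters.
  obtain ⟨c, hc01, hc'⟩ := exists_hasDerivAt_eq_slope (fun t : ℝ => U (a + t • (z - a)))
    (fun t => fderiv ℝ U (a + t • (z - a)) (z - a)) (zero_lt_one' ℝ)
    (fun t ht => (h1 t ht).continuousAt.continuousWithinAt)
    (fun t ht => h1 t (Ioo_subset_Icc_self ht))
  obtain ⟨d, hd0c, hd'⟩ := exists_hasDerivAt_eq_slope
    (fun t : ℝ => fderiv ℝ U (a + t • (z - a)) (z - a))
    (fun t => fderiv ℝ (fderiv ℝ U) (a + t • (z - a)) (z - a) (z - a)) hc01.1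
    (fun t ht => (h2 t ⟨ht.1, ht.2.trans hc01.2.le⟩).continuousAt.continuousWithinAt)
    (fun t ht => h2 t ⟨ht.1.le, (ht.2.trans hc01.2).le⟩)
  refine ⟨c, hc01.1, a + d • (z - a), hmem d ⟨hd0c.1.le, (hd0c.2.trans hc01.2).le⟩, ?_⟩
  rw [hd', hc']
  have := hc01.1.ne'
  simp only [one_smul, zero_smul, add_zero, add_sub_cancel, sub_zero, div_one]
  field_simp

/-- The entropy lies above its tangent planes. -/
lemma tangent_le (hp : IsConvexEntropyPair f 𝒰 U F) (h𝒰 : IsOpen 𝒰) (hc : Convex ℝ 𝒰)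
    {a z : State N} (ha : a ∈ 𝒰) (hz : z ∈ 𝒰) :
    0 ≤ U z - U a - fderiv ℝ U a (z - a) := by
  obtain ⟨c, hc0, p, hp𝒰, h⟩ := hp.exists_taylor h𝒰 hc ha hz
  rw [h]
  exact mul_nonneg hc0.le (hp.hessian_nonneg p hp𝒰 _)

/-- Beyond a point of the ray from `a` through `z`, the relative entropy grows at least
linearly. -/
lemma mul_relative_le (hp : IsConvexEntropyPair f 𝒰 U F) (h𝒰 : IsOpen 𝒰) (hc : Convex ℝ 𝒰)
    {a v : State N} {s : ℝ} (hs : 1 ≤ s) (ha : a ∈ 𝒰) (hz : a + s • v ∈ 𝒰) :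
    s * (U (a + v) - U a - fderiv ℝ U a v) ≤ U (a + s • v) - U a - fderiv ℝ U a (s • v) := by
  have hs0 : 0 < s := by linarith
  have hm : a + v ∈ 𝒰 := by
    have := hc.add_smul_mem ha hz (t := s⁻¹) ⟨by positivity, inv_le_one_of_one_le₀ hs⟩
    rwa [smul_smul, inv_mul_cancel₀ hs0.ne', one_smul] at this
  -- The tangent plane at the intermediate point `a + v` is compared with `U` at both ends of the
  -- segment; the combination `e1 + (s - 1) * e2` eliminates the gradient there.
  have e1 := hp.tangent_le h𝒰 hc hm hz
  have e2 := hp.tangent_le h𝒰 hc hm ha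
  have r1 : a + s • v - (a + v) = (s - 1) • v := by module
  have r2 : a - (a + v) = -v := by abel
  rw [r1, map_smul, smul_eq_mul] at e1
  rw [r2, map_neg] at e2
  rw [map_smul, smul_eq_mul]
  nlinarith [mul_nonneg (sub_nonneg.2 hs) e2]

end IsConvexEntropyPair

namespace IsStrictlyConvexEntropyPair

variable {N : ℕ} {f : State N → State N} {𝒰 : Set (State N)} {U F : State N → ℝ}

lemma tangent_lt (hp : IsStrictlyConvexEntropyPair f 𝒰 U F) (h𝒰 : IsOpen 𝒰) (hc : Convex ℝ 𝒰)
    {a z : State N} (ha : a ∈ 𝒰) (hz : z ∈ 𝒰) (hne : z ≠ a) :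
    0 < U z - U a - fderiv ℝ U a (z - a) := by
  obtain ⟨c, hc0, p, hp𝒰, h⟩ := hp.exists_taylor h𝒰 hc ha hz
  rw [h]
  exact mul_pos hc0 (hp.hessian_pos p hp𝒰 _ (sub_ne_zero.2 hne))

/-- The relative entropy of a strictly convex entropy controls the distance, up to an arbitrarily
small error. -/
lemma norm_sub_le (hp : IsStrictlyConvexEntropyPair f 𝒰 U F) (h𝒰 : IsOpen 𝒰)
    (hc : Convex ℝ 𝒰) {K : Set (State N)} (hK : IsCompact K) (hK𝒰 : K ⊆ 𝒰) {ε : ℝ}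
    (hε : 0 < ε) :
    ∃ B : ℝ, 0 ≤ B ∧ ∀ a ∈ K, ∀ z ∈ 𝒰,
      ‖z - a‖ ≤ ε + B * (U z - U a - fderiv ℝ U a (z - a)) := by
  obtain ⟨r, hr, hr𝒰⟩ := hK.exists_cthickening_subset_open h𝒰 hK𝒰
  -- `δ ≤ r` keeps the spheres around points of `K` inside `𝒰`; `δ ≤ ε` makes distances up to `δ`
  -- harmless.
  set δ := min r ε with hδ
  have hδ0 : 0 < δ := lt_min hr hε
  have hS : IsCompact (K ×ˢ Metric.sphere (0 : State N) δ) := hK.prod (isCompact_sphere _ _)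
  have hmem : ∀ p ∈ K ×ˢ Metric.sphere (0 : State N) δ, p.1 + p.2 ∈ 𝒰 := fun p hp' => by
    refine hr𝒰 (Metric.mem_cthickening_of_dist_le _ p.1 _ _ hp'.1 ?_)
    have := hp'.2
    simp only [mem_sphere_iff_norm, sub_zero] at this
    simp [this, hδ]
  have hcont : ContinuousOn (fun p : State N × State N =>
      U (p.1 + p.2) - U p.1 - fderiv ℝ U p.1 p.2) (K ×ˢ Metric.sphere (0 : State N) δ) := by
    have h1 : ContinuousOn (fun p : State N × State N => U (p.1 + p.2))
        (K ×ˢ Metric.sphere (0 : State N) δ) :=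
      hp.continuousOn_entropy.comp (by fun_prop) hmem
    have h2 : ContinuousOn (fun p : State N × State N => U p.1)
        (K ×ˢ Metric.sphere (0 : State N) δ) :=
      hp.continuousOn_entropy.comp (by fun_prop) fun p hp' => hK𝒰 hp'.1
    have h3 : ContinuousOn (fun p : State N × State N => fderiv ℝ U p.1)
        (K ×ˢ Metric.sphere (0 : State N) δ) :=
      (hp.contDiffOn_fderiv h𝒰).continuousOn.comp (by fun_prop) fun p hp' => hK𝒰 hp'.1
    exact (h1.sub h2).sub (h3.clm_apply (by fun_prop))
  obtain ⟨m, hm0, hm⟩ : ∃ m : ℝ, 0 < m ∧ ∀ p ∈ K ×ˢ Metric.sphere (0 : State N) δ,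
      m ≤ U (p.1 + p.2) - U p.1 - fderiv ℝ U p.1 p.2 := by
    -- The product is empty if `K` is, or if `N = 0`.
    rcases (K ×ˢ Metric.sphere (0 : State N) δ).eq_empty_or_nonempty with he | hne
    · exact ⟨1, one_pos, by simp [he]⟩
    · obtain ⟨q, hq, hqm⟩ := hS.exists_isMinOn hne hcont
      refine ⟨_, ?_, fun p hp' => hqm hp'⟩
      have hq2 : q.2 ≠ 0 := by
        intro h0
        have := hq.2
        simp [h0] at this
        exact hδ0.ne this
      have := hp.tangent_lt h𝒰 hc (hK𝒰 hq.1) (hmem q hq) (by simpa using hq2)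
      simpa using this
  refine ⟨δ / m, by positivity, fun a ha z hz => ?_⟩
  have hB := hp.tangent_le h𝒰 hc (hK𝒰 ha) hz
  rcases le_or_gt ‖z - a‖ δ with hle | hgt
  · have : 0 ≤ δ / m * (U z - U a - fderiv ℝ U a (z - a)) := by positivity
    linarith [min_le_right r ε]
  · set s := ‖z - a‖ / δ with hs
    have hs1 : 1 ≤ s := by rw [hs, one_le_div hδ0]; exact hgt.le
    have hza : 0 < ‖z - a‖ := hδ0.trans hgt
    set v := (δ / ‖z - a‖) • (z - a) with hv
    have hsv : s • v = z - a := by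
      rw [hv, smul_smul, hs, div_mul_div_comm, mul_comm ‖z - a‖, div_self (by positivity), one_smul]
    have hvn : ‖v‖ = δ := by
      rw [hv, norm_smul, Real.norm_of_nonneg (by positivity), div_mul_cancel₀ _ hza.ne']
    -- The ray from `a` to `z` crosses the sphere at `a + v`, where the relative entropy is at least
    -- `m`; beyond it the growth is at least linear.
    have key := hp.mul_relative_le h𝒰 hc hs1 (hK𝒰 ha) (v := v) (by rw [hsv]; simpa using hz)
    rw [hsv, add_sub_cancel] at key
    have h1 := hm (a, v) ⟨ha, by simp [hvn]⟩
    have h2 : s * m ≤ U z - U a - fderiv ℝ U a (z - a) :=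
      (mul_le_mul_of_nonneg_left h1 (by linarith)).trans key
    have h3 : ‖z - a‖ = δ / m * (s * m) := by rw [hs]; field_simp
    rw [h3]
    have := mul_le_mul_of_nonneg_left h2 (show 0 ≤ δ / m by positivity)
    linarith

end IsStrictlyConvexEntropyPair

/-- The equation itself is the case of the trivial entropy pairs: a linear functional and its
composition with the flux. -/
lemma isConvexEntropyPair_clm {N : ℕ} {f : State N → State N} {𝒰 : Set (State N)}
    (h𝒰 : IsOpen 𝒰) (hf : ContDiffOn ℝ ∞ f 𝒰) (ℓ : State N →L[ℝ] ℝ) :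
    IsConvexEntropyPair f 𝒰 ℓ (fun u => ℓ (f u)) where
  contDiff_entropy := ℓ.contDiff.contDiffOn
  contDiff_flux := ℓ.contDiff.comp_contDiffOn (contDiffOn_infty.1 hf 2)
  compatible u hu := by
    have hd : DifferentiableAt ℝ f u :=
      (hf.differentiableOn (by simp)).differentiableAt (h𝒰.mem_nhds hu)
    rw [ℓ.fderiv]
    exact (ℓ.hasFDerivAt.comp u hd.hasFDerivAt).fderiv
  hessian_nonneg u _ z := by
    have : fderiv ℝ (ℓ : State N → ℝ) = fun _ => ℓ := funext fun x => ℓ.fderiv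
    simp [this]

/-- Factoring through the subtype avoids any measurability assumption on `S`, and `g` may be
arbitrary outside it. -/
lemma ContinuousOn.measurable_comp_of_mem {α X Y : Type*} [MeasurableSpace α] [TopologicalSpace X]
    [MeasurableSpace X] [OpensMeasurableSpace X] [TopologicalSpace Y] [MeasurableSpace Y]
    [BorelSpace Y] {S : Set X} {g : X → Y} (hg : ContinuousOn g S) {u : α → X} (hu : Measurable u)
    (hmem : ∀ a, u a ∈ S) : Measurable fun a => g (u a) := by
  have h1 : Measurable (S.domRestrict g) :=
    (continuousOn_iff_continuous_domRestrict.1 hg).measurable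
  exact h1.comp (hu.subtype_mk (h := hmem))

/-! ### Self-similar test functions -/

section SelfSimilar

variable {χ ψ : ℝ → ℝ}

/-- The quotient is singular only at t = 0, where the factor `χ` vanishes identically. -/
lemma contDiff_selfSimilar (hχ : ContDiff ℝ ∞ χ) (hχ0 : ∀ t, t ≤ 1 → χ t = 0)
    (hψ : ContDiff ℝ ∞ ψ) : ContDiff ℝ ∞ (fun p : ℝ × ℝ => χ p.2 * ψ (p.1 / p.2)) := by
  rw [contDiff_iff_contDiffAt]
  intro p
  rcases lt_or_ge p.2 1 with h | h
  · have : (fun p : ℝ × ℝ => χ p.2 * ψ (p.1 / p.2)) =ᶠ[𝓝 p] fun _ => 0 := by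
      filter_upwards [continuous_snd.continuousAt.eventually (gt_mem_nhds h)] with q hq
      simp [hχ0 q.2 (le_of_lt hq)]
    exact contDiffAt_const.congr_of_eventuallyEq this
  · have h0 : p.2 ≠ 0 := by linarith
    exact (hχ.contDiffAt.comp p contDiffAt_snd).mul
      (hψ.contDiffAt.comp p (contDiffAt_fst.div contDiffAt_snd h0))

lemma hasCompactSupport_selfSimilar (hχ0 : ∀ t, t ≤ 1 → χ t = 0) (hχ : HasCompactSupport χ)
    (hψ : HasCompactSupport ψ) :
    HasCompactSupport (fun p : ℝ × ℝ => χ p.2 * ψ (p.1 / p.2)) := by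
  have hK : IsCompact ((fun q : ℝ × ℝ => (q.1 * q.2, q.2)) '' (tsupport ψ ×ˢ tsupport χ)) :=
    (hψ.isCompact.prod hχ.isCompact).image (by fun_prop)
  refine HasCompactSupport.of_support_subset_isCompact hK fun p hp => ?_
  have h1 : χ p.2 ≠ 0 := left_ne_zero_of_mul hp
  have h2 : ψ (p.1 / p.2) ≠ 0 := right_ne_zero_of_mul hp
  have h0 : p.2 ≠ 0 := by
    rintro h
    exact h1 (hχ0 _ (by linarith))
  exact ⟨(p.1 / p.2, p.2), ⟨subset_tsupport _ h2, subset_tsupport _ h1⟩,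
    Prod.ext (div_mul_cancel₀ _ h0) rfl⟩

/-- The derivatives are sums of products of a function of t and a function of x/t, so the space-time
integral separates after the substitution ξ = x/t. -/
lemma fderiv_selfSimilar (hχ : ContDiff ℝ ∞ χ) (hχ0 : ∀ t, t ≤ 1 → χ t = 0)
    (hψ : ContDiff ℝ ∞ ψ) {x t : ℝ} (ht : 0 < t) :
    fderiv ℝ (fun p : ℝ × ℝ => χ p.2 * ψ (p.1 / p.2)) (x, t) (0, 1)
        = deriv χ t * ψ (x / t) - χ t / t * (x / t * deriv ψ (x / t)) ∧
    fderiv ℝ (fun p : ℝ × ℝ => χ p.2 * ψ (p.1 / p.2)) (x, t) (1, 0)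
        = χ t / t * deriv ψ (x / t) := by
  have hd : DifferentiableAt ℝ (fun p : ℝ × ℝ => χ p.2 * ψ (p.1 / p.2)) (x, t) :=
    ((contDiff_selfSimilar hχ hχ0 hψ).differentiable (by simp)).differentiableAt
  have hχ' : HasDerivAt χ (deriv χ t) t := (hχ.differentiable (by simp) t).hasDerivAt
  have hψ' : HasDerivAt ψ (deriv ψ (x / t)) (x / t) :=
    (hψ.differentiable (by simp) _).hasDerivAt
  constructor
  · have h1 : HasDerivAt (fun s : ℝ => ((x, s) : ℝ × ℝ)) (0, 1) t :=
      (hasDerivAt_const t x).prodMk (hasDerivAt_id t)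
    have h2 : HasDerivAt (fun s => χ s * ψ (x / s)) _ t :=
      HasFDerivAt.comp_hasDerivAt (l := fun p : ℝ × ℝ => χ p.2 * ψ (p.1 / p.2)) t
        hd.hasFDerivAt h1
    have h3 : HasDerivAt (fun s => x / s) (x * -(t ^ 2)⁻¹) t :=
      (hasDerivAt_inv ht.ne').const_mul x
    have h4 : HasDerivAt (fun s => ψ (x / s)) _ t := hψ'.comp t h3
    rw [h2.unique (hχ'.mul h4)]
    field_simp
    ring
  · have h1 : HasDerivAt (fun s : ℝ => ((s, t) : ℝ × ℝ)) (1, 0) x :=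
      (hasDerivAt_id x).prodMk (hasDerivAt_const x t)
    have h2 : HasDerivAt (fun s => χ t * ψ (s / t)) _ x :=
      HasFDerivAt.comp_hasDerivAt (l := fun p : ℝ × ℝ => χ p.2 * ψ (p.1 / p.2)) x
        hd.hasFDerivAt h1
    have h3 : HasDerivAt (fun s => s / t) (1 / t) x := (hasDerivAt_id x).div_const t
    have h4 : HasDerivAt (fun s => ψ (s / t)) _ x := hψ'.comp x h3
    rw [h2.unique (h4.const_mul (χ t))]
    ring

end SelfSimilar

/-! ### The entropy inequality for the profile of a self-similar solution -/

section WeakProfile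

variable {N : ℕ} {f : State N → State N} {𝒰 : Set (State N)} {U F : State N → ℝ}

/-- A self-similar solution takes its values in a compact subset of `𝒰`, and its profile is
measurable. -/
lemma IsEntropySolution.profile {u₀ : ℝ → State N} {σ : ℝ → State N}
    (hs : IsEntropySolution f 𝒰 u₀ (fun x t => σ (x / t))) :
    Measurable σ ∧ ∃ C : Set (State N), IsCompact C ∧ C ⊆ 𝒰 ∧ ∀ ξ, σ ξ ∈ C := by
  obtain ⟨hm, ⟨C, hC, hC𝒰, hmem⟩, -⟩ := hs
  refine ⟨?_, C, hC, hC𝒰, fun ξ => by simpa using hmem ξ 1 one_pos⟩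
  have := hm.comp (measurable_id.prodMk (measurable_const (a := (1 : ℝ))))
  simpa [Function.comp_def] using this

/-- The entropy inequality `(F(σ) - ξ U(σ))' + U(σ) ≤ 0` for the profile of a self-similar
solution, in the weak sense. -/
lemma IsEntropySolution.weak_profile {u₀ : ℝ → State N} {σ : ℝ → State N}
    (hs : IsEntropySolution f 𝒰 u₀ (fun x t => σ (x / t)))
    (hp : IsConvexEntropyPair f 𝒰 U F) {ψ : ℝ → ℝ} (hψ : ContDiff ℝ ∞ ψ)
    (hψc : HasCompactSupport ψ) (hψ0 : ∀ ξ, 0 ≤ ψ ξ) :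
    0 ≤ ∫ ξ, ((F (σ ξ) - ξ * U (σ ξ)) * deriv ψ ξ - U (σ ξ) * ψ ξ) := by
  obtain ⟨hσ, C, hC, hC𝒰, hmem⟩ := hs.profile
  -- Supported in [1, 3]: away from t = 0, so that the initial term drops out of the weak
  -- formulation.
  let b : ContDiffBump (2 : ℝ) := ⟨1 / 2, 1, by norm_num, by norm_num⟩
  set χ : ℝ → ℝ := fun t => b t with hχdef
  have hχ : ContDiff ℝ ∞ χ := b.contDiff
  have hχc : HasCompactSupport χ := b.hasCompactSupport
  have hχ0 : ∀ t, t ≤ 1 → χ t = 0 := fun t ht => b.zero_of_le_dist (by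
    rw [Real.dist_eq, abs_sub_comm]
    exact le_trans (show b.rOut ≤ 2 - t by change (1 : ℝ) ≤ 2 - t; linarith) (le_abs_self _))
  have hUm : Measurable fun ξ => U (σ ξ) :=
    hp.continuousOn_entropy.measurable_comp_of_mem hσ fun ξ => hC𝒰 (hmem ξ)
  have hFm : Measurable fun ξ => F (σ ξ) :=
    hp.continuousOn_flux.measurable_comp_of_mem hσ fun ξ => hC𝒰 (hmem ξ)
  obtain ⟨MU, hMU⟩ := hC.exists_bound_of_continuousOn (hp.continuousOn_entropy.mono hC𝒰)
  obtain ⟨MF, hMF⟩ := hC.exists_bound_of_continuousOn (hp.continuousOn_flux.mono hC𝒰)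
  have hint : ∀ {k : ℝ → ℝ}, Continuous k → HasCompactSupport k →
      Integrable (fun ξ => U (σ ξ) * k ξ) ∧ Integrable (fun ξ => F (σ ξ) * k ξ) :=
    fun hk hkc => ⟨(hk.integrable_of_hasCompactSupport hkc).bdd_mul hUm.aestronglyMeasurable
        (Eventually.of_forall fun ξ => hMU _ (hmem ξ)),
      (hk.integrable_of_hasCompactSupport hkc).bdd_mul hFm.aestronglyMeasurable
        (Eventually.of_forall fun ξ => hMF _ (hmem ξ))⟩
  have hψ' : Continuous (deriv ψ) := hψ.continuous_deriv (by simp)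
  have hA : Integrable fun ξ => U (σ ξ) * ψ ξ := (hint hψ.continuous hψc).1
  have hB : Integrable fun ξ => (F (σ ξ) - ξ * U (σ ξ)) * deriv ψ ξ := by
    have h1 := (hint hψ' hψc.deriv).2
    have h2 := (hint (k := fun ξ => ξ * deriv ψ ξ) (by fun_prop) hψc.deriv.mul_left).1
    refine (h1.sub h2).congr (Eventually.of_forall fun ξ => ?_)
    simp only [Pi.sub_apply]; ring
  rw [integral_sub hB hA]
  set A := ∫ ξ, U (σ ξ) * ψ ξ
  set B := ∫ ξ, (F (σ ξ) - ξ * U (σ ξ)) * deriv ψ ξ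
  set φ : ℝ × ℝ → ℝ := fun p => χ p.2 * ψ (p.1 / p.2) with hφdef
  have hφ : ContDiff ℝ ∞ φ := contDiff_selfSimilar hχ hχ0 hψ
  have hφc : HasCompactSupport φ := hasCompactSupport_selfSimilar hχ0 hχc hψc
  have hweak := hs.2.2 U F hp φ hφ hφc fun p => mul_nonneg b.nonneg (hψ0 _)
  have hinit : ∫ x : ℝ, U (u₀ x) * φ (x, 0) = 0 := by simp [hφdef, hχ0 0 zero_le_one]
  rw [hinit, add_zero] at hweak
  have hset : {p : ℝ × ℝ | 0 < p.2} = univ ×ˢ Ioi (0 : ℝ) := by ext; simp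
  have hdφ : Continuous (fderiv ℝ φ) := hφ.continuous_fderiv (by simp)
  have hdφi : ∀ v : ℝ × ℝ, Integrable fun p => fderiv ℝ φ p v := fun v =>
    (hdφ.clm_apply continuous_const).integrable_of_hasCompactSupport
      (hφc.fderiv_apply (𝕜 := ℝ) v)
  have hquot : Measurable fun p : ℝ × ℝ => p.1 / p.2 := measurable_fst.div measurable_snd
  have hI : Integrable (fun p : ℝ × ℝ => U (σ (p.1 / p.2)) * fderiv ℝ φ p (0, 1)
      + F (σ (p.1 / p.2)) * fderiv ℝ φ p (1, 0)) :=
    ((hdφi _).bdd_mul (hUm.comp hquot).aestronglyMeasurable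
      (Eventually.of_forall fun p => hMU _ (hmem _))).add
    ((hdφi _).bdd_mul (hFm.comp hquot).aestronglyMeasurable
      (Eventually.of_forall fun p => hMF _ (hmem _)))
  have hmeas : (volume : Measure (ℝ × ℝ)).restrict (univ ×ˢ Ioi (0 : ℝ))
      = (volume : Measure ℝ).prod (volume.restrict (Ioi (0 : ℝ))) := by
    rw [Measure.volume_eq_prod, ← Measure.prod_restrict, Measure.restrict_univ]
  have hIr := hI.restrict (s := univ ×ˢ Ioi (0 : ℝ))
  rw [hset, hmeas, integral_prod_symm _ (hmeas ▸ hIr)] at hweak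
  -- Substituting ξ = x/t contributes a factor t and leaves the two constants `A` and `B`.
  have hinner : ∀ t ∈ Ioi (0 : ℝ), (∫ x, (U (σ (x / t)) * fderiv ℝ φ (x, t) (0, 1)
      + F (σ (x / t)) * fderiv ℝ φ (x, t) (1, 0))) = A * (t * deriv χ t) + B * χ t := by
    intro t ht
    have ht0 : 0 < t := ht
    have h1 : ∀ x, U (σ (x / t)) * fderiv ℝ φ (x, t) (0, 1)
        + F (σ (x / t)) * fderiv ℝ φ (x, t) (1, 0)
        = (fun ξ => deriv χ t * (U (σ ξ) * ψ ξ)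
          + χ t / t * ((F (σ ξ) - ξ * U (σ ξ)) * deriv ψ ξ)) (x / t) := fun x => by
      rw [(fderiv_selfSimilar hχ hχ0 hψ ht0).1, (fderiv_selfSimilar hχ hχ0 hψ ht0).2]
      ring
    refine (integral_congr_ae (Eventually.of_forall h1)).trans ?_
    refine (Measure.integral_comp_div (fun ξ => deriv χ t * (U (σ ξ) * ψ ξ)
      + χ t / t * ((F (σ ξ) - ξ * U (σ ξ)) * deriv ψ ξ)) t).trans ?_
    rw [integral_add (hA.const_mul _) (hB.const_mul _),
      integral_const_mul, integral_const_mul, abs_of_pos ht0, smul_eq_mul]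
    change t * (deriv χ t * A + χ t / t * B) = _
    field_simp
  rw [setIntegral_congr_fun measurableSet_Ioi hinner] at hweak
  have hχ' : Continuous (deriv χ) := hχ.continuous_deriv (by simp)
  have hi1 : Integrable fun t => t * deriv χ t :=
    (continuous_id.mul hχ').integrable_of_hasCompactSupport hχc.deriv.mul_left
  have hi2 : Integrable χ := hχ.continuous.integrable_of_hasCompactSupport hχc
  have hext : ∫ t in Ioi (0 : ℝ), (A * (t * deriv χ t) + B * χ t)
      = ∫ t, (A * (t * deriv χ t) + B * χ t) := by
    refine setIntegral_eq_integral_of_forall_compl_eq_zero fun t ht => ?_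
    have ht' : t < 1 := by
      have : t ≤ 0 := by simpa using ht
      linarith
    have hd0 : deriv χ t = 0 := by
      have : χ =ᶠ[𝓝 t] fun _ => 0 := by
        filter_upwards [gt_mem_nhds ht'] with q hq using hχ0 q hq.le
      rw [this.deriv_eq, deriv_const]
    simp [hd0, hχ0 t ht'.le]
  -- The integrand is the derivative of t χ(t). Hence the weak inequality reduces to (B - A) ∫ χ ≥
  -- 0.
  have hparts : ∫ t, (t * deriv χ t + χ t) = 0 := by
    refine integral_eq_zero_of_hasDerivAt_of_integrable (f := fun t => t * χ t) (fun t => ?_)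
      (hi1.add hi2)
      ((continuous_id.mul hχ.continuous).integrable_of_hasCompactSupport hχc.mul_left)
    have h4 : HasDerivAt (fun t => t * χ t) (1 * χ t + t * deriv χ t) t :=
      (hasDerivAt_id t).mul (hχ.differentiable (by simp) t).hasDerivAt
    rwa [one_mul, add_comm] at h4
  rw [integral_add hi1 hi2] at hparts
  rw [hext, integral_add (hi1.const_mul _) (hi2.const_mul _), integral_const_mul,
    integral_const_mul] at hweak
  have hpos : 0 < ∫ t, χ t := b.integral_pos
  have h3 : 0 ≤ (B - A) * ∫ t, χ t := by
    have : ∫ t, t * deriv χ t = -∫ t, χ t := by linarith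
    rw [this] at hweak
    linarith
  exact nonneg_of_mul_nonneg_left h3 hpos

end WeakProfile

/-! ### Half-line entropy balances of a profile -/

section Profile

variable {p q : ℝ → ℝ} {M s : ℝ}

lemma intervalIntegrable_of_bounded (hp : Measurable p) (hM : ∀ ξ, |p ξ| ≤ M) (a b : ℝ) :
    IntervalIntegrable p volume a b := by
  rw [intervalIntegrable_iff]
  exact Measure.integrableOn_of_bounded (M := M) (by simp) hp.aestronglyMeasurable
    (Eventually.of_forall fun x => hM x)

/-- The weak inequality `(q - ξ p)' + p ≤ 0`, tested with a function which is constant outside a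
bounded interval, when `p` and `q` are constant there. -/
lemma profile_test (hp : Measurable p) (hpM : ∀ ξ, |p ξ| ≤ M) (hq : Measurable q)
    (hqM : ∀ ξ, |q ξ| ≤ M)
    (hweak : ∀ ψ : ℝ → ℝ, ContDiff ℝ ∞ ψ → HasCompactSupport ψ → (∀ ξ, 0 ≤ ψ ξ) →
      0 ≤ ∫ ξ, ((q ξ - ξ * p ξ) * deriv ψ ξ - p ξ * ψ ξ))
    {Λ pl ql pr qr : ℝ} (hs : Λ < s) (hs0 : 0 < s)
    (hl : ∀ ξ, ξ < -Λ → p ξ = pl ∧ q ξ = ql) (hr : ∀ ξ, Λ < ξ → p ξ = pr ∧ q ξ = qr)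
    {ϑ : ℝ → ℝ} (hϑ : ContDiff ℝ ∞ ϑ) (hϑ0 : ∀ ξ, 0 ≤ ϑ ξ) {cl cr : ℝ}
    (hϑl : ∀ ξ, ξ < 0 → ϑ ξ = cl) (hϑr : ∀ ξ, s / 2 < ξ → ϑ ξ = cr) :
    0 ≤ cl * (s * pl + ql) + cr * (s * pr - qr)
      + ∫ ξ in -s..s, ((q ξ - ξ * p ξ) * deriv ϑ ξ - p ξ * ϑ ξ) := by
  -- The cut-off equals 1 on a neighbourhood of [-s, s], so it acts only where `p`, `q` and `ϑ` are
  -- constant.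
  let κ : ContDiffBump (0 : ℝ) := ⟨s + 1, s + 2, by linarith, by linarith⟩
  have hκ : ContDiff ℝ ∞ (fun ξ => κ ξ) := κ.contDiff
  have hκ1 : ∀ ξ, |ξ| < s + 1 → (fun ξ => κ ξ) =ᶠ[𝓝 ξ] fun _ => 1 := fun ξ h =>
    κ.eventuallyEq_one_of_mem_ball (by simpa [Real.dist_eq] using h)
  have hκ0 : ∀ ξ, s + 2 ≤ |ξ| → κ ξ = 0 := fun ξ h =>
    κ.zero_of_le_dist (by simpa [Real.dist_eq] using h)
  set ψ : ℝ → ℝ := fun ξ => κ ξ * ϑ ξ with hψdef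
  have hψ : ContDiff ℝ ∞ ψ := hκ.mul hϑ
  have hψc : HasCompactSupport ψ := HasCompactSupport.mul_right κ.hasCompactSupport
  have hw := hweak ψ hψ hψc fun ξ => mul_nonneg κ.nonneg (hϑ0 ξ)
  set G : ℝ → ℝ := fun ξ => (q ξ - ξ * p ξ) * deriv ψ ξ - p ξ * ψ ξ with hG
  have hsupp : Function.support G ⊆ Ioc (-(s + 3)) (s + 3) := by
    intro ξ hξ
    by_contra hout
    have habs : s + 2 < |ξ| := by
      rw [mem_Ioc, not_and_or, not_lt, not_le] at hout
      rcases hout with h | h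
      · have := neg_le_abs ξ; linarith
      · have := le_abs_self ξ; linarith
    have hz : ψ =ᶠ[𝓝 ξ] fun _ => 0 := by
      filter_upwards [continuous_abs.continuousAt.eventually (lt_mem_nhds habs)] with x hx
      simp [hψdef, hκ0 x (le_of_lt hx)]
    exact hξ (by simp [hG, hz.deriv_eq, hz.eq_of_nhds])
  rw [← intervalIntegral.integral_eq_integral_of_support_subset hsupp] at hw
  have hpi := intervalIntegrable_of_bounded hp hpM
  have hqi := intervalIntegrable_of_bounded hq hqM
  have hψ' : Continuous (deriv ψ) := hψ.continuous_deriv (by simp)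
  have hGi : ∀ a b, IntervalIntegrable G volume a b := fun a b =>
    ((((hqi a b).sub ((hpi a b).continuousOn_mul continuousOn_id)).mul_continuousOn
      hψ'.continuousOn)).sub ((hpi a b).mul_continuousOn hψ.continuous.continuousOn)
  rw [← intervalIntegral.integral_add_adjacent_intervals (hGi _ (-s)) (hGi _ _),
    ← intervalIntegral.integral_add_adjacent_intervals (hGi (-s) s) (hGi _ _)] at hw
  -- With constant data the integrand is the exact derivative of (d - ξ e) κ(ξ) c. The outer pieces
  -- therefore reduce to boundary values at ±s.
  have hFTC : ∀ a b c d e : ℝ, ∫ ξ in a..b, (((d - ξ * e) * deriv (fun ξ => κ ξ) ξ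
      - e * κ ξ) * c) = ((d - b * e) * κ b - (d - a * e) * κ a) * c := by
    intro a b c d e
    have hκ' : Continuous (deriv fun ξ => κ ξ) := hκ.continuous_deriv (by simp)
    have hκc : Continuous fun ξ => κ ξ := hκ.continuous
    rw [intervalIntegral.integral_mul_const]
    congr 1
    refine intervalIntegral.integral_eq_sub_of_hasDerivAt (f := fun ξ => (d - ξ * e) * κ ξ)
      (fun ξ _ => ?_) (Continuous.intervalIntegrable (by fun_prop) _ _)
    have h1 : HasDerivAt (fun ξ : ℝ => d - ξ * e) (-(1 * e)) ξ :=
      ((hasDerivAt_id ξ).mul_const e).const_sub d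
    have h2 : HasDerivAt (fun ξ => (d - ξ * e) * κ ξ)
        (-(1 * e) * κ ξ + (d - ξ * e) * deriv (fun ξ => κ ξ) ξ) ξ :=
      h1.mul (hκ.differentiable (by simp) ξ).hasDerivAt
    rwa [show (d - ξ * e) * deriv (fun ξ => κ ξ) ξ - e * κ ξ
      = -(1 * e) * κ ξ + (d - ξ * e) * deriv (fun ξ => κ ξ) ξ by ring]
  have hconst : ∀ ξ c, ϑ =ᶠ[𝓝 ξ] (fun _ => c) →
      deriv ψ ξ = deriv (fun ξ => κ ξ) ξ * c ∧ ψ ξ = κ ξ * c := fun ξ c h => by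
    have : ψ =ᶠ[𝓝 ξ] fun x => κ x * c := by
      filter_upwards [h] with x hx
      simp [hψdef, hx]
    exact ⟨by rw [this.deriv_eq, deriv_mul_const (hκ.differentiable (by simp) ξ)],
      this.eq_of_nhds⟩
  have hleft : ∫ ξ in -(s + 3)..-s, G ξ = cl * (s * pl + ql) := by
    have : EqOn G (fun ξ => ((ql - ξ * pl) * deriv (fun ξ => κ ξ) ξ - pl * κ ξ) * cl)
        (uIcc (-(s + 3)) (-s)) := fun ξ hξ => by
      rw [uIcc_of_le (by linarith)] at hξ
      have h1 := hl ξ (by linarith [hξ.2])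
      have h2 := hconst ξ cl (by
        filter_upwards [gt_mem_nhds (show ξ < 0 by linarith [hξ.2])] with x hx using hϑl x hx)
      simp only [hG, h1.1, h1.2, h2.1, h2.2]
      ring
    rw [intervalIntegral.integral_congr this, hFTC, hκ0 (-(s + 3))
      (by rw [abs_neg, abs_of_pos] <;> linarith),
      (hκ1 (-s) (by rw [abs_neg, abs_of_pos] <;> linarith)).eq_of_nhds]
    ring
  have hright : ∫ ξ in s..s + 3, G ξ = cr * (s * pr - qr) := by
    have : EqOn G (fun ξ => ((qr - ξ * pr) * deriv (fun ξ => κ ξ) ξ - pr * κ ξ) * cr)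
        (uIcc s (s + 3)) := fun ξ hξ => by
      rw [uIcc_of_le (by linarith)] at hξ
      have h1 := hr ξ (by linarith [hξ.1])
      have h2 := hconst ξ cr (by
        filter_upwards [lt_mem_nhds (show s / 2 < ξ by linarith [hξ.1])] with x hx
          using hϑr x hx)
      simp only [hG, h1.1, h1.2, h2.1, h2.2]
      ring
    rw [intervalIntegral.integral_congr this, hFTC, hκ0 (s + 3) (by rw [abs_of_pos] <;> linarith),
      (hκ1 s (by rw [abs_of_pos] <;> linarith)).eq_of_nhds]
    ring
  have hmid : ∫ ξ in -s..s, G ξ = ∫ ξ in -s..s, ((q ξ - ξ * p ξ) * deriv ϑ ξ - p ξ * ϑ ξ) := by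
    refine intervalIntegral.integral_congr fun ξ hξ => ?_
    rw [uIcc_of_le (by linarith)] at hξ
    have h1 := hκ1 ξ (by rw [abs_lt]; constructor <;> linarith [hξ.1, hξ.2])
    have h2 : ψ =ᶠ[𝓝 ξ] ϑ := by
      filter_upwards [h1] with x hx
      simp [hψdef, hx]
    simp only [hG, h2.deriv_eq, h2.eq_of_nhds]
  rw [hleft, hright, hmid] at hw
  linarith

/-- A smooth monotone transition from `0` on `(-∞, ε]` to `1` on `[2 ε, ∞)`. -/
lemma exists_transition {ε : ℝ} (hε : 0 < ε) :
    ∃ ρ : ℝ → ℝ, ContDiff ℝ ∞ ρ ∧ (∀ ξ, 0 ≤ ρ ξ) ∧ (∀ ξ, ρ ξ ≤ 1) ∧ (∀ ξ, ξ ≤ ε → ρ ξ = 0) ∧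
      (∀ ξ, 2 * ε ≤ ξ → ρ ξ = 1) ∧ ∀ ξ, 0 ≤ deriv ρ ξ := by
  refine ⟨fun ξ => Real.smoothTransition (ξ / ε - 1),
    Real.smoothTransition.contDiff.comp (by fun_prop), fun ξ => Real.smoothTransition.nonneg _,
    fun ξ => Real.smoothTransition.le_one _, fun ξ h => ?_, fun ξ h => ?_, fun ξ => ?_⟩
  · refine Real.smoothTransition.zero_of_nonpos ?_
    rw [sub_nonpos, div_le_one hε]
    exact h
  · refine Real.smoothTransition.one_of_one_le ?_
    rw [le_sub_iff_add_le, le_div_iff₀ hε]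
    linarith
  · refine Monotone.deriv_nonneg (fun a b hab => Real.smoothTransition.monotone ?_)
    gcongr

/-- The weak inequality is tested with smoothed Heaviside functions that jump just to the right of
0. Both `ρ` and `1 - ρ` have their jump there, so the right limit `q0` appears on both sides of the
interface and no left limit of `q` is needed. -/
lemma profile_bounds (hp : Measurable p) (hpM : ∀ ξ, |p ξ| ≤ M) (hq : Measurable q)
    (hqM : ∀ ξ, |q ξ| ≤ M)
    (hweak : ∀ ψ : ℝ → ℝ, ContDiff ℝ ∞ ψ → HasCompactSupport ψ → (∀ ξ, 0 ≤ ψ ξ) →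
      0 ≤ ∫ ξ, ((q ξ - ξ * p ξ) * deriv ψ ξ - p ξ * ψ ξ))
    {Λ pl ql pr qr q0 : ℝ} (hs : Λ < s) (hs0 : 0 < s)
    (hl : ∀ ξ, ξ < -Λ → p ξ = pl ∧ q ξ = ql) (hr : ∀ ξ, Λ < ξ → p ξ = pr ∧ q ξ = qr)
    (hq0 : Tendsto q (𝓝[>] 0) (𝓝 q0)) :
    ∫ ξ in (0 : ℝ)..s, p ξ ≤ s * pr - qr + q0 ∧
      ∫ ξ in -s..0, p ξ ≤ s * pl + ql - q0 := by
  have hM : 0 ≤ M := (abs_nonneg _).trans (hpM 0)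
  have hpi := intervalIntegrable_of_bounded hp hpM
  have hqi := intervalIntegrable_of_bounded hq hqM
  set g : ℝ → ℝ := fun ξ => q ξ - ξ * p ξ with hg
  have hgi : ∀ a b, IntervalIntegrable g volume a b := fun a b =>
    (hqi a b).sub ((hpi a b).continuousOn_mul continuousOn_id)
  have hg0 : Tendsto g (𝓝[>] 0) (𝓝 q0) := by
    have h1 : Tendsto (fun ξ : ℝ => ξ * p ξ) (𝓝[>] 0) (𝓝 0) := by
      refine squeeze_zero_norm' (a := fun ξ : ℝ => |ξ| * M) (Eventually.of_forall fun ξ => ?_) ?_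
      · rw [norm_mul, Real.norm_eq_abs, Real.norm_eq_abs]
        gcongr
        exact hpM ξ
      · have : Tendsto (fun ξ : ℝ => |ξ| * M) (𝓝 0) (𝓝 (|0| * M)) :=
          (by fun_prop : Continuous fun ξ : ℝ => |ξ| * M).tendsto 0
        rw [abs_zero, zero_mul] at this
        exact this.mono_left nhdsWithin_le_nhds
    simpa [hg] using hq0.sub h1
  have key : ∀ η : ℝ, 0 < η → ∫ ξ in (0 : ℝ)..s, p ξ ≤ s * pr - qr + q0 + η ∧
      ∫ ξ in -s..0, p ξ ≤ s * pl + ql - q0 + η := by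
    intro η hη
    have hη2 : 0 < η / 2 := by linarith
    have hev : ∀ᶠ ξ in 𝓝[>] (0 : ℝ), |g ξ - q0| < η / 2 := by
      have := Metric.tendsto_nhds.1 hg0 _ hη2
      simpa [Real.dist_eq] using this
    obtain ⟨r, hr0, hrg⟩ := (mem_nhdsGT_iff_exists_Ioo_subset).1 hev
    have hr0' : (0 : ℝ) < r := hr0
    -- The three bounds place the transition where `g` is close to `q0`, make it end before `s / 2`
    -- as `profile_test` requires, and make the integral of `p` over [0, 2ε] negligible.
    obtain ⟨ε, hε, hεr, hεs, hεM⟩ : ∃ ε : ℝ, 0 < ε ∧ 2 * ε ≤ r ∧ 2 * ε ≤ s / 2 ∧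
        2 * ε * M ≤ η / 2 := by
      refine ⟨min (r / 2) (min (s / 4) (η / (4 * (M + 1)))), by positivity, ?_, ?_, ?_⟩
      · linarith [min_le_left (r / 2) (min (s / 4) (η / (4 * (M + 1))))]
      · linarith [(min_le_right (r / 2) (min (s / 4) (η / (4 * (M + 1))))).trans
          (min_le_left _ _)]
      · have h1 := (min_le_right (r / 2) (min (s / 4) (η / (4 * (M + 1))))).trans
          (min_le_right _ _)
        have h2 : 2 * (η / (4 * (M + 1))) * M ≤ η / 2 := by
          have : 2 * (η / (4 * (M + 1))) * M = η / 2 * (M / (M + 1)) := by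
            field_simp; ring
          rw [this]
          have : M / (M + 1) ≤ 1 := by rw [div_le_one (by linarith)]; linarith
          nlinarith
        exact (by gcongr : _ ≤ 2 * (η / (4 * (M + 1))) * M).trans h2
    obtain ⟨ρ, hρ, hρ0, hρ1, hρl, hρr, hρ'⟩ := exists_transition hε
    have hρc : Continuous ρ := hρ.continuous
    have hρ'c : Continuous (deriv ρ) := hρ.continuous_deriv (by simp)
    have hd0 : ∀ ξ, ξ < ε → deriv ρ ξ = 0 := fun ξ h => by
      have : ρ =ᶠ[𝓝 ξ] fun _ => 0 := by
        filter_upwards [gt_mem_nhds h] with x hx using hρl x hx.le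
      rw [this.deriv_eq, deriv_const]
    have hd1 : ∀ ξ, 2 * ε < ξ → deriv ρ ξ = 0 := fun ξ h => by
      have : ρ =ᶠ[𝓝 ξ] fun _ => 1 := by
        filter_upwards [lt_mem_nhds h] with x hx using hρr x hx.le
      rw [this.deriv_eq, deriv_const]
    -- The endpoint is treated separately because `2 * ε = r` is possible, and the control of `g` is
    -- on an open interval.
    have hd2 : deriv ρ (2 * ε) = 0 := by
      have h1 : deriv ρ (2 * ε) ∈ closure {x : ℝ | x = 0} := by
        refine mem_closure_of_tendsto (f := deriv ρ) (b := 𝓝[>] (2 * ε))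
          (hρ'c.continuousAt.mono_left nhdsWithin_le_nhds) ?_
        filter_upwards [self_mem_nhdsWithin] with x hx using hd1 x hx
      simpa using h1
    have hgρ : ∀ a b, IntervalIntegrable (fun ξ => g ξ * deriv ρ ξ) volume a b := fun a b =>
      (hgi a b).mul_continuousOn hρ'c.continuousOn
    have hpρ : ∀ a b, IntervalIntegrable (fun ξ => p ξ * ρ ξ) volume a b := fun a b =>
      (hpi a b).mul_continuousOn hρc.continuousOn
    have hFTC : ∫ ξ in -s..s, deriv ρ ξ = 1 := by
      rw [intervalIntegral.integral_deriv_eq_sub (fun x _ => hρ.differentiable (by simp) x)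
        (hρ'c.intervalIntegrable _ _), hρr s (by linarith), hρl (-s) (by linarith), sub_zero]
    have hgb : |(∫ ξ in -s..s, g ξ * deriv ρ ξ) - q0| ≤ η / 2 := by
      have h1 : (∫ ξ in -s..s, g ξ * deriv ρ ξ) - q0
          = ∫ ξ in -s..s, (g ξ - q0) * deriv ρ ξ := by
        have h3 : IntervalIntegrable (fun ξ => q0 * deriv ρ ξ) volume (-s) s :=
          (continuous_const.mul hρ'c).intervalIntegrable _ _
        simp_rw [sub_mul]
        rw [intervalIntegral.integral_sub (hgρ _ _) h3, intervalIntegral.integral_const_mul,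
          hFTC, mul_one]
      have h2 : ∫ ξ in -s..s, η / 2 * deriv ρ ξ = η / 2 := by
        rw [intervalIntegral.integral_const_mul,
          hFTC, mul_one]
      rw [h1, ← Real.norm_eq_abs]
      refine (intervalIntegral.norm_integral_le_of_norm_le (g := fun ξ => η / 2 * deriv ρ ξ)
        (by linarith) (Eventually.of_forall fun ξ _ => ?_)
        ((continuous_const.mul hρ'c).intervalIntegrable _ _)).trans_eq h2
      rw [norm_mul, Real.norm_of_nonneg (hρ' ξ)]
      rcases lt_or_ge ξ ε with hξ | hξ
      · simp [hd0 ξ hξ]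
      rcases lt_or_ge ξ (2 * ε) with hξ' | hξ'
      · exact mul_le_mul_of_nonneg_right
          (hrg ⟨hε.trans_le hξ, hξ'.trans_le hεr⟩ : |g ξ - q0| < η / 2).le (hρ' ξ)
      · have : deriv ρ ξ = 0 := by
          rcases hξ'.eq_or_lt with h | h
          · rw [← h, hd2]
          · exact hd1 ξ h
        simp [this]
    have hneg : ∫ ξ in -s..0, p ξ * ρ ξ = 0 := by
      rw [intervalIntegral.integral_congr (g := fun _ => 0) fun ξ hξ => ?_]
      · simp
      · rw [uIcc_of_le (by linarith)] at hξ
        simp [hρl ξ (hξ.2.trans hε.le)]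
    have hpb : |(∫ ξ in -s..s, p ξ * ρ ξ) - ∫ ξ in (0 : ℝ)..s, p ξ| ≤ η / 2 := by
      rw [← intervalIntegral.integral_add_adjacent_intervals (hpρ (-s) 0) (hpρ 0 s), hneg, zero_add,
        ← intervalIntegral.integral_sub (hpρ _ _) (hpi _ _),
        ← intervalIntegral.integral_add_adjacent_intervals (b := 2 * ε)
          ((hpρ _ _).sub (hpi _ _)) ((hpρ _ _).sub (hpi _ _))]
      have hz : ∫ ξ in 2 * ε..s, (p ξ * ρ ξ - p ξ) = 0 := by
        rw [intervalIntegral.integral_congr (g := fun _ => 0) fun ξ hξ => ?_]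
        · simp
        · rw [uIcc_of_le (by linarith)] at hξ
          simp [hρr ξ hξ.1]
      rw [hz, add_zero, ← Real.norm_eq_abs]
      refine (intervalIntegral.norm_integral_le_of_norm_le_const (C := M) fun ξ _ => ?_).trans ?_
      · rw [Real.norm_eq_abs, show p ξ * ρ ξ - p ξ = -(p ξ * (1 - ρ ξ)) by ring, abs_neg, abs_mul,
          abs_of_nonneg (sub_nonneg.2 (hρ1 ξ))]
        nlinarith [hpM ξ, hρ0 ξ, hρ1 ξ, abs_nonneg (p ξ)]
      · rw [sub_zero, abs_of_pos (by linarith)]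
        linarith
    have hsplit : ∫ ξ in -s..s, p ξ = (∫ ξ in -s..0, p ξ) + ∫ ξ in (0 : ℝ)..s, p ξ :=
      (intervalIntegral.integral_add_adjacent_intervals (hpi _ _) (hpi _ _)).symm
    have t1 := profile_test hp hpM hq hqM hweak hs hs0 hl hr hρ hρ0 (cl := 0) (cr := 1)
      (fun ξ h => hρl ξ (by linarith)) (fun ξ h => hρr ξ (by linarith))
    have t2 := profile_test hp hpM hq hqM hweak hs hs0 hl hr (ϑ := fun ξ => 1 - ρ ξ)
      (contDiff_const.sub hρ) (fun ξ => sub_nonneg.2 (hρ1 ξ)) (cl := 1) (cr := 0)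
      (fun ξ h => by simp [hρl ξ (by linarith)]) (fun ξ h => by simp [hρr ξ (by linarith)])
    have e1 : ∫ ξ in -s..s, ((q ξ - ξ * p ξ) * deriv ρ ξ - p ξ * ρ ξ)
        = (∫ ξ in -s..s, g ξ * deriv ρ ξ) - ∫ ξ in -s..s, p ξ * ρ ξ :=
      intervalIntegral.integral_sub (hgρ _ _) (hpρ _ _)
    have e2 : ∫ ξ in -s..s, ((q ξ - ξ * p ξ) * deriv (fun ξ => 1 - ρ ξ) ξ - p ξ * (1 - ρ ξ))
        = -(∫ ξ in -s..s, g ξ * deriv ρ ξ) - (∫ ξ in -s..s, p ξ)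
          + ∫ ξ in -s..s, p ξ * ρ ξ := by
      have h1 : IntervalIntegrable (fun ξ => -(g ξ * deriv ρ ξ)) volume (-s) s := (hgρ _ _).neg
      have h2 : IntervalIntegrable (fun ξ => -(g ξ * deriv ρ ξ) - p ξ) volume (-s) s :=
        h1.sub (hpi _ _)
      rw [← intervalIntegral.integral_neg, ← intervalIntegral.integral_sub h1 (hpi _ _),
        ← intervalIntegral.integral_add h2 (hpρ _ _)]
      refine intervalIntegral.integral_congr fun ξ _ => ?_
      simp only [deriv_const_sub, hg]
      ring
    rw [e1] at t1
    rw [e2, hsplit] at t2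
    rw [abs_le] at hgb hpb
    constructor <;> linarith [hgb.1, hgb.2, hpb.1, hpb.2]
  exact ⟨le_of_forall_pos_le_add fun η hη => (key η hη).1,
    le_of_forall_pos_le_add fun η hη => (key η hη).2⟩

end Profile

/-! ### Entropy inequality and consistency in one cell -/

section Cell

variable {N : ℕ} {f : State N → State N} {𝒰 𝒟 K : Set (State N)} {U F : State N → ℝ}
  {Λ lam s : ℝ} {R : State N → State N → State N} {v w r : State N} {σ : ℝ → State N}

/-- The relative entropy with respect to a fixed state is an entropy. -/
lemma IsConvexEntropyPair.relative (hp : IsConvexEntropyPair f 𝒰 U F) (h𝒰 : IsOpen 𝒰)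
    (hf : ContDiffOn ℝ ∞ f 𝒰) (a : State N) (ℓ : State N →L[ℝ] ℝ) :
    IsConvexEntropyPair f 𝒰 (fun z => U z - U a - ℓ (z - a)) (fun z => F z - ℓ (f z)) := by
  have hlin := isConvexEntropyPair_clm h𝒰 hf ℓ
  have hfU : ∀ u ∈ 𝒰, fderiv ℝ (fun z => U z - U a - ℓ (z - a)) u = fderiv ℝ U u - ℓ := by
    intro u hu
    have hd : DifferentiableAt ℝ U u :=
      (hp.contDiff_entropy.differentiableOn (by norm_num)).differentiableAt (h𝒰.mem_nhds hu)
    have h1 : HasFDerivAt (fun z => ℓ (z - a)) ℓ u :=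
      ℓ.hasFDerivAt.comp u ((hasFDerivAt_id u).sub_const a)
    exact ((hd.hasFDerivAt.sub_const (U a)).sub h1).fderiv
  refine ⟨?_, hp.contDiff_flux.sub hlin.contDiff_flux, fun u hu => ?_, fun u hu z => ?_⟩
  · exact (hp.contDiff_entropy.sub contDiffOn_const).sub
      (ℓ.contDiff.comp (contDiff_id.sub contDiff_const)).contDiffOn
  · have h1 : DifferentiableAt ℝ F u :=
      (hp.contDiff_flux.differentiableOn (by norm_num)).differentiableAt (h𝒰.mem_nhds hu)
    have h2 : DifferentiableAt ℝ (fun z => ℓ (f z)) u :=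
      (hlin.contDiff_flux.differentiableOn (by norm_num)).differentiableAt (h𝒰.mem_nhds hu)
    have h3 := hlin.compatible u hu
    rw [ℓ.fderiv] at h3
    rw [hfU u hu, ContinuousLinearMap.sub_comp, ← hp.compatible u hu, ← h3]
    exact (h1.hasFDerivAt.sub h2.hasFDerivAt).fderiv
  · have h1 : fderiv ℝ (fun z => U z - U a - ℓ (z - a)) =ᶠ[𝓝 u] fun x => fderiv ℝ U x - ℓ := by
      filter_upwards [h𝒰.mem_nhds hu] with x hx using hfU x hx
    rw [h1.fderiv_eq, fderiv_sub_const]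
    exact hp.hessian_nonneg u hu z

lemma IsRiemannSolution.value_mem (hσ : IsRiemannSolution f 𝒰 Λ v w σ)
    (hr : Tendsto σ (𝓝[>] 0) (𝓝 r)) : r ∈ 𝒰 := by
  obtain ⟨-, C, hC, hC𝒰, hmem⟩ := hσ.1.profile
  exact hC𝒰 (hC.isClosed.mem_of_tendsto hr (Eventually.of_forall hmem))

lemma IsRiemannSolution.intervalIntegrable (hσ : IsRiemannSolution f 𝒰 Λ v w σ)
    {g : State N → ℝ} (hg : ContinuousOn g 𝒰) (a b : ℝ) :
    IntervalIntegrable (fun ξ => g (σ ξ)) volume a b := by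
  obtain ⟨hm, C, hC, hC𝒰, hmem⟩ := hσ.1.profile
  obtain ⟨M, hM⟩ := hC.exists_bound_of_continuousOn (hg.mono hC𝒰)
  have h1 : Measurable fun ξ => g (σ ξ) := by
    have hcl : ContinuousOn g C := hg.mono hC𝒰
    exact hcl.measurable_comp_of_mem hm hmem
  exact intervalIntegrable_of_bounded h1 (fun ξ => hM _ (hmem ξ)) a b

/-- The entropy balance of a Riemann solution on the two sides of the interface. -/
lemma IsRiemannSolution.entropy_bounds (hσ : IsRiemannSolution f 𝒰 Λ v w σ)
    (hr : Tendsto σ (𝓝[>] 0) (𝓝 r)) (hs : Λ < s) (hs0 : 0 < s)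
    (hp : IsConvexEntropyPair f 𝒰 U F) (h𝒰 : IsOpen 𝒰) :
    ∫ ξ in (0 : ℝ)..s, U (σ ξ) ≤ s * U w - F w + F r ∧
      ∫ ξ in -s..0, U (σ ξ) ≤ s * U v + F v - F r := by
  obtain ⟨hm, C, hC, hC𝒰, hmem⟩ := hσ.1.profile
  obtain ⟨MU, hMU⟩ := hC.exists_bound_of_continuousOn (hp.continuousOn_entropy.mono hC𝒰)
  obtain ⟨MF, hMF⟩ := hC.exists_bound_of_continuousOn (hp.continuousOn_flux.mono hC𝒰)
  have hUm : Measurable fun ξ => U (σ ξ) :=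
    (hp.continuousOn_entropy.mono hC𝒰).measurable_comp_of_mem hm hmem
  have hFm : Measurable fun ξ => F (σ ξ) :=
    (hp.continuousOn_flux.mono hC𝒰).measurable_comp_of_mem hm hmem
  have hFc : ContinuousAt F r :=
    hp.continuousOn_flux.continuousAt (h𝒰.mem_nhds (hσ.value_mem hr))
  exact profile_bounds (M := max MU MF) hUm
    (fun ξ => (hMU _ (hmem ξ)).trans (le_max_left _ _)) hFm
    (fun ξ => (hMF _ (hmem ξ)).trans (le_max_right _ _))
    (fun ψ h1 h2 h3 => hσ.1.weak_profile hp h1 h2 h3) hs hs0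
    (fun ξ hξ => by rw [hσ.2.1 ξ hξ]; exact ⟨rfl, rfl⟩)
    (fun ξ hξ => by rw [hσ.2.2 ξ hξ]; exact ⟨rfl, rfl⟩) (hFc.tendsto.comp hr)

/-- The relative entropies of the two Riemann solutions which enter a cell are controlled by the
entropy dissipation in the cell. -/
lemma cell_relative_entropy {σl σr : ℝ → State N} {u rl rr : State N}
    (hl : IsRiemannSolution f 𝒰 Λ v u σl) (hrl : Tendsto σl (𝓝[>] 0) (𝓝 rl))
    (hr : IsRiemannSolution f 𝒰 Λ u w σr) (hrr : Tendsto σr (𝓝[>] 0) (𝓝 rr))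
    (h𝒰 : IsOpen 𝒰) (hf : ContDiffOn ℝ ∞ f 𝒰) (hlam : 0 < lam) (hCFL : lam * Λ < 1 / 2)
    (hp : IsConvexEntropyPair f 𝒰 U F) {a : State N} (ha : a = u - lam • f rr + lam • f rl) :
    lam * ((∫ ξ in (0 : ℝ)..1 / (2 * lam), (U (σl ξ) - U a - fderiv ℝ U a (σl ξ - a)))
        + ∫ ξ in -(1 / (2 * lam))..0, (U (σr ξ) - U a - fderiv ℝ U a (σr ξ - a)))
      ≤ U u - U a - lam * F rr + lam * F rl := by
  have hs0 : 0 < 1 / (2 * lam) := by positivity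
  -- At the end of a time step the middle of the cell is at ξ = ±1/(2 lam), so the stability
  -- condition keeps the waves of each interface inside the adjacent half cells.
  have hs : Λ < 1 / (2 * lam) := by
    rw [lt_div_iff₀ (by positivity)]; linarith
  have hrel := hp.relative h𝒰 hf a (fderiv ℝ U a)
  have h1 := (hl.entropy_bounds hrl hs hs0 hrel h𝒰).1
  have h2 := (hr.entropy_bounds hrr hs hs0 hrel h𝒰).2
  -- Conservation makes the linear parts of the relative entropy and of its flux cancel. It is never
  -- necessary to identify `a` with the mean of the Riemann solutions.
  have hua : u - a = lam • f rr - lam • f rl := by rw [ha]; abel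
  have h3 : fderiv ℝ U a (u - a) = lam * fderiv ℝ U a (f rr) - lam * fderiv ℝ U a (f rl) := by
    rw [hua, map_sub, map_smul, map_smul, smul_eq_mul, smul_eq_mul]
  have h4 := mul_le_mul_of_nonneg_left (add_le_add h1 h2) hlam.le
  refine h4.trans_eq ?_
  rw [h3]
  field_simp
  ring

/-- The cell entropy inequality. -/
lemma cell_entropy (h𝒰 : IsOpen 𝒰) (hc : Convex ℝ 𝒰) (hf : ContDiffOn ℝ ∞ f 𝒰)
    (hR : IsRiemannSolver f 𝒰 𝒟 Λ R) (hlam : 0 < lam) (hCFL : lam * Λ < 1 / 2)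
    (hp : IsConvexEntropyPair f 𝒰 U F) {v u w a : State N} (hv : v ∈ 𝒟) (hu : u ∈ 𝒟) (hw : w ∈ 𝒟)
    (ha : a = u - lam • f (R u w) + lam • f (R v u)) (ha𝒰 : a ∈ 𝒰) :
    U a ≤ U u - lam * F (R u w) + lam * F (R v u) := by
  obtain ⟨σl, hl, hrl⟩ := hR v hv u hu
  obtain ⟨σr, hr, hrr⟩ := hR u hu w hw
  have h1 := cell_relative_entropy hl hrl hr hrr h𝒰 hf hlam hCFL hp ha
  have hs0 : 0 < 1 / (2 * lam) := by positivity
  obtain ⟨-, Cl, -, hCl, hml⟩ := hl.1.profile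
  obtain ⟨-, Cr, -, hCr, hmr⟩ := hr.1.profile
  have h2 : 0 ≤ ∫ ξ in (0 : ℝ)..1 / (2 * lam), (U (σl ξ) - U a - fderiv ℝ U a (σl ξ - a)) :=
    intervalIntegral.integral_nonneg hs0.le fun ξ _ => hp.tangent_le h𝒰 hc ha𝒰 (hCl (hml ξ))
  have h3 : 0 ≤ ∫ ξ in -(1 / (2 * lam))..0, (U (σr ξ) - U a - fderiv ℝ U a (σr ξ - a)) :=
    intervalIntegral.integral_nonneg (by linarith) fun ξ _ =>
      hp.tangent_le h𝒰 hc ha𝒰 (hCr (hmr ξ))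
  have h4 := mul_nonneg hlam.le (add_nonneg h2 h3)
  linarith

/-- The numerical entropy fluxes at the two interfaces of a cell are consistent with the entropy
flux in the cell, up to the dissipation of a strictly convex entropy. -/
lemma cell_consistency (h𝒰 : IsOpen 𝒰) (hc : Convex ℝ 𝒰) (hf : ContDiffOn ℝ ∞ f 𝒰)
    (hR : IsRiemannSolver f 𝒰 𝒟 Λ R) (hlam : 0 < lam) (hCFL : lam * Λ < 1 / 2)
    (hK : IsCompact K) (hK𝒰 : K ⊆ 𝒰) {Us Fs : State N → ℝ}
    (hps : IsStrictlyConvexEntropyPair f 𝒰 Us Fs) (hp : IsConvexEntropyPair f 𝒰 U F)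
    {ε : ℝ} (hε : 0 < ε) :
    ∃ B : ℝ, 0 ≤ B ∧ ∀ v u w a : State N, v ∈ 𝒟 → u ∈ K ∩ 𝒟 → w ∈ 𝒟 → a ∈ K →
      a = u - lam • f (R u w) + lam • f (R v u) →
      F u - F (R v u) ≤ ε + B * (Us u - Us a - lam * Fs (R u w) + lam * Fs (R v u)) ∧
      F (R u w) - F u ≤ ε + B * (Us u - Us a - lam * Fs (R u w) + lam * Fs (R v u)) := by
  set s := 1 / (2 * lam) with hsdef
  have hs0 : 0 < s := by positivity
  have hs : Λ < s := by rw [hsdef, lt_div_iff₀ (by positivity)]; linarith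
  -- `Λ` is not assumed nonnegative.
  set m := max Λ 0 with hmdef
  have hm0 : 0 ≤ m := le_max_right _ _
  have hms : m < s := max_lt hs hs0
  obtain ⟨G, hG⟩ := hK.exists_bound_of_continuousOn
    ((hp.contDiffOn_fderiv h𝒰).continuousOn.mono hK𝒰)
  set G' := max G 0 with hG'
  have hG'0 : 0 ≤ G' := le_max_right _ _
  -- The 1 accounts for the distance of the Riemann solution to `a`, the term `s / (s - m)` for the
  -- distance from `u` to `a`.
  set κ := G' * (1 + s / (s - m)) with hκ
  have hκ0 : 0 ≤ κ := by have : 0 < s - m := by linarith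
                         positivity
  -- The error is integrated over a length `s` and multiplied by `κ`, after which it is at most `ε`.
  obtain ⟨B, hB0, hB⟩ := hps.norm_sub_le h𝒰 hc hK hK𝒰
    (ε := ε / (s * (κ + 1))) (by positivity)
  refine ⟨κ * (B / lam), by positivity, fun v u w a hv hu hw haK ha => ?_⟩
  obtain ⟨σl, hl, hrl⟩ := hR v hv u hu.2
  obtain ⟨σr, hr, hrr⟩ := hR u hu.2 w hw
  have hD := cell_relative_entropy hl hrl hr hrr h𝒰 hf hlam hCFL hps.toIsConvexEntropyPair ha
  obtain ⟨-, Cl, -, hCl, hml⟩ := hl.1.profile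
  obtain ⟨-, Cr, -, hCr, hmr⟩ := hr.1.profile
  rw [← hsdef] at hD
  set D := Us u - Us a - lam * Fs (R u w) + lam * Fs (R v u) with hDdef
  have hcr : ContinuousOn (fun z => Us z - Us a - fderiv ℝ Us a (z - a)) 𝒰 :=
    (hps.continuousOn_entropy.sub continuousOn_const).sub (by fun_prop)
  have hcn : ∀ c : State N, ContinuousOn (fun z : State N => ‖z - c‖) 𝒰 := fun c => by fun_prop
  have hposl : 0 ≤ ∫ ξ in (0 : ℝ)..s, (Us (σl ξ) - Us a - fderiv ℝ Us a (σl ξ - a)) :=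
    intervalIntegral.integral_nonneg hs0.le fun ξ _ =>
      hps.tangent_le h𝒰 hc (hK𝒰 haK) (hCl (hml ξ))
  have hposr : 0 ≤ ∫ ξ in -s..0, (Us (σr ξ) - Us a - fderiv ℝ Us a (σr ξ - a)) :=
    intervalIntegral.integral_nonneg (by linarith) fun ξ _ =>
      hps.tangent_le h𝒰 hc (hK𝒰 haK) (hCr (hmr ξ))
  set E := ε / (κ + 1) + B / lam * D with hE
  have hside : ∀ {τ : ℝ → State N} {v' w' : State N} (x y : ℝ), x ≤ y → y - x = s →
      IsRiemannSolution f 𝒰 Λ v' w' τ →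
      lam * (∫ ξ in x..y, (Us (τ ξ) - Us a - fderiv ℝ Us a (τ ξ - a))) ≤ D →
      ∫ ξ in x..y, ‖τ ξ - a‖ ≤ E := by
    intro τ v' w' x y hxy hys hτ hle
    obtain ⟨-, C, -, hC, hmem⟩ := hτ.1.profile
    have h1 : ∫ ξ in x..y, ‖τ ξ - a‖ ≤ ∫ ξ in x..y, (ε / (s * (κ + 1))
        + B * (Us (τ ξ) - Us a - fderiv ℝ Us a (τ ξ - a))) :=
      intervalIntegral.integral_mono_on hxy (hτ.intervalIntegrable (hcn a) x y)
        (intervalIntegrable_const.add ((hτ.intervalIntegrable hcr x y).const_mul B))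
        fun ξ _ => hB a haK _ (hC (hmem ξ))
    rw [intervalIntegral.integral_add intervalIntegrable_const
      ((hτ.intervalIntegrable hcr x y).const_mul B), intervalIntegral.integral_const,
      intervalIntegral.integral_const_mul, hys, smul_eq_mul] at h1
    refine h1.trans (add_le_add (le_of_eq (by field_simp)) ?_)
    rw [div_mul_eq_mul_div, mul_div_assoc]
    refine mul_le_mul_of_nonneg_left ?_ hB0
    rw [le_div_iff₀ hlam]
    linarith
  have hEl : ∫ ξ in (0 : ℝ)..s, ‖σl ξ - a‖ ≤ E :=
    hside 0 s hs0.le (by ring) hl (by nlinarith)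
  have hEr : ∫ ξ in -s..0, ‖σr ξ - a‖ ≤ E :=
    hside (-s) 0 (by linarith) (by ring) hr (by nlinarith)
  -- Between `m` and `s` the left Riemann solution equals `u`, so its L¹ distance to `a` also
  -- controls the distance from `u` to `a`.
  have hau : (s - m) * ‖u - a‖ ≤ E := by
    have h1 : ∫ ξ in m..s, ‖σl ξ - a‖ = (s - m) * ‖u - a‖ := by
      rw [← smul_eq_mul, ← intervalIntegral.integral_const]
      refine intervalIntegral.integral_congr_ae (Eventually.of_forall fun ξ hξ => ?_)
      rw [uIoc_of_le hms.le] at hξ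
      rw [hl.2.2 ξ ((le_max_left _ _).trans_lt hξ.1)]
    have h2 : 0 ≤ ∫ ξ in (0 : ℝ)..m, ‖σl ξ - a‖ :=
      intervalIntegral.integral_nonneg hm0 fun ξ _ => norm_nonneg _
    rw [← intervalIntegral.integral_add_adjacent_intervals (hl.intervalIntegrable (hcn a) 0 m)
      (hl.intervalIntegrable (hcn a) m s), h1] at hEl
    linarith
  have hau' : s * ‖u - a‖ ≤ s / (s - m) * E := by
    have h1 : 0 < s - m := by linarith
    rw [show s / (s - m) * E = s * (E / (s - m)) by ring]
    refine mul_le_mul_of_nonneg_left ?_ hs0.le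
    rw [le_div_iff₀ h1]
    linarith
  have hfinal : G' * ((1 + s / (s - m)) * E) ≤ ε + κ * (B / lam) * D := by
    rw [← mul_assoc, ← hκ, hE, mul_add, ← mul_assoc]
    refine add_le_add ?_ le_rfl
    rw [mul_div_assoc', div_le_iff₀ (by positivity)]
    nlinarith
  have hflux : ∀ {τ : ℝ → State N} {v' w' : State N} (x y : ℝ), x ≤ y → y - x = s →
      IsRiemannSolution f 𝒰 Λ v' w' τ → ∫ ξ in x..y, ‖τ ξ - a‖ ≤ E →
      s * U u - ∫ ξ in x..y, U (τ ξ) ≤ ε + κ * (B / lam) * D := by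
    intro τ v' w' x y hxy hys hτ hle
    obtain ⟨-, C, -, hC, hmem⟩ := hτ.1.profile
    have h1 : s * U u - ∫ ξ in x..y, U (τ ξ) = ∫ ξ in x..y, (U u - U (τ ξ)) := by
      rw [intervalIntegral.integral_sub intervalIntegrable_const
        (hτ.intervalIntegrable hp.continuousOn_entropy x y), intervalIntegral.integral_const, hys,
        smul_eq_mul]
    have h2 : ∫ ξ in x..y, (U u - U (τ ξ)) ≤ ∫ ξ in x..y, G' * (‖τ ξ - a‖ + ‖u - a‖) := by
      refine intervalIntegral.integral_mono_on hxy
        (intervalIntegrable_const.sub (hτ.intervalIntegrable hp.continuousOn_entropy x y))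
        (((hτ.intervalIntegrable (hcn a) x y).add intervalIntegrable_const).const_mul G')
        fun ξ _ => ?_
      -- Using the tangent plane at `u`, only the gradient of `U` on `K` enters. The constant is
      -- thus uniform although the compact range of the Riemann solution is not.
      have e1 := hp.tangent_le h𝒰 hc (hK𝒰 hu.1) (hC (hmem ξ))
      have e2 : -fderiv ℝ U u (τ ξ - u) ≤ ‖fderiv ℝ U u‖ * ‖τ ξ - u‖ :=
        (neg_le_abs _).trans ((fderiv ℝ U u).le_opNorm _)
      have e3 : ‖fderiv ℝ U u‖ ≤ G' := (hG u hu.1).trans (le_max_left _ _)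
      have e4 : ‖τ ξ - u‖ ≤ ‖τ ξ - a‖ + ‖u - a‖ := by
        rw [norm_sub_rev u a]; exact norm_sub_le_norm_sub_add_norm_sub _ _ _
      have e5 : ‖fderiv ℝ U u‖ * ‖τ ξ - u‖ ≤ G' * (‖τ ξ - a‖ + ‖u - a‖) := by gcongr
      linarith
    have h3 : ∫ ξ in x..y, G' * (‖τ ξ - a‖ + ‖u - a‖)
        = G' * ((∫ ξ in x..y, ‖τ ξ - a‖) + s * ‖u - a‖) := by
      rw [intervalIntegral.integral_const_mul,
        intervalIntegral.integral_add (hτ.intervalIntegrable (hcn a) x y) intervalIntegrable_const,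
        intervalIntegral.integral_const, hys, smul_eq_mul]
    rw [h1]
    refine (h2.trans_eq h3).trans (le_trans ?_ hfinal)
    refine mul_le_mul_of_nonneg_left ?_ hG'0
    linarith
  have b1 := (hl.entropy_bounds hrl hs hs0 hp h𝒰).1
  have b2 := (hr.entropy_bounds hrr hs hs0 hp h𝒰).2
  have c1 := hflux 0 s hs0.le (by ring) hl hEl
  have c2 := hflux (-s) 0 (by linarith) (by ring) hr hEr
  constructor <;> linarith

end Cell

/-- A family of finite volume schemes, with cell values `c n j t` and interface values `W n j t`
(between the cells `j` and `j + 1`), which satisfies the cell entropy inequalities, and is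
consistent up to the dissipation of one of the entropies. -/
structure IsEntropyScheme {N : ℕ} (f : State N → State N) (𝒰 K : Set (State N)) (lam : ℝ)
    (h : ℕ → ℝ) (c W : ℕ → ℕ → ℝ → State N) : Prop where
  measurable_cell : ∀ n j, Measurable (c n j)
  measurable_interface : ∀ n j, Measurable (W n j)
  cell_mem : ∀ n j t, c n j t ∈ K
  interface_mem : ∀ n j t, W n j t ∈ K
  entropy : ∀ U F, IsConvexEntropyPair f 𝒰 U F → ∀ n j t, 0 ≤ t →
    U (c n (j + 1) (t + lam * h n))
      ≤ U (c n (j + 1) t) - lam * F (W n (j + 1) t) + lam * F (W n j t)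
  consistent : ∃ Us Fs, IsConvexEntropyPair f 𝒰 Us Fs ∧
    ∀ U F, IsConvexEntropyPair f 𝒰 U F → ∀ ε, 0 < ε → ∃ B, 0 ≤ B ∧ ∀ n j t, 0 ≤ t →
      F (c n (j + 1) t) - F (W n j t)
        ≤ ε + B * (Us (c n (j + 1) t) - Us (c n (j + 1) (t + lam * h n))
          - lam * Fs (W n (j + 1) t) + lam * Fs (W n j t)) ∧
      F (W n (j + 1) t) - F (c n (j + 1) t)
        ≤ ε + B * (Us (c n (j + 1) t) - Us (c n (j + 1) (t + lam * h n))
          - lam * Fs (W n (j + 1) t) + lam * Fs (W n j t))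

/-! ### The Godunov scheme as an entropy scheme -/

section Godunov

variable {N : ℕ} {f : State N → State N} {𝒰 𝒟 K : Set (State N)} {Λ lam h : ℝ}
  {R : State N → State N → State N} {a : ℕ → State N} {uB : ℝ → State N}

/-- The value of the Godunov approximation in the cell `j`, extended by its value at `t = 0` to
negative times. -/
noncomputable def godunovCell (f : State N → State N) (R : State N → State N → State N)
    (lam h : ℝ) (a : ℕ → State N) (uB : ℝ → State N) (j : ℕ) (t : ℝ) : State N :=
  godunov f R lam h a uB (j * h) (max t 0)

lemma godunov_eq_cell (hh : 0 < h) (x : ℝ) {t : ℝ} (ht : 0 ≤ t) :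
    godunov f R lam h a uB x t = godunovCell f R lam h a uB ⌊x / h⌋₊ t := by
  unfold godunovCell godunov
  rw [mul_div_cancel_right₀ _ hh.ne', Nat.floor_natCast, max_eq_left ht]

/-- Interfaces are numbered by the cell on their left: `y` in [k - 1/2, k + 1/2) has index k - 1. -/
lemma godunovInterface_eq_cell (hh : 0 < h) {y : ℝ} (hy : 1 / 2 ≤ y) {t : ℝ} (ht : 0 ≤ t) :
    godunovInterface f R lam h a uB y t
      = R (godunovCell f R lam h a uB ⌊y - 1 / 2⌋₊ t)
        (godunovCell f R lam h a uB (⌊y - 1 / 2⌋₊ + 1) t) := by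
  unfold godunovInterface
  rw [godunov_eq_cell hh _ ht, godunov_eq_cell hh _ ht]
  have h1 : (y * h - h / 2) / h = y - 1 / 2 := by field_simp
  have h2 : (y * h + h / 2) / h = (y - 1 / 2) + 1 := by field_simp; ring
  rw [h1, h2, Nat.floor_add_one (by linarith)]

lemma godunovCell_zero (hh : 0 < h) {t : ℝ} (ht : 0 ≤ t) :
    godunovCell f R lam h a uB 0 t = uB t := by
  unfold godunovCell godunov
  rw [mul_div_cancel_right₀ _ hh.ne', Nat.floor_natCast, max_eq_left ht]
  cases ⌊t / (lam * h)⌋₊ <;> simp [godunovLattice]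

lemma godunovCell_add (hh : 0 < h) (hlam : 0 < lam) (j : ℕ) {t : ℝ} (ht : 0 ≤ t) :
    godunovCell f R lam h a uB (j + 1) (t + lam * h)
      = godunovCell f R lam h a uB (j + 1) t
        - lam • f (R (godunovCell f R lam h a uB (j + 1) t) (godunovCell f R lam h a uB (j + 2) t))
        + lam • f (R (godunovCell f R lam h a uB j t) (godunovCell f R lam h a uB (j + 1) t)) := by
  have hτ : 0 < lam * h := mul_pos hlam hh
  unfold godunovCell godunov
  simp only [mul_div_cancel_right₀ _ hh.ne', Nat.floor_natCast, max_eq_left ht,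
    max_eq_left (add_nonneg ht hτ.le)]
  have h1 : ⌊(t + lam * h) / (lam * h)⌋₊ = ⌊t / (lam * h)⌋₊ + 1 := by
    rw [add_div, div_self hτ.ne', Nat.floor_add_one (by positivity)]
  -- The two times have the same position inside their time step and hence the same sampled boundary
  -- data, so they are consecutive levels of one lattice.
  have h2 : ∀ n m : ℕ, t + lam * h - ((n + 1 : ℕ) : ℝ) * (lam * h) + (m : ℝ) * (lam * h)
      = t - (n : ℝ) * (lam * h) + (m : ℝ) * (lam * h) := fun n m => by push_cast; ring
  rw [h1]
  simp only [h2]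
  rfl

/-- Induction on the time level, simultaneously in all cells, with the position inside the time step
as the variable. Since `f` is regular only on `𝒰`, each step uses that the interface values stay
there. The countably many levels are glued at the end. -/
lemma measurable_godunovCell (hf : ContDiffOn ℝ ∞ f 𝒰)
    (hR : Measurable (Function.uncurry R)) (hh : 0 < h) (hlam : 0 < lam) (huB : Measurable uB)
    (hK𝒰 : K ⊆ 𝒰)
    (hw : ∀ y t, 1 / 2 ≤ y → 0 ≤ t → godunovInterface f R lam h a uB y t ∈ K) (j : ℕ) :
    Measurable (godunovCell f R lam h a uB j) := by
  have hτ : 0 < lam * h := mul_pos hlam hh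
  set L : ℕ → ℕ → Ico (0 : ℝ) (lam * h) → State N := fun n j s =>
    godunovLattice f R lam a (fun m => uB ((s : ℝ) + (m : ℝ) * (lam * h))) n j with hL
  have hLc : ∀ n j (s : Ico (0 : ℝ) (lam * h)),
      L n j s = godunovCell f R lam h a uB j (s + n * (lam * h)) := by
    intro n j s
    have hs : 0 ≤ (s : ℝ) + n * (lam * h) := by have := s.2.1; positivity
    have hfl : ⌊((s : ℝ) + n * (lam * h)) / (lam * h)⌋₊ = n := by
      rw [add_div, mul_div_cancel_right₀ _ hτ.ne', Nat.floor_add_natCast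
        (div_nonneg s.2.1 hτ.le), Nat.floor_eq_zero.2 ((div_lt_one hτ).2 s.2.2), zero_add]
    simp only [hL, godunovCell, godunov, mul_div_cancel_right₀ _ hh.ne', Nat.floor_natCast,
      max_eq_left hs, hfl, add_sub_cancel_right]
  have hRmem : ∀ n j s, R (L n j s) (L n (j + 1) s) ∈ 𝒰 := by
    intro n j s
    have hs : 0 ≤ (s : ℝ) + n * (lam * h) := by have := s.2.1; positivity
    -- The smallest `y` whose interface has index `j`.
    have h1 := hw (j + 1 / 2) (s + n * (lam * h)) (by have := j.cast_nonneg (α := ℝ); linarith) hs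
    rw [godunovInterface_eq_cell hh (by have := j.cast_nonneg (α := ℝ); linarith) hs,
      add_sub_cancel_right, Nat.floor_natCast] at h1
    rw [hLc, hLc]
    exact hK𝒰 h1
  have hLm : ∀ n j, Measurable (L n j) := by
    intro n
    induction n with
    | zero =>
      intro j
      cases j with
      | zero => simp only [hL, godunovLattice]; fun_prop
      | succ j => simp only [hL, godunovLattice]; fun_prop
    | succ n ih =>
      intro j
      cases j with
      | zero => simp only [hL, godunovLattice]; fun_prop
      | succ j =>
        have hfR : ∀ j, Measurable fun s => f (R (L n j s) (L n (j + 1) s)) := fun j =>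
          hf.continuousOn.measurable_comp_of_mem
            (hR.comp ((ih j).prodMk (ih (j + 1)))) (hRmem n j)
        exact ((ih (j + 1)).sub ((hfR (j + 1)).const_smul lam)).add ((hfR j).const_smul lam)
  have hmem : ∀ t : ℝ, max t 0 - (⌊max t 0 / (lam * h)⌋₊ : ℝ) * (lam * h) ∈
      Ico (0 : ℝ) (lam * h) := fun t => by
    have h0 : 0 ≤ max t 0 / (lam * h) := div_nonneg (le_max_right _ _) hτ.le
    have h1 := Nat.floor_le h0
    have h2 := Nat.lt_floor_add_one (max t 0 / (lam * h))
    rw [le_div_iff₀ hτ] at h1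
    rw [div_lt_iff₀ hτ] at h2
    constructor <;> linarith
  have hjoint : Measurable fun p : ℕ × Ico (0 : ℝ) (lam * h) => L p.1 j p.2 :=
    measurable_from_prod_countable_right fun n => hLm n j
  have hfloor : Measurable fun t : ℝ => ⌊max t 0 / (lam * h)⌋₊ :=
    Nat.measurable_floor.comp ((measurable_id.max measurable_const).div_const _)
  have hsub : Measurable fun t : ℝ => max t 0 - (⌊max t 0 / (lam * h)⌋₊ : ℝ) * (lam * h) :=
    (measurable_id.max measurable_const).sub
      ((measurable_from_nat.comp hfloor : Measurable fun t : ℝ =>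
        (⌊max t 0 / (lam * h)⌋₊ : ℝ)).mul_const _)
  have := hjoint.comp (hfloor.prodMk (hsub.subtype_mk (h := hmem)))
  convert this using 1
  funext t
  simp only [Function.comp_apply, hLc, sub_add_cancel, godunovCell, max_eq_left (le_max_right t 0)]

end Godunov

/-- The Godunov scheme is an entropy scheme. -/
lemma isEntropyScheme_godunov {N : ℕ} {f : State N → State N} {𝒰 𝒟 K : Set (State N)}
    {Λ lam : ℝ} {R : State N → State N → State N} {h : ℕ → ℝ} {uI : ℕ → ℕ → State N}
    {uB : ℝ → State N} (h𝒰_open : IsOpen 𝒰) (h𝒰_convex : Convex ℝ 𝒰)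
    (hf : ContDiffOn ℝ ∞ f 𝒰) (hentropy : ∃ U F, IsStrictlyConvexEntropyPair f 𝒰 U F)
    (hR : IsRiemannSolver f 𝒰 𝒟 Λ R) (hR_meas : Measurable (Function.uncurry R))
    (hlam : 0 < lam) (hCFL : lam * Λ < 1 / 2) (huB : Measurable uB) (h_pos : ∀ n, 0 < h n)
    (hK : IsCompact K) (hK𝒰 : K ⊆ 𝒰)
    (hu : ∀ n x t, 0 ≤ x → 0 ≤ t → godunov f R lam (h n) (uI n) uB x t ∈ K ∩ 𝒟)
    (hw : ∀ n y t, 1 / 2 ≤ y → 0 ≤ t → godunovInterface f R lam (h n) (uI n) uB y t ∈ K) :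
    IsEntropyScheme f 𝒰 K lam h (fun n => godunovCell f R lam (h n) (uI n) uB)
      (fun n j t => R (godunovCell f R lam (h n) (uI n) uB j t)
        (godunovCell f R lam (h n) (uI n) uB (j + 1) t)) := by
  have hm : ∀ n j, Measurable (godunovCell f R lam (h n) (uI n) uB j) := fun n j =>
    measurable_godunovCell hf hR_meas (h_pos n) hlam huB hK𝒰 (hw n) j
  have hmem : ∀ n j t, godunovCell f R lam (h n) (uI n) uB j t ∈ K ∩ 𝒟 := fun n j t =>
    hu n _ _ (mul_nonneg j.cast_nonneg (h_pos n).le) (le_max_right _ _)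
  refine ⟨hm, fun n j => hR_meas.comp ((hm n j).prodMk (hm n (j + 1))),
    fun n j t => (hmem n j t).1, fun n j t => ?_, fun U F hp n j t ht => ?_, ?_⟩
  · have hy : (1 : ℝ) / 2 ≤ j + 1 / 2 := by have := j.cast_nonneg (α := ℝ); linarith
    have h1 := hw n (j + 1 / 2) (max t 0) hy (le_max_right _ _)
    rw [godunovInterface_eq_cell (h_pos n) hy (le_max_right _ _), add_sub_cancel_right,
      Nat.floor_natCast] at h1
    simpa only [godunovCell, max_eq_left (le_max_right t 0)] using h1
  · exact cell_entropy h𝒰_open h𝒰_convex hf hR hlam hCFL hp (hmem n j t).2 (hmem n (j + 1) t).2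
      (hmem n (j + 2) t).2 (godunovCell_add (h_pos n) hlam j ht) (hK𝒰 (hmem n (j + 1) _).1)
  · obtain ⟨Us, Fs, hps⟩ := hentropy
    refine ⟨Us, Fs, hps.toIsConvexEntropyPair, fun U F hp ε hε => ?_⟩
    obtain ⟨B, hB0, hB⟩ := cell_consistency h𝒰_open h𝒰_convex hf hR hlam hCFL hK hK𝒰 hps hp hε
    refine ⟨B, hB0, fun n j t ht => ?_⟩
    exact hB _ _ _ _ (hmem n j t).2 (hmem n (j + 1) t) (hmem n (j + 2) t).2
      (hmem n (j + 1) (t + lam * h n)).1 (godunovCell_add (h_pos n) hlam j ht)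

/-! ### Time shifts against weights of bounded variation -/

section Shift

variable {q θ : ℝ → ℝ} {M T₁ T₂ : ℝ}

lemma IntervalIntegrable.bounded_mul (hθ : IntervalIntegrable θ volume T₁ T₂) (hq : Measurable q)
    (hM : ∀ t, |q t| ≤ M) : IntervalIntegrable (fun t => q t * θ t) volume T₁ T₂ := by
  rw [intervalIntegrable_iff] at hθ ⊢
  exact Integrable.bdd_mul hθ hq.aestronglyMeasurable (Eventually.of_forall hM)

/-- The effect of a time shift on an integral against a monotone weight. -/
lemma abs_integral_shift_le_of_monotoneOn (hθ : MonotoneOn θ (Ici 0)) (h0 : 0 ≤ T₁) (h12 : T₁ ≤ T₂)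
    (hq : Measurable q) (hM : ∀ t, |q t| ≤ M) {τ : ℝ} (hτ : 0 ≤ τ) :
    |∫ t in T₁..T₂, (q t - q (t + τ)) * θ t| ≤ 4 * M * (|θ T₁| + |θ T₂|) * τ := by
  have hM0 : 0 ≤ M := (abs_nonneg _).trans (hM 0)
  set S := |θ T₁| + |θ T₂| with hS
  -- The weight is frozen outside [T₁, T₂], so that it can be shifted and remains monotone and
  -- bounded by `S`.
  set ϑ : ℝ → ℝ := fun t => θ (max T₁ (min t T₂)) with hϑ
  have hϑm : Monotone ϑ := fun a b hab => by
    refine hθ (h0.trans (le_max_left _ _)) (h0.trans (le_max_left _ _)) ?_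
    gcongr
  have hϑeq : ∀ t ∈ Icc T₁ T₂, θ t = ϑ t := fun t ht => by
    simp only [hϑ, min_eq_left ht.2, max_eq_right ht.1]
  have hϑS : ∀ t, |ϑ t| ≤ S := fun t => by
    have h1 : θ T₁ ≤ ϑ t := hθ h0 (h0.trans (le_max_left _ _)) (le_max_left _ _)
    have h2 : ϑ t ≤ θ T₂ := hθ (h0.trans (le_max_left _ _)) (h0.trans h12)
      (max_le h12 (min_le_right _ _))
    rw [abs_le]
    constructor
    · linarith [neg_abs_le (θ T₁), abs_nonneg (θ T₂)]
    · linarith [le_abs_self (θ T₂), abs_nonneg (θ T₁)]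
  have hϑi : ∀ a b, IntervalIntegrable ϑ volume a b := fun a b => hϑm.intervalIntegrable
  have hϑτm : Monotone fun t => ϑ (t - τ) := fun a b hab => hϑm (by linarith)
  have hϑτi : ∀ a b, IntervalIntegrable (fun t => ϑ (t - τ)) volume a b :=
    fun a b => hϑτm.intervalIntegrable
  have hqϑ : ∀ a b, IntervalIntegrable (fun t => q t * ϑ t) volume a b :=
    fun a b => (hϑi a b).bounded_mul hq hM
  have hqϑτ : ∀ a b, IntervalIntegrable (fun t => q t * ϑ (t - τ)) volume a b :=
    fun a b => (hϑτi a b).bounded_mul hq hM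
  have hqτϑ : ∀ a b, IntervalIntegrable (fun t => q (t + τ) * ϑ t) volume a b :=
    fun a b => (hϑi a b).bounded_mul (hq.comp (measurable_id.add_const τ)) fun t => hM _
  have e1 : ∫ t in T₁..T₂, (q t - q (t + τ)) * θ t
      = (∫ t in T₁..T₂, q t * ϑ t) - ∫ t in T₁..T₂, q (t + τ) * ϑ t := by
    rw [← intervalIntegral.integral_sub (hqϑ _ _) (hqτϑ _ _)]
    refine intervalIntegral.integral_congr fun t ht => ?_
    rw [uIcc_of_le h12] at ht
    simp only [hϑeq t ht]
    ring
  -- `q` has no regularity, so the shift is moved onto the weight. The price is two end layers of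
  -- length `τ`.
  have e2 : ∫ t in T₁..T₂, q (t + τ) * ϑ t = ∫ t in T₁ + τ..T₂ + τ, q t * ϑ (t - τ) := by
    rw [← intervalIntegral.integral_comp_add_right (fun t => q t * ϑ (t - τ))]
    simp
  have e3 : ∫ t in T₁ + τ..T₂ + τ, q t * ϑ (t - τ) = (∫ t in T₁..T₂, q t * ϑ (t - τ))
      - (∫ t in T₁..T₁ + τ, q t * ϑ (t - τ)) + ∫ t in T₂..T₂ + τ, q t * ϑ (t - τ) := by
    have h1 := intervalIntegral.integral_add_adjacent_intervals (hqϑτ T₁ (T₁ + τ))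
      (hqϑτ (T₁ + τ) (T₂ + τ))
    have h2 := intervalIntegral.integral_add_adjacent_intervals (hqϑτ T₁ T₂) (hqϑτ T₂ (T₂ + τ))
    linarith
  have hb : ∀ T, |∫ t in T..T + τ, q t * ϑ (t - τ)| ≤ M * S * τ := fun T => by
    have := intervalIntegral.norm_integral_le_of_norm_le_const (a := T) (b := T + τ) (C := M * S)
      (f := fun t => q t * ϑ (t - τ)) fun t _ => by
        rw [norm_mul]
        exact mul_le_mul (hM t) (hϑS _) (norm_nonneg _) hM0
    rwa [add_sub_cancel_left, abs_of_nonneg hτ] at this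
  have hb' : ∀ T, |∫ t in T - τ..T, ϑ t| ≤ S * τ := fun T => by
    have := intervalIntegral.norm_integral_le_of_norm_le_const (a := T - τ) (b := T) (C := S)
      (f := ϑ) fun t _ => hϑS t
    rwa [sub_sub_cancel, abs_of_nonneg hτ] at this
  -- By monotonicity the absolute value of the difference of the weights is the difference itself,
  -- whose integral telescopes to two layers of length `τ`.
  have e4 : |∫ t in T₁..T₂, (q t * ϑ t - q t * ϑ (t - τ))| ≤ M * (2 * S * τ) := by
    have h1 : ∫ t in T₁..T₂, M * (ϑ t - ϑ (t - τ)) ≤ M * (2 * S * τ) := by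
      rw [intervalIntegral.integral_const_mul]
      refine mul_le_mul_of_nonneg_left ?_ hM0
      rw [intervalIntegral.integral_sub (hϑi _ _) (hϑτi _ _),
        intervalIntegral.integral_comp_sub_right (fun t => ϑ t)]
      have h2 := intervalIntegral.integral_add_adjacent_intervals (hϑi (T₁ - τ) (T₂ - τ))
        (hϑi (T₂ - τ) T₂)
      have h3 := intervalIntegral.integral_add_adjacent_intervals (hϑi (T₁ - τ) T₁) (hϑi T₁ T₂)
      have h4 := abs_le.1 (hb' T₁)
      have h5 := abs_le.1 (hb' T₂)
      linarith [h4.1, h5.2]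
    rw [← Real.norm_eq_abs]
    refine (intervalIntegral.norm_integral_le_of_norm_le h12 (Eventually.of_forall fun t _ => ?_)
      (((hϑi _ _).sub (hϑτi _ _)).const_mul M)).trans h1
    have h6 : ϑ (t - τ) ≤ ϑ t := hϑm (by linarith)
    rw [← mul_sub, norm_mul, Real.norm_of_nonneg (sub_nonneg.2 h6)]
    exact mul_le_mul_of_nonneg_right (hM t) (sub_nonneg.2 h6)
  rw [intervalIntegral.integral_sub (hqϑ _ _) (hqϑτ _ _)] at e4
  rw [e1, e2, e3]
  have h4 := abs_le.1 e4
  have h5 := abs_le.1 (hb T₁)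
  have h6 := abs_le.1 (hb T₂)
  rw [abs_le]
  constructor <;> linarith [h4.1, h4.2, h5.1, h5.2, h6.1, h6.2]

lemma LocallyBoundedVariationOn.intervalIntegrable_of_nonneg
    (hθ : LocallyBoundedVariationOn θ (Ici 0)) (h0 : 0 ≤ T₁) (h12 : T₁ ≤ T₂) :
    IntervalIntegrable θ volume T₁ T₂ := by
  obtain ⟨p, r, hp, hr, rfl⟩ := hθ.exists_monotoneOn_sub_monotoneOn
  have hsub : uIcc T₁ T₂ ⊆ Ici 0 := by
    rw [uIcc_of_le h12]
    exact fun t ht => h0.trans ht.1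
  exact (hp.mono hsub).intervalIntegrable.sub (hr.mono hsub).intervalIntegrable

lemma LocallyBoundedVariationOn.exists_bound_Icc
    (hθ : LocallyBoundedVariationOn θ (Ici 0)) (h0 : 0 ≤ T₁) (h12 : T₁ ≤ T₂) :
    ∃ S, 0 ≤ S ∧ ∀ t ∈ Icc T₁ T₂, |θ t| ≤ S := by
  obtain ⟨p, r, hp, hr, rfl⟩ := hθ.exists_monotoneOn_sub_monotoneOn
  refine ⟨|p T₁| + |p T₂| + |r T₁| + |r T₂|, by positivity, fun t ht => ?_⟩
  have ht0 : t ∈ Ici (0 : ℝ) := h0.trans ht.1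
  have a1 := hp h0 ht0 ht.1
  have a2 := hp ht0 (h0.trans h12) ht.2
  have a3 := hr h0 ht0 ht.1
  have a4 := hr ht0 (h0.trans h12) ht.2
  rw [Pi.sub_apply, abs_le]
  constructor <;>
  linarith [neg_abs_le (p T₁), le_abs_self (p T₂), neg_abs_le (r T₁), le_abs_self (r T₂),
    abs_nonneg (p T₁), abs_nonneg (p T₂), abs_nonneg (r T₁), abs_nonneg (r T₂)]

/-- The effect of a time shift on an integral against a weight of bounded variation is of the
order of the shift. -/
lemma LocallyBoundedVariationOn.exists_integral_shift_le
    (hθ : LocallyBoundedVariationOn θ (Ici 0)) (h0 : 0 ≤ T₁) (h12 : T₁ ≤ T₂) (hM : 0 ≤ M) :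
    ∃ C, 0 ≤ C ∧ ∀ q : ℝ → ℝ, Measurable q → (∀ t, |q t| ≤ M) → ∀ τ, 0 ≤ τ →
      ∫ t in T₁..T₂, (q t - q (t + τ)) * θ t ≤ C * τ := by
  have hsub : uIcc T₁ T₂ ⊆ Ici 0 := by
    rw [uIcc_of_le h12]
    exact fun t ht => h0.trans ht.1
  obtain ⟨p, r, hp, hr, rfl⟩ := hθ.exists_monotoneOn_sub_monotoneOn
  refine ⟨4 * M * (|p T₁| + |p T₂|) + 4 * M * (|r T₁| + |r T₂|), by positivity,
    fun q hq hqM τ hτ => ?_⟩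
  have hqq : Measurable fun t => q t - q (t + τ) := hq.sub (hq.comp (measurable_id.add_const τ))
  have hqqM : ∀ t, |q t - q (t + τ)| ≤ 2 * M := fun t => by
    have h1 := abs_le.1 (hqM t)
    have h2 := abs_le.1 (hqM (t + τ))
    rw [abs_le]
    constructor <;> linarith [h1.1, h1.2, h2.1, h2.2]
  have i1 := IntervalIntegrable.bounded_mul (hp.mono hsub).intervalIntegrable hqq hqqM
  have i2 := IntervalIntegrable.bounded_mul (hr.mono hsub).intervalIntegrable hqq hqqM
  have e1 := abs_le.1 (abs_integral_shift_le_of_monotoneOn hp h0 h12 hq hqM hτ)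
  have e2 := abs_le.1 (abs_integral_shift_le_of_monotoneOn hr h0 h12 hq hqM hτ)
  simp only [Pi.sub_apply, mul_sub]
  rw [intervalIntegral.integral_sub i1 i2]
  linarith [e1.2, e2.1]

end Shift

/-- The amount by which the values of `F` increase from the left interface to the interior and from
the interior to the right interface of the cell `m + 1`. -/
noncomputable def fluxDefect {N : ℕ} (F : State N → ℝ) (c W : ℕ → ℕ → ℝ → State N) (n m : ℕ)
    (t : ℝ) : ℝ :=
  max 0 (F (c n (m + 1) t) - F (W n m t)) + max 0 (F (W n (m + 1) t) - F (c n (m + 1) t))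

/-! ### Monotonicity of interface fluxes and vanishing of the flux defect -/

namespace IsEntropyScheme

variable {N : ℕ} {f : State N → State N} {𝒰 K : Set (State N)} {lam : ℝ} {h : ℕ → ℝ}
  {c W : ℕ → ℕ → ℝ → State N} {U F g : State N → ℝ} {θ : ℝ → ℝ} {T₁ T₂ : ℝ}

lemma measurable_comp_cell (hS : IsEntropyScheme f 𝒰 K lam h c W) (hg : ContinuousOn g K)
    (n j : ℕ) : Measurable fun t => g (c n j t) :=
  hg.measurable_comp_of_mem (hS.measurable_cell n j) (hS.cell_mem n j)

lemma measurable_comp_interface (hS : IsEntropyScheme f 𝒰 K lam h c W) (hg : ContinuousOn g K)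
    (n j : ℕ) : Measurable fun t => g (W n j t) :=
  hg.measurable_comp_of_mem (hS.measurable_interface n j) (hS.interface_mem n j)

/-- The time averages of the interface entropy fluxes are nonincreasing in the space direction, up
to an error of the order of the distance. -/
lemma exists_flux_le (hS : IsEntropyScheme f 𝒰 K lam h c W) (hK : IsCompact K) (hK𝒰 : K ⊆ 𝒰)
    (hlam : 0 < lam) (h_pos : ∀ n, 0 < h n) (hp : IsConvexEntropyPair f 𝒰 U F)
    (hθ : LocallyBoundedVariationOn θ (Ici 0)) (hθ0 : ∀ t, 0 ≤ t → 0 ≤ θ t) (h0 : 0 ≤ T₁)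
    (h12 : T₁ ≤ T₂) :
    ∃ C, 0 ≤ C ∧ ∀ n j k : ℕ, j ≤ k → ∫ t in T₁..T₂, F (W n k t) * θ t
      ≤ (∫ t in T₁..T₂, F (W n j t) * θ t) + C * ((k - j) * h n) := by
  have hFc := hp.continuousOn_flux.mono hK𝒰
  have hUc := hp.continuousOn_entropy.mono hK𝒰
  obtain ⟨MF, hMF⟩ := hK.exists_bound_of_continuousOn hFc
  obtain ⟨MU, hMU⟩ := hK.exists_bound_of_continuousOn hUc
  have hMU0 : 0 ≤ MU := (norm_nonneg _).trans (hMU _ (hS.cell_mem 0 0 0))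
  have hθi := hθ.intervalIntegrable_of_nonneg h0 h12
  obtain ⟨C, hC0, hC⟩ := hθ.exists_integral_shift_le h0 h12 hMU0
  have hFi : ∀ n j, IntervalIntegrable (fun t => F (W n j t) * θ t) volume T₁ T₂ := fun n j =>
    hθi.bounded_mul (hS.measurable_comp_interface hFc n j) fun t => hMF _ (hS.interface_mem n j t)
  have hstep : ∀ n j, ∫ t in T₁..T₂, F (W n (j + 1) t) * θ t
      ≤ (∫ t in T₁..T₂, F (W n j t) * θ t) + C * h n := by
    intro n j
    have hτ : 0 ≤ lam * h n := mul_nonneg hlam.le (h_pos n).le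
    have hUm := hS.measurable_comp_cell hUc n (j + 1)
    have hUi : IntervalIntegrable
        (fun t => (U (c n (j + 1) t) - U (c n (j + 1) (t + lam * h n))) * θ t) volume T₁ T₂ := by
      refine hθi.bounded_mul (M := MU + MU)
        (hUm.sub (hUm.comp (measurable_id.add_const _))) fun t => ?_
      exact (norm_sub_le _ _).trans
        (add_le_add (hMU _ (hS.cell_mem _ _ _)) (hMU _ (hS.cell_mem _ _ _)))
    have h1 := hC _ hUm (fun t => hMU _ (hS.cell_mem n (j + 1) t)) _ hτ
    have h2 : ∫ t in T₁..T₂, lam * (F (W n (j + 1) t) * θ t - F (W n j t) * θ t)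
        ≤ ∫ t in T₁..T₂, (U (c n (j + 1) t) - U (c n (j + 1) (t + lam * h n))) * θ t := by
      refine intervalIntegral.integral_mono_on h12 (((hFi n _).sub (hFi n _)).const_mul lam) hUi
        fun t ht => ?_
      have ht0 : 0 ≤ t := h0.trans ht.1
      nlinarith [hS.entropy U F hp n j t ht0, hθ0 t ht0]
    rw [intervalIntegral.integral_const_mul, intervalIntegral.integral_sub (hFi n _) (hFi n _)]
      at h2
    have h3 := h2.trans h1
    -- The time step is proportional to the mesh size, so the cost per cell is of order `h n`, with
    -- a constant independent of `n` and of the cell.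
    rw [show C * (lam * h n) = lam * (C * h n) by ring] at h3
    linarith [le_of_mul_le_mul_left h3 hlam]
  refine ⟨C, hC0, fun n j k hjk => ?_⟩
  induction k, hjk using Nat.le_induction with
  | base => simp
  | succ k hjk ih =>
    refine (hstep n k).trans ?_
    push_cast
    linarith

lemma measurable_fluxDefect (hS : IsEntropyScheme f 𝒰 K lam h c W) (hF : ContinuousOn F K)
    (n m : ℕ) : Measurable (fluxDefect F c W n m) :=
  (measurable_const.max ((hS.measurable_comp_cell hF n (m + 1)).sub
    (hS.measurable_comp_interface hF n m))).add
  (measurable_const.max ((hS.measurable_comp_interface hF n (m + 1)).sub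
    (hS.measurable_comp_cell hF n (m + 1))))

lemma abs_fluxDefect_le (hS : IsEntropyScheme f 𝒰 K lam h c W) {M : ℝ} (hM : ∀ u ∈ K, ‖F u‖ ≤ M)
    (n m : ℕ) (t : ℝ) : |fluxDefect F c W n m t| ≤ 4 * M := by
  have b1 := abs_le.1 (hM _ (hS.cell_mem n (m + 1) t))
  have b2 := abs_le.1 (hM _ (hS.interface_mem n m t))
  have b3 := abs_le.1 (hM _ (hS.interface_mem n (m + 1) t))
  rw [fluxDefect, abs_of_nonneg (add_nonneg (le_max_left _ _) (le_max_left _ _))]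
  have m1 : max 0 (F (c n (m + 1) t) - F (W n m t)) ≤ 2 * M :=
    max_le (by linarith [b1.1, b1.2]) (by linarith [b1.2, b2.1])
  have m2 : max 0 (F (W n (m + 1) t) - F (c n (m + 1) t)) ≤ 2 * M :=
    max_le (by linarith [b1.1, b1.2]) (by linarith [b1.1, b3.2])
  linarith

/-- The space-time integral of the entropy dissipation is of the order of the mesh size; hence the
interface entropy fluxes are asymptotically consistent with the entropy flux in the cells. -/
lemma tendsto_defect (hS : IsEntropyScheme f 𝒰 K lam h c W) (hK : IsCompact K) (hK𝒰 : K ⊆ 𝒰)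
    (hlam : 0 < lam) (h_pos : ∀ n, 0 < h n) (h_lim : Tendsto h atTop (𝓝 0))
    (hp : IsConvexEntropyPair f 𝒰 U F) (h0 : 0 ≤ T₁) (h12 : T₁ ≤ T₂) {X : ℝ} (hX : 0 ≤ X) :
    Tendsto (fun n => ∫ x in (0 : ℝ)..X, ∫ t in T₁..T₂,
      fluxDefect F c W n ⌊x / h n⌋₊ t) atTop (𝓝 0) := by
  obtain ⟨Us, Fs, hps, hcons⟩ := hS.consistent
  have hFc := hp.continuousOn_flux.mono hK𝒰
  have hUsc := hps.continuousOn_entropy.mono hK𝒰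
  have hFsc := hps.continuousOn_flux.mono hK𝒰
  obtain ⟨MF, hMF⟩ := hK.exists_bound_of_continuousOn hFc
  obtain ⟨MU, hMU⟩ := hK.exists_bound_of_continuousOn hUsc
  obtain ⟨MFs, hMFs⟩ := hK.exists_bound_of_continuousOn hFsc
  have hMU0 : 0 ≤ MU := (norm_nonneg _).trans (hMU _ (hS.cell_mem 0 0 0))
  have hMFs0 : 0 ≤ MFs := (norm_nonneg _).trans (hMFs _ (hS.cell_mem 0 0 0))
  have h1v : LocallyBoundedVariationOn (fun _ : ℝ => (1 : ℝ)) (Ici 0) :=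
    (monotoneOn_const).locallyBoundedVariationOn
  obtain ⟨C₁, hC₁0, hC₁⟩ := h1v.exists_integral_shift_le h0 h12 hMU0
  -- The shift estimate is used a second time in the space variable: the flux difference across a
  -- cell is a shift by `h n`.
  obtain ⟨C₂, hC₂0, hC₂⟩ := h1v.exists_integral_shift_le le_rfl hX
    (M := MFs * |T₂ - T₁|) (by positivity)
  set e := fluxDefect F c W with he
  have he0 : ∀ n m t, 0 ≤ e n m t := fun n m t =>
    add_nonneg (le_max_left _ _) (le_max_left _ _)
  have hem : ∀ n m, Measurable (e n m) := hS.measurable_fluxDefect hFc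
  have heb : ∀ n m t, |e n m t| ≤ 4 * MF := hS.abs_fluxDefect_le hMF
  have hei : ∀ n m, IntervalIntegrable (e n m) volume T₁ T₂ := fun n m =>
    intervalIntegrable_of_bounded (hem n m) (heb n m) _ _
  set P : ℕ → ℕ → ℝ := fun n m => ∫ t in T₁..T₂, Fs (W n m t) with hP
  have hFsi : ∀ n m, IntervalIntegrable (fun t => Fs (W n m t)) volume T₁ T₂ := fun n m =>
    intervalIntegrable_of_bounded (hS.measurable_comp_interface hFsc n m)
      (fun t => hMFs _ (hS.interface_mem n m t)) _ _
  have hPb : ∀ n m, |P n m| ≤ MFs * |T₂ - T₁| := fun n m =>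
    intervalIntegral.norm_integral_le_of_norm_le_const fun t _ => hMFs _ (hS.interface_mem n m t)
  have hPm : ∀ n, Measurable fun x : ℝ => P n ⌊x / h n⌋₊ := fun n =>
    (measurable_from_nat (f := P n)).comp (Nat.measurable_floor.comp (measurable_id.div_const _))
  have hmain : ∀ ε, 0 < ε → ∃ B, 0 ≤ B ∧ ∀ n, ∫ x in (0 : ℝ)..X, ∫ t in T₁..T₂, e n ⌊x / h n⌋₊ t
      ≤ 2 * ε * (T₂ - T₁) * X + B * h n := by
    intro ε hε
    obtain ⟨B, hB0, hB⟩ := hcons U F hp ε hε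
    refine ⟨2 * B * lam * (C₁ * X + C₂), by positivity, fun n => ?_⟩
    have hτ : 0 ≤ lam * h n := mul_nonneg hlam.le (h_pos n).le
    have hE : ∀ m, ∫ t in T₁..T₂, e n m t ≤ 2 * ε * (T₂ - T₁)
        + 2 * B * (C₁ * (lam * h n) + lam * (P n m - P n (m + 1))) := by
      intro m
      have hUm := hS.measurable_comp_cell hUsc n (m + 1)
      have hUi : IntervalIntegrable
          (fun t => Us (c n (m + 1) t) - Us (c n (m + 1) (t + lam * h n))) volume T₁ T₂ := by
        refine intervalIntegrable_of_bounded (M := MU + MU)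
          (hUm.sub (hUm.comp (measurable_id.add_const _))) (fun t => ?_) _ _
        exact (norm_sub_le _ _).trans
          (add_le_add (hMU _ (hS.cell_mem _ _ _)) (hMU _ (hS.cell_mem _ _ _)))
      have b1 := hC₁ _ hUm (fun t => hMU _ (hS.cell_mem n (m + 1) t)) _ hτ
      simp only [mul_one] at b1
      have b2 : ∫ t in T₁..T₂, e n m t ≤ ∫ t in T₁..T₂, (2 * ε
          + 2 * B * ((Us (c n (m + 1) t) - Us (c n (m + 1) (t + lam * h n)))
            + lam * (Fs (W n m t) - Fs (W n (m + 1) t)))) := by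
        refine intervalIntegral.integral_mono_on h12 (hei n m) (intervalIntegrable_const.add
          ((hUi.add (((hFsi n m).sub (hFsi n (m + 1))).const_mul lam)).const_mul (2 * B)))
          fun t ht => ?_
        have ht0 : 0 ≤ t := h0.trans ht.1
        have a1 := hB n m t ht0
        have a2 := hS.entropy Us Fs hps n m t ht0
        -- The dissipation is nonnegative, so it bounds the positive parts in the defect as well.
        have a3 : 0 ≤ B * (Us (c n (m + 1) t) - Us (c n (m + 1) (t + lam * h n))
          - lam * Fs (W n (m + 1) t) + lam * Fs (W n m t)) := mul_nonneg hB0 (by linarith)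
        have m1 := max_le (add_nonneg hε.le a3) a1.1
        have m2 := max_le (add_nonneg hε.le a3) a1.2
        have := add_le_add m1 m2
        simp only [he, fluxDefect]
        linarith
      rw [intervalIntegral.integral_add intervalIntegrable_const
        ((hUi.add (((hFsi n m).sub (hFsi n (m + 1))).const_mul lam)).const_mul (2 * B)),
        intervalIntegral.integral_const, intervalIntegral.integral_const_mul,
        intervalIntegral.integral_add hUi (((hFsi n m).sub (hFsi n (m + 1))).const_mul lam),
        intervalIntegral.integral_const_mul, intervalIntegral.integral_sub (hFsi n m)
        (hFsi n (m + 1)), smul_eq_mul] at b2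
      have b3 := mul_le_mul_of_nonneg_left b1 (show 0 ≤ 2 * B by positivity)
      simp only [hP]
      linarith
    have hfl : ∀ x ∈ Icc (0 : ℝ) X, P n (⌊x / h n⌋₊ + 1) = P n ⌊(x + h n) / h n⌋₊ := by
      intro x hx
      rw [add_div, div_self (h_pos n).ne', Nat.floor_add_one (div_nonneg hx.1 (h_pos n).le)]
    have hPi : IntervalIntegrable (fun x => P n ⌊x / h n⌋₊ - P n ⌊(x + h n) / h n⌋₊)
        volume 0 X :=
      (intervalIntegrable_of_bounded (hPm n) (fun x => hPb n _) _ _).sub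
        (intervalIntegrable_of_bounded ((hPm n).comp (measurable_id.add_const (h n)))
          (fun x => hPb n _) _ _)
    have hEi : IntervalIntegrable (fun x => ∫ t in T₁..T₂, e n ⌊x / h n⌋₊ t) volume 0 X := by
      have hm : Measurable fun x : ℝ => ∫ t in T₁..T₂, e n ⌊x / h n⌋₊ t :=
        (measurable_from_nat (f := fun m => ∫ t in T₁..T₂, e n m t)).comp
          (Nat.measurable_floor.comp (measurable_id.div_const _))
      have hb : ∀ m, |∫ t in T₁..T₂, e n m t| ≤ 4 * MF * |T₂ - T₁| := fun m => by
        have := intervalIntegral.norm_integral_le_of_norm_le_const (a := T₁) (b := T₂)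
          (f := e n m) fun t _ => (Real.norm_eq_abs _).trans_le (heb n m t)
        rwa [Real.norm_eq_abs] at this
      exact intervalIntegrable_of_bounded hm (fun x => hb _) _ _
    have b1 : ∫ x in (0 : ℝ)..X, ∫ t in T₁..T₂, e n ⌊x / h n⌋₊ t
        ≤ ∫ x in (0 : ℝ)..X, (2 * ε * (T₂ - T₁) + 2 * B * (C₁ * (lam * h n)
          + lam * (P n ⌊x / h n⌋₊ - P n ⌊(x + h n) / h n⌋₊))) := by
      refine intervalIntegral.integral_mono_on hX hEi (intervalIntegrable_const.add
        ((intervalIntegrable_const.add (hPi.const_mul lam)).const_mul (2 * B))) fun x hx => ?_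
      rw [← hfl x hx]
      exact hE _
    rw [intervalIntegral.integral_add intervalIntegrable_const
      ((intervalIntegrable_const.add (hPi.const_mul lam)).const_mul (2 * B)),
      intervalIntegral.integral_const, intervalIntegral.integral_const_mul,
      intervalIntegral.integral_add intervalIntegrable_const (hPi.const_mul lam),
      intervalIntegral.integral_const, intervalIntegral.integral_const_mul, smul_eq_mul,
      smul_eq_mul] at b1
    have b2 := hC₂ _ (hPm n) (fun x => hPb n _) _ (h_pos n).le
    simp only [mul_one] at b2
    have b3 := mul_le_mul_of_nonneg_left b2 (show 0 ≤ 2 * B * lam by positivity)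
    linarith
  rw [Metric.tendsto_nhds]
  intro δ hδ
  -- `ε` is fixed before h → 0 because `B` depends on it. The summand 1 covers an empty domain.
  set ε := δ / (4 * ((T₂ - T₁) * X + 1)) with hε
  have hTX : 0 ≤ (T₂ - T₁) * X := mul_nonneg (by linarith) hX
  have hε0 : 0 < ε := by positivity
  obtain ⟨B, hB0, hB⟩ := hmain ε hε0
  have hlim : Tendsto (fun n => B * h n) atTop (𝓝 0) := by simpa using h_lim.const_mul B
  filter_upwards [hlim.eventually (gt_mem_nhds (half_pos hδ))] with n hn
  have hnn : 0 ≤ ∫ x in (0 : ℝ)..X, ∫ t in T₁..T₂, e n ⌊x / h n⌋₊ t :=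
    intervalIntegral.integral_nonneg hX fun x _ =>
      intervalIntegral.integral_nonneg h12 fun t _ => he0 _ _ _
  rw [Real.dist_eq, sub_zero, abs_of_nonneg hnn]
  refine (hB n).trans_lt ?_
  have : 2 * ε * (T₂ - T₁) * X ≤ δ / 2 := by
    have h1 : ε * (4 * ((T₂ - T₁) * X + 1)) = δ := by rw [hε]; field_simp
    nlinarith
  linarith

end IsEntropyScheme

/-! ### Measures supported in a compact set -/

section Support

variable {N : ℕ} {K : Set (State N)} {g g' : State N → ℝ} {μ μ' : Measure (State N)}

lemma ContinuousOn.exists_continuous_extension (hK : IsClosed K) (hg : ContinuousOn g K) :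
    ∃ g' : State N → ℝ, Continuous g' ∧ EqOn g' g K := by
  obtain ⟨G, hG⟩ := ContinuousMap.exists_restrict_eq hK
    ⟨K.domRestrict g, continuousOn_iff_continuous_domRestrict.1 hg⟩
  refine ⟨G, G.continuous, fun z hz => ?_⟩
  have := DFunLike.congr_fun hG ⟨z, hz⟩
  simpa using this

lemma ae_mem_of_compl_null (h : μ Kᶜ = 0) : ∀ᵐ z ∂μ, z ∈ K := h

lemma integral_congr_of_eqOn (h : μ Kᶜ = 0) (he : EqOn g g' K) :
    ∫ z, g z ∂μ = ∫ z, g' z ∂μ :=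
  integral_congr_ae ((ae_mem_of_compl_null h).mono fun _ hz => he hz)

lemma integrable_of_continuousOn_compact [IsProbabilityMeasure μ] (hK : IsCompact K)
    (hg : ContinuousOn g K) (h : μ Kᶜ = 0) : Integrable g μ := by
  have h1 : IntegrableOn g K μ := hg.integrableOn_compact hK
  rwa [IntegrableOn, Measure.restrict_eq_self_of_ae_mem (ae_mem_of_compl_null h)] at h1

lemma abs_integral_le_of_support [IsProbabilityMeasure μ] {M : ℝ} (hM : ∀ z ∈ K, |g z| ≤ M)
    (h : μ Kᶜ = 0) : |∫ z, g z ∂μ| ≤ M := by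
  have := norm_integral_le_of_norm_le_const (μ := μ) (f := g) (C := M)
    ((ae_mem_of_compl_null h).mono fun z hz => hM z hz)
  simpa using this

/-- A countable family of test functions determines the probability measures on a compact set. -/
lemma exists_separating_family (hK : IsCompact K) :
    ∃ G : ℕ → State N → ℝ, (∀ i, Continuous (G i)) ∧
      ∀ μ μ' : Measure (State N), IsProbabilityMeasure μ → IsProbabilityMeasure μ' →
        μ Kᶜ = 0 → μ' Kᶜ = 0 → (∀ i, ∫ z, G i z ∂μ = ∫ z, G i z ∂μ') → μ = μ' := by
  have : CompactSpace K := isCompact_iff_compactSpace.1 hK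
  choose G hGc hG using fun i : ℕ =>
    ContinuousMap.exists_restrict_eq hK.isClosed (TopologicalSpace.denseSeq C(K, ℝ) i) |>.imp
      fun G hG => And.intro G.continuous hG
  refine ⟨fun i => G i, hGc, fun μ μ' _ _ hμ hμ' hGi => ?_⟩
  refine ext_of_forall_integral_eq_of_IsFiniteMeasure fun g => ?_
  refine eq_of_forall_dist_le fun ε hε => ?_
  obtain ⟨i, hi⟩ := (TopologicalSpace.denseRange_denseSeq C(K, ℝ)).exists_dist_lt
    ((g : C(State N, ℝ)).restrict K) (half_pos hε)
  have hclose : ∀ z ∈ K, |g z - G i z| ≤ ε / 2 := fun z hz => by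
    have h1 := (ContinuousMap.dist_apply_le_dist (f := (g : C(State N, ℝ)).restrict K)
      (g := TopologicalSpace.denseSeq C(K, ℝ) i) ⟨z, hz⟩).trans hi.le
    rw [← hG i, Real.dist_eq] at h1
    simpa using h1
  have hb : ∀ m : Measure (State N), IsProbabilityMeasure m → m Kᶜ = 0 →
      |(∫ z, g z ∂m) - ∫ z, G i z ∂m| ≤ ε / 2 := fun m _ hm => by
    rw [← integral_sub (integrable_of_continuousOn_compact hK g.continuous.continuousOn hm)
      (integrable_of_continuousOn_compact hK (hGc i).continuousOn hm)]
    exact abs_integral_le_of_support hclose hm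
  have b1 := abs_le.1 (hb μ inferInstance hμ)
  have b2 := abs_le.1 (hb μ' inferInstance hμ')
  rw [Real.dist_eq, abs_le]
  have := hGi i
  constructor <;> linarith [b1.1, b1.2, b2.1, b2.2]

end Support

/-! ### Young measures: restriction and support -/

section Young

variable {N : ℕ} {α : Type*} [MeasureSpace α] {K S : Set (State N)} {Ω Ω' : Set α}
  {ν : α → Measure (State N)} {u u' : ℕ → α → State N} {g : State N → ℝ}

lemma IsYoungFamily.ae_abs_le (h : IsYoungFamily K Ω ν) {M : ℝ} (hM : ∀ z ∈ K, |g z| ≤ M) :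
    ∀ᵐ p ∂(volume.restrict Ω), |∫ z, g z ∂(ν p)| ≤ M := by
  filter_upwards [h.prob] with p hp
  have := hp.1
  exact abs_integral_le_of_support hM hp.2

lemma IsYoungFamily.mono (h : IsYoungFamily S Ω ν) (hΩ : Ω' ⊆ Ω) : IsYoungFamily S Ω' ν where
  prob := ae_restrict_of_ae_restrict_of_subset hΩ h.prob
  measurable g hg := (h.measurable g hg).mono_measure (Measure.restrict_mono hΩ le_rfl)

lemma IsYoungMeasure.mono (h : IsYoungMeasure S Ω u ν) (hΩ : Ω' ⊆ Ω) (hm : MeasurableSet Ω') :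
    IsYoungMeasure S Ω' u ν where
  toIsYoungFamily := h.toIsYoungFamily.mono hΩ
  tendsto g hg φ hφ := by
    have hφ' : Integrable (Ω'.indicator φ) (volume.restrict Ω) := by
      rw [integrable_indicator_iff hm, IntegrableOn, Measure.restrict_restrict hm,
        inter_eq_self_of_subset_left hΩ]
      exact hφ
    have hset : ∀ k : α → ℝ, ∫ p in Ω, k p * Ω'.indicator φ p = ∫ p in Ω', k p * φ p := fun k => by
      rw [← inter_eq_self_of_subset_left hΩ, ← Measure.restrict_restrict hm,
        ← integral_indicator hm]
      refine integral_congr_ae (Eventually.of_forall fun p => ?_)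
      simp only [inter_eq_self_of_subset_left hΩ]
      by_cases hp : p ∈ Ω' <;> simp [hp]
    have := h.tendsto g hg _ hφ'
    simpa only [hset] using this

lemma IsYoungMeasure.congr (h : IsYoungMeasure S Ω u ν) (hm : MeasurableSet Ω)
    (hu : ∀ n, ∀ p ∈ Ω, u n p = u' n p) : IsYoungMeasure S Ω u' ν where
  toIsYoungFamily := h.toIsYoungFamily
  tendsto g hg φ hφ := by
    refine (h.tendsto g hg φ hφ).congr fun n => setIntegral_congr_fun hm fun p hp => ?_
    simp only [hu n p hp]

/-- A Young measure associated with functions with values in a compact set is supported in this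
set. -/
lemma IsYoungMeasure.of_mem_compact [SigmaFinite (volume : Measure α)]
    (h : IsYoungMeasure S Ω u ν) (hm : MeasurableSet Ω) (hK : IsCompact K)
    (hKne : K.Nonempty) (hu : ∀ n, ∀ p ∈ Ω, u n p ∈ K) : IsYoungMeasure K Ω u ν := by
  -- This test function vanishes along the sequence and exactly on `K`. Truncation makes it
  -- integrable for every probability measure.
  set d : State N → ℝ := fun z => min (Metric.infDist z K) 1 with hd
  have hdc : Continuous d := (Metric.continuous_infDist_pt K).min continuous_const
  have hd0 : ∀ z, 0 ≤ d z := fun z => le_min Metric.infDist_nonneg zero_le_one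
  have hd1 : ∀ z, |d z| ≤ 1 := fun z => by rw [abs_of_nonneg (hd0 z)]; exact min_le_right _ _
  have hdK : ∀ z ∈ K, d z = 0 := fun z hz => by simp [hd, Metric.infDist_zero_of_mem hz]
  have hdKc : ∀ z, d z = 0 → z ∈ K := fun z hz => by
    rw [hK.isClosed.mem_iff_infDist_zero hKne]
    simp only [hd] at hz
    rcases min_choice (Metric.infDist z K) 1 with h1 | h1 <;> rw [h1] at hz
    · exact hz
    · norm_num at hz
  have hbd : ∀ᵐ p ∂(volume.restrict Ω), ‖∫ z, d z ∂(ν p)‖ ≤ 1 :=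
    h.toIsYoungFamily.ae_abs_le fun z _ => hd1 z
  have hzero : (fun p => ∫ z, d z ∂(ν p)) =ᵐ[volume.restrict Ω] 0 := by
    refine ae_eq_zero_of_forall_setIntegral_eq_of_sigmaFinite (fun s hs hsf => ?_)
      fun s hs hsf => ?_
    · exact Measure.integrableOn_of_bounded hsf.ne (h.measurable d hdc.continuousOn)
        (ae_restrict_of_ae hbd)
    · have hφ : Integrable (s.indicator fun _ => (1 : ℝ)) (volume.restrict Ω) := by
        rw [integrable_indicator_iff hs]
        exact integrableOn_const hsf.ne
      have h1 := h.tendsto d hdc.continuousOn _ hφ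
      have h2 : ∀ n, ∫ p in Ω, d (u n p) * s.indicator (fun _ => (1 : ℝ)) p = 0 := fun n => by
        rw [setIntegral_congr_fun hm (g := fun _ => 0) fun p hp => by simp [hdK _ (hu n p hp)]]
        simp
      simp only [h2] at h1
      rw [← integral_indicator hs]
      have h3 := tendsto_nhds_unique tendsto_const_nhds h1
      rw [h3]
      refine integral_congr_ae (Eventually.of_forall fun p => ?_)
      by_cases hp : p ∈ s <;> simp [hp]
  have hprob : ∀ᵐ p ∂(volume.restrict Ω), IsProbabilityMeasure (ν p) ∧ ν p Kᶜ = 0 := by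
    filter_upwards [h.prob, hzero] with p hp hp0
    have := hp.1
    refine ⟨hp.1, ?_⟩
    have hint : Integrable d (ν p) := Integrable.of_bound hdc.aestronglyMeasurable 1
      (Eventually.of_forall hd1)
    have h1 := (integral_eq_zero_iff_of_nonneg hd0 hint).1 hp0
    exact h1.mono fun z hz => hdKc z hz
  refine ⟨⟨hprob, fun g hg => ?_⟩, fun g hg φ hφ => ?_⟩
  · obtain ⟨g', hg'c, hg'⟩ := hg.exists_continuous_extension hK.isClosed
    refine (h.measurable g' hg'c.continuousOn).congr ?_
    filter_upwards [hprob] with p hp using integral_congr_of_eqOn hp.2 hg'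
  · obtain ⟨g', hg'c, hg'⟩ := hg.exists_continuous_extension hK.isClosed
    have h1 := h.tendsto g' hg'c.continuousOn φ hφ
    have h2 : ∫ p in Ω, (∫ z, g' z ∂(ν p)) * φ p = ∫ p in Ω, (∫ z, g z ∂(ν p)) * φ p := by
      refine integral_congr_ae ?_
      filter_upwards [hprob] with p hp
      rw [integral_congr_of_eqOn hp.2 hg']
    rw [h2] at h1
    refine h1.congr fun n => setIntegral_congr_fun hm fun p hp => ?_
    simp only [hg' (hu n p hp)]

end Young

/-! ### Young measures that do not depend on the first variable -/

section Layer

variable {N : ℕ} {K : Set (State N)} {g : State N → ℝ}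

lemma volume_restrict_prod (A B : Set ℝ) : (volume : Measure (ℝ × ℝ)).restrict (A ×ˢ B)
    = (volume.restrict A).prod (volume.restrict B) := by
  rw [Measure.volume_eq_prod, Measure.prod_restrict]

/-- A Young measure associated with functions which depend only on the second variable depends
only on the second variable. -/
lemma IsYoungMeasure.integral_eq_average {A B : Set ℝ} {w : ℕ → ℝ → State N}
    {π : ℝ × ℝ → Measure (State N)} (hK : IsCompact K) (hA1 : volume A = 1)
    (hw : ∀ n, Measurable (w n)) (hwK : ∀ n t, w n t ∈ K)
    (h : IsYoungMeasure K (A ×ˢ B) (fun n p => w n p.2) π) (hg : ContinuousOn g K) :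
    (fun p => ∫ z, g z ∂(π p)) =ᵐ[volume.restrict (A ×ˢ B)]
      fun p => ∫ y in A, ∫ z, g z ∂(π (y, p.2)) := by
  have : IsProbabilityMeasure (volume.restrict A) := ⟨by simp [hA1]⟩
  obtain ⟨M, hM⟩ := hK.exists_bound_of_continuousOn hg
  have hbd := h.toIsYoungFamily.ae_abs_le hM
  have hGm := h.measurable g hg
  have htend := h.tendsto g hg
  rw [volume_restrict_prod] at hbd hGm htend ⊢
  set μ := (volume : Measure ℝ).restrict A
  set τ := (volume : Measure ℝ).restrict B
  set G : ℝ × ℝ → ℝ := fun p => ∫ z, g z ∂(π p) with hG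
  have hAm : AEStronglyMeasurable (fun t => ∫ y, G (y, t) ∂μ) τ :=
    hGm.prod_swap.integral_prod_right'
  have hAb : ∀ᵐ t ∂τ, ‖∫ y, G (y, t) ∂μ‖ ≤ M := by
    have h1 : ∀ᵐ q ∂(τ.prod μ), |G q.swap| ≤ M :=
      Measure.measurePreserving_swap.quasiMeasurePreserving.ae hbd
    filter_upwards [Measure.ae_ae_of_ae_prod h1] with t ht
    have := norm_integral_le_of_norm_le_const (f := fun y => G (y, t)) (C := M) ht
    simpa using this
  have hwg : ∀ n, Measurable fun t => g (w n t) := fun n => hg.measurable_comp_of_mem (hw n) (hwK n)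
  have hAb' : ∀ᵐ p ∂(μ.prod τ), ‖∫ y, G (y, p.2) ∂μ‖ ≤ M :=
    Measure.quasiMeasurePreserving_snd.ae hAb
  refine ae_eq_of_forall_setIntegral_eq_of_sigmaFinite
    (fun s _ hsf => Measure.integrableOn_of_bounded hsf.ne hGm (ae_restrict_of_ae hbd))
    (fun s _ hsf => Measure.integrableOn_of_bounded hsf.ne hAm.comp_snd (ae_restrict_of_ae hAb'))
    fun s hs hsf => ?_
  set φ : ℝ × ℝ → ℝ := s.indicator fun _ => 1 with hφ
  have hφi : Integrable φ (μ.prod τ) := (integrable_indicator_iff hs).2 (integrableOn_const hsf.ne)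
  -- The sequence does not see `y`, so it pairs equally with `φ` and with its average in `y`. In the
  -- limit the averaging passes by Fubini from `φ` to `G`.
  set ψ : ℝ → ℝ := fun t => ∫ y, φ (y, t) ∂μ with hψ
  have hψi : Integrable ψ τ := hφi.integral_prod_right
  have hψi' : Integrable (fun p : ℝ × ℝ => ψ p.2) (μ.prod τ) := hψi.comp_snd μ
  have l1 := htend φ hφi
  have l2 := htend (fun p => ψ p.2) hψi'
  have heq : ∀ n, ∫ p, g (w n p.2) * φ p ∂(μ.prod τ) = ∫ p, g (w n p.2) * ψ p.2 ∂(μ.prod τ) := by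
    intro n
    have i1 : Integrable (fun p => g (w n p.2) * φ p) (μ.prod τ) :=
      hφi.bdd_mul ((hwg n).comp measurable_snd).aestronglyMeasurable
        (Eventually.of_forall fun p => hM _ (hwK n p.2))
    have i2 : Integrable (fun p => g (w n p.2) * ψ p.2) (μ.prod τ) :=
      hψi'.bdd_mul ((hwg n).comp measurable_snd).aestronglyMeasurable
        (Eventually.of_forall fun p => hM _ (hwK n p.2))
    rw [integral_prod_symm _ i1, integral_prod_symm _ i2]
    refine integral_congr_ae (Eventually.of_forall fun t => ?_)
    simp only [integral_const_mul, integral_const, probReal_univ, one_smul, hψ]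
  simp only [heq] at l1
  have e1 := tendsto_nhds_unique l1 l2
  have e2 : ∫ p in s, G p ∂(μ.prod τ) = ∫ p, G p * φ p ∂(μ.prod τ) := by
    rw [← integral_indicator hs]
    refine integral_congr_ae (Eventually.of_forall fun p => ?_)
    by_cases hp : p ∈ s <;> simp [hφ, hp]
  have e3 : ∫ p in s, (∫ y, G (y, p.2) ∂μ) ∂(μ.prod τ)
      = ∫ p, (∫ y, G (y, p.2) ∂μ) * φ p ∂(μ.prod τ) := by
    rw [← integral_indicator hs]
    refine integral_congr_ae (Eventually.of_forall fun p => ?_)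
    by_cases hp : p ∈ s <;> simp [hφ, hp]
  have i3 : Integrable (fun p => G p * ψ p.2) (μ.prod τ) := hψi'.bdd_mul hGm hbd
  have i4 : Integrable (fun p => (∫ y, G (y, p.2) ∂μ) * φ p) (μ.prod τ) :=
    hφi.bdd_mul hAm.comp_snd hAb'
  rw [e2, e3, e1, integral_prod_symm _ i3, integral_prod_symm _ i4]
  refine integral_congr_ae (Eventually.of_forall fun t => ?_)
  simp only [integral_mul_const, integral_const_mul, hψ]

/-- For a countable separating family the integrals equal their averages in `y` almost everywhere.
This determines the measures, so almost any slice serves as `ρ`. -/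
lemma IsYoungMeasure.exists_layer {A B : Set ℝ} {w : ℕ → ℝ → State N}
    {π : ℝ × ℝ → Measure (State N)} (hK : IsCompact K) (hA1 : volume A = 1)
    (hw : ∀ n, Measurable (w n)) (hwK : ∀ n t, w n t ∈ K)
    (h : IsYoungMeasure K (A ×ˢ B) (fun n p => w n p.2) π) :
    ∃ ρ : ℝ → Measure (State N), (∀ᵐ p ∂(volume.restrict (A ×ˢ B)), π p = ρ p.2) ∧
      IsYoungMeasure K B w ρ := by
  have : IsProbabilityMeasure ((volume : Measure ℝ).restrict A) := ⟨by simp [hA1]⟩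
  obtain ⟨G, hGc, hG⟩ := exists_separating_family hK
  have hall : ∀ᵐ p ∂(volume.restrict (A ×ˢ B)), (IsProbabilityMeasure (π p) ∧ π p Kᶜ = 0) ∧
      ∀ i, ∫ z, G i z ∂(π p) = ∫ y in A, ∫ z, G i z ∂(π (y, p.2)) := by
    filter_upwards [h.prob, ae_all_iff.2 fun i =>
      h.integral_eq_average hK hA1 hw hwK (hGc i).continuousOn] with p h1 h2 using ⟨h1, h2⟩
  have hmeas := h.measurable
  have htend := h.tendsto
  rw [volume_restrict_prod] at hall hmeas htend ⊢
  set μ := (volume : Measure ℝ).restrict A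
  set τ := (volume : Measure ℝ).restrict B with hτ
  -- A slice on which the almost-everywhere statement holds for almost every time.
  obtain ⟨y₀, hy₀⟩ := (Measure.ae_ae_of_ae_prod hall).exists
  have hae : ∀ᵐ p ∂(μ.prod τ), π p = π (y₀, p.2) := by
    filter_upwards [hall, Measure.quasiMeasurePreserving_snd.ae hy₀] with p h1 h2
    exact hG _ _ h1.1.1 h2.1.1 h1.1.2 h2.1.2 fun i => (h1.2 i).trans (h2.2 i).symm
  refine ⟨fun t => π (y₀, t), hae, ⟨⟨hy₀.mono fun t ht => ht.1, fun g hg => ?_⟩,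
    fun g hg φ hφ => ?_⟩⟩
  · have h1 : AEStronglyMeasurable (fun p : ℝ × ℝ => ∫ z, g z ∂(π (y₀, p.2))) (μ.prod τ) :=
      (hmeas g hg).congr (hae.mono fun p hp => by simp only [← hp])
    obtain ⟨y, hy⟩ := h1.prodMk_left.exists
    exact hy
  · have h1 := htend g hg (fun p => φ p.2) (hφ.comp_snd μ)
    have h2 : ∫ p, (∫ z, g z ∂(π p)) * φ p.2 ∂(μ.prod τ)
        = ∫ p : ℝ × ℝ, (∫ z, g z ∂(π (y₀, p.2))) * φ p.2 ∂(μ.prod τ) :=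
      integral_congr_ae (hae.mono fun p hp => by simp only [← hp])
    rw [h2, integral_fun_snd fun t => (∫ z, g z ∂(π (y₀, t))) * φ t] at h1
    rw [probReal_univ, one_smul] at h1
    refine h1.congr fun n => ?_
    rw [integral_fun_snd fun t => g (w n t) * φ t, probReal_univ, one_smul]

end Layer

/-! ### Essential limits at the origin -/

section EssentialLimit

variable {I : ℝ → ℝ} {A C L M : ℝ}

/-- The filter encodes essential limits from the right: null sets near 0 are ignored. -/
lemma eventually_nhdsGT_inf_ae_iff {P : ℝ → Prop} :
    (∀ᶠ x in 𝓝[>] (0 : ℝ) ⊓ ae volume, P x) ↔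
      ∃ r, 0 < r ∧ ∀ᵐ x ∂(volume : Measure ℝ), 0 < x → x < r → P x := by
  rw [Filter.eventually_inf]
  constructor
  · rintro ⟨s, hs, t, ht, h⟩
    obtain ⟨r, hr, hrs⟩ := mem_nhdsGT_iff_exists_Ioo_subset.1 hs
    exact ⟨r, hr, mem_of_superset ht fun x hx h0 h1 => h x ⟨hrs ⟨h0, h1⟩, hx⟩⟩
  · rintro ⟨r, hr, h⟩
    exact ⟨Ioo 0 r, Ioo_mem_nhdsGT hr, _, h, fun x hx => hx.2 hx.1.1 hx.1.2⟩

lemma exists_ae_abs_sub_lt (hL : Tendsto I (𝓝[>] (0 : ℝ) ⊓ ae volume) (𝓝 L)) {η : ℝ}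
    (hη : 0 < η) : ∃ r, 0 < r ∧ ∀ᵐ x ∂(volume : Measure ℝ), 0 < x → x < r → |I x - L| < η :=
  eventually_nhdsGT_inf_ae_iff.1 (Metric.tendsto_nhds.1 hL η hη)

lemma abs_integral_sub_le_of_ae {a b r η : ℝ} (ha : 0 ≤ a) (hab : a ≤ b) (hb : b < r)
    (hI : IntervalIntegrable I volume a b)
    (h : ∀ᵐ x ∂(volume : Measure ℝ), 0 < x → x < r → |I x - L| < η) :
    |(∫ x in a..b, I x) - (b - a) * L| ≤ η * (b - a) := by
  have h1 : (∫ x in a..b, I x) - (b - a) * L = ∫ x in a..b, (I x - L) := by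
    rw [intervalIntegral.integral_sub hI intervalIntegrable_const, intervalIntegral.integral_const,
      smul_eq_mul]
  have h2 := intervalIntegral.norm_integral_le_of_norm_le_const_ae (a := a) (b := b) (C := η)
    (f := fun x => I x - L) (by
      filter_upwards [h] with x hx hxm
      rw [uIoc_of_le hab] at hxm
      exact (hx (ha.trans_lt hxm.1) (hxm.2.trans_lt hb)).le)
  rwa [abs_of_nonneg (sub_nonneg.2 hab), Real.norm_eq_abs, ← h1] at h2

/-- The averages over small intervals converge to the essential limit. -/
lemma tendsto_average_of_ess_limit (hI : ∀ X, 0 ≤ X → IntervalIntegrable I volume 0 X)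
    (hL : Tendsto I (𝓝[>] (0 : ℝ) ⊓ ae volume) (𝓝 L)) :
    Tendsto (fun ε => ε⁻¹ * ∫ x in (0 : ℝ)..ε, I x) (𝓝[>] 0) (𝓝 L) := by
  rw [Metric.tendsto_nhds]
  intro η hη
  obtain ⟨r, hr, h⟩ := exists_ae_abs_sub_lt hL (half_pos hη)
  filter_upwards [Ioo_mem_nhdsGT hr] with ε hε
  have h1 := abs_integral_sub_le_of_ae le_rfl hε.1.le hε.2 (hI ε hε.1.le) h
  have hε0 : 0 < ε := hε.1
  rw [sub_zero] at h1
  have h2 : ε⁻¹ * (∫ x in (0 : ℝ)..ε, I x) - L = ε⁻¹ * ((∫ x in (0 : ℝ)..ε, I x) - ε * L) := by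
    field_simp
  rw [Real.dist_eq, h2, abs_mul, abs_of_pos (inv_pos.2 hε0), inv_mul_lt_iff₀ hε0]
  nlinarith

/-- The average over [b, 2b] is at most A + 2Cb and is close to `L` for small `b`. Intervals away
from 0 suffice, which is all that the scheme provides. -/
lemma ess_limit_le_of_integral_le (hI : ∀ X, 0 ≤ X → IntervalIntegrable I volume 0 X)
    (hL : Tendsto I (𝓝[>] (0 : ℝ) ⊓ ae volume) (𝓝 L)) (hC : 0 ≤ C)
    (h : ∀ b δ, 0 < b → 0 ≤ δ → ∫ x in b..b + δ, I x ≤ δ * (A + C * (b + δ))) : L ≤ A := by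
  refine le_of_forall_pos_le_add fun η hη => ?_
  obtain ⟨r, hr, hr'⟩ := exists_ae_abs_sub_lt hL (half_pos hη)
  set b := min (r / 3) (η / (4 * (C + 1))) with hb
  have hb0 : 0 < b := lt_min (by positivity) (by positivity)
  have hbr : b + b < r := by linarith [min_le_left (r / 3) (η / (4 * (C + 1)))]
  have hbC : C * (b + b) ≤ η / 2 := by
    have h1 : b ≤ η / (4 * (C + 1)) := min_le_right _ _
    rw [le_div_iff₀ (by positivity)] at h1
    nlinarith
  have h1 := h b b hb0 hb0.le
  have h2 := abs_le.1 (abs_integral_sub_le_of_ae hb0.le (by linarith) hbr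
    ((hI b hb0.le).symm.trans (hI (b + b) (by linarith))) hr')
  have h3 : b * L ≤ b * (A + η) := by
    have := mul_le_mul_of_nonneg_left hbC hb0.le
    have e := h2.1
    rw [add_sub_cancel_left] at e
    nlinarith
  exact le_of_mul_le_mul_left h3 hb0

/-- A bounded function whose averages over short intervals are nonincreasing, up to a linear
error, has an essential limit at the origin. -/
lemma exists_ess_limit (hI : ∀ X, 0 ≤ X → IntervalIntegrable I volume 0 X)
    (hM : ∀ᵐ x ∂(volume : Measure ℝ), 0 < x → |I x| ≤ M) (hC : 0 ≤ C)
    (hmono : ∀ a b δ, 0 < a → a < b → 0 ≤ δ →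
      ∫ x in b..b + δ, I x ≤ (∫ x in a..a + δ, I x) + δ * (C * (b - a))) :
    ∃ L, Tendsto I (𝓝[>] (0 : ℝ) ⊓ ae volume) (𝓝 L) := by
  -- Points at which the primitive of `I` has derivative `I x`: there the hypothesis on averages
  -- becomes pointwise as δ → 0.
  set G : Set ℝ := {x | 0 < x ∧ x < 1 ∧ |I x| ≤ M ∧
    HasDerivAt (fun x => ∫ t in (0 : ℝ)..x, I t) (I x) x} with hG
  have hGae : ∀ᵐ x ∂(volume : Measure ℝ), 0 < x → x < 1 → x ∈ G := by
    filter_upwards [hM, (hI 1 zero_le_one).ae_hasDerivAt_integral] with x h1 h2 h3 h4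
    exact ⟨h3, h4, h1 h3, h2 (by rw [uIcc_of_le zero_le_one]; exact ⟨h3.le, h4.le⟩) 0
      left_mem_uIcc⟩
  have hanti : ∀ a ∈ G, ∀ b ∈ G, a < b → I b - C * b ≤ I a - C * a := by
    intro a ha b hb hab
    have ta := ha.2.2.2.tendsto_slope_zero_right
    have tb := hb.2.2.2.tendsto_slope_zero_right
    have : I b ≤ I a + C * (b - a) := by
      refine le_of_tendsto_of_tendsto tb (ta.add_const _) ?_
      filter_upwards [self_mem_nhdsWithin] with δ hδ
      have hδ0 : 0 < δ := hδ
      have i : ∀ x, 0 < x → IntervalIntegrable I volume 0 x := fun x hx => hI x hx.le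
      rw [intervalIntegral.integral_interval_sub_left (i _ (by linarith [hb.1])) (i _ hb.1),
        intervalIntegral.integral_interval_sub_left (i _ (by linarith [ha.1])) (i _ ha.1),
        smul_eq_mul, smul_eq_mul]
      have h1 := hmono a b δ ha.1 hab hδ0.le
      have h2 := mul_le_mul_of_nonneg_left h1 (inv_pos.2 hδ0).le
      rw [mul_add, inv_mul_cancel_left₀ hδ0.ne'] at h2
      exact h2
    linarith
  set S : Set ℝ := (fun x => I x - C * x) '' G with hS
  have hbdd : BddAbove S := by
    refine ⟨M, ?_⟩
    rintro _ ⟨x, hx, rfl⟩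
    have := (abs_le.1 hx.2.2.1).2
    have := mul_nonneg hC hx.1.le
    simp only
    linarith
  have hne : ∀ r, 0 < r → r ≤ 1 → ∃ x ∈ G, x < r := by
    intro r hr hr1
    by_contra! hcon
    have h1 : ∀ᵐ x ∂(volume : Measure ℝ), x ∉ Ioo 0 r := by
      filter_upwards [hGae] with x hx hx'
      exact absurd hx'.2 (not_lt.2 (hcon x (hx hx'.1 (hx'.2.trans_le hr1))))
    have h2 : volume (Ioo 0 r) = 0 := by
      simpa only [ae_iff, not_not, ofPred_mem_eq] using h1
    rw [Real.volume_Ioo, sub_zero, ENNReal.ofReal_eq_zero] at h2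
    linarith
  -- On the good set I(x) - C x is nonincreasing and bounded above, so its limit at 0 is its
  -- supremum.
  refine ⟨sSup S, ?_⟩
  rw [Metric.tendsto_nhds]
  intro η hη
  obtain ⟨x₁, hx₁, -⟩ := hne 1 one_pos le_rfl
  obtain ⟨_, ⟨x₀, hx₀, rfl⟩, hlt⟩ := exists_lt_of_lt_csSup (⟨_, x₁, hx₁, rfl⟩ : S.Nonempty)
    (sub_lt_self (sSup S) hη)
  rw [eventually_nhdsGT_inf_ae_iff]
  refine ⟨min x₀ (η / (C + 1)), lt_min hx₀.1 (by positivity), ?_⟩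
  filter_upwards [hGae] with x hx h0 hxr
  have hxx₀ : x < x₀ := hxr.trans_le (min_le_left _ _)
  have hxG := hx h0 (hxx₀.trans hx₀.2.1)
  have h1 := hanti x hxG x₀ hx₀ hxx₀
  have h2 : I x - C * x ≤ sSup S := le_csSup hbdd ⟨x, hxG, rfl⟩
  have h3 : C * x < η := by
    have h4 : x < η / (C + 1) := hxr.trans_le (min_le_right _ _)
    rw [lt_div_iff₀ (by linarith)] at h4
    nlinarith
  have h5 := mul_nonneg hC h0.le
  simp only at hlt
  rw [Real.dist_eq, abs_lt]
  constructor <;> linarith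

end EssentialLimit

/-! ### From interface fluxes to the flux of the Young measure -/

section Trace

variable {N : ℕ} {f : State N → State N} {𝒰 K : Set (State N)} {lam : ℝ} {h : ℕ → ℝ}
  {c W : ℕ → ℕ → ℝ → State N} {U F g : State N → ℝ} {θ : ℝ → ℝ} {T₁ T₂ : ℝ}
  {ν : ℝ × ℝ → Measure (State N)}

lemma IsEntropyScheme.measurable_comp_cell_prod (hS : IsEntropyScheme f 𝒰 K lam h c W)
    (hg : ContinuousOn g K) (n : ℕ) :
    Measurable fun p : ℝ × ℝ => g (c n ⌊p.1 / h n⌋₊ p.2) := by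
  have h1 : Measurable fun q : ℕ × ℝ => g (c n q.1 q.2) :=
    measurable_from_prod_countable_right fun m => hS.measurable_comp_cell hg n m
  exact h1.comp ((Nat.measurable_floor.comp (measurable_fst.div_const _)).prodMk measurable_snd)

/-- Convergence of space-time averages. -/
lemma IsYoungMeasure.tendsto_average (hS : IsEntropyScheme f 𝒰 K lam h c W) (hK : IsCompact K)
    (hν : IsYoungMeasure K (Ioi (0 : ℝ) ×ˢ Ioi (0 : ℝ)) (fun n p => c n ⌊p.1 / h n⌋₊ p.2) ν)
    (hg : ContinuousOn g K) (h0 : 0 ≤ T₁) (h12 : T₁ ≤ T₂)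
    (hθ : IntervalIntegrable θ volume T₁ T₂) {a b : ℝ} (ha : 0 ≤ a) (hab : a ≤ b) :
    IntervalIntegrable (fun x => timeAverage T₁ T₂ θ g fun t => ν (x, t)) volume a b ∧
    Tendsto (fun n => ∫ x in a..b, ∫ t in T₁..T₂, g (c n ⌊x / h n⌋₊ t) * θ t) atTop
      (𝓝 (∫ x in a..b, timeAverage T₁ T₂ θ g fun t => ν (x, t))) := by
  obtain ⟨M, hM⟩ := hK.exists_bound_of_continuousOn hg
  have hν' := hν.mono (Ω' := Ioc a b ×ˢ Ioc T₁ T₂)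
    (prod_mono (fun x hx => ha.trans_lt hx.1) fun t ht => h0.trans_lt ht.1)
    (measurableSet_Ioc.prod measurableSet_Ioc)
  have hbd := hν'.toIsYoungFamily.ae_abs_le hM
  have hm := hν'.measurable g hg
  have ht := hν'.tendsto g hg
  rw [intervalIntegrable_iff_integrableOn_Ioc_of_le h12] at hθ
  rw [volume_restrict_prod] at hbd hm ht
  have hφ : Integrable (fun p : ℝ × ℝ => θ p.2)
      ((volume.restrict (Ioc a b)).prod (volume.restrict (Ioc T₁ T₂))) := hθ.comp_snd _
  have h1 := ht _ hφ
  have i1 : Integrable (fun p : ℝ × ℝ => (∫ z, g z ∂(ν p)) * θ p.2)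
      ((volume.restrict (Ioc a b)).prod (volume.restrict (Ioc T₁ T₂))) := hφ.bdd_mul hm hbd
  have i2 := i1.integral_prod_left
  simp only [timeAverage, intervalIntegral.integral_of_le h12, intervalIntegral.integral_of_le hab,
    intervalIntegrable_iff_integrableOn_Ioc_of_le hab]
  refine ⟨i2, ?_⟩
  rw [integral_prod _ i1] at h1
  refine h1.congr fun n => ?_
  exact integral_prod (fun p : ℝ × ℝ => g (c n ⌊p.1 / h n⌋₊ p.2) * θ p.2)
    (hφ.bdd_mul (hS.measurable_comp_cell_prod hg n).aestronglyMeasurable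
    (Eventually.of_forall fun p => hM _ (hS.cell_mem _ _ _)))

lemma IsYoungFamily.ae_abs_timeAverage_le (hK : IsCompact K)
    (hν : IsYoungFamily K (Ioi (0 : ℝ) ×ˢ Ioi (0 : ℝ)) ν) (hg : ContinuousOn g K) (h0 : 0 ≤ T₁)
    (h12 : T₁ ≤ T₂) (hθ : IntervalIntegrable θ volume T₁ T₂) :
    ∃ M, ∀ᵐ x ∂(volume : Measure ℝ), 0 < x →
      |timeAverage T₁ T₂ θ g fun t => ν (x, t)| ≤ M := by
  obtain ⟨M, hM⟩ := hK.exists_bound_of_continuousOn hg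
  refine ⟨∫ t in T₁..T₂, M * |θ t|, ?_⟩
  have hbd := hν.ae_abs_le hM
  rw [volume_restrict_prod] at hbd
  have h1 := Measure.ae_ae_of_ae_prod hbd
  rw [ae_restrict_iff' measurableSet_Ioi] at h1
  filter_upwards [h1] with x hx hx0
  have hx' := (ae_restrict_iff' measurableSet_Ioi).1 (hx hx0)
  change ‖∫ t in T₁..T₂, (∫ z, g z ∂(ν (x, t))) * θ t‖ ≤ _
  refine intervalIntegral.norm_integral_le_of_norm_le h12 ?_ (hθ.abs.const_mul M)
  filter_upwards [hx'] with t ht htm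
  rw [norm_mul, Real.norm_eq_abs, Real.norm_eq_abs]
  exact mul_le_mul_of_nonneg_right (ht (h0.trans_lt htm.1)) (abs_nonneg _)

end Trace

lemma intervalIntegrable_comp_floor {s : ℕ → ℝ} {B : ℝ} (hs : ∀ m, |s m| ≤ B) (d a b : ℝ) :
    IntervalIntegrable (fun x : ℝ => s ⌊x / d⌋₊) volume a b :=
  intervalIntegrable_of_bounded ((measurable_from_nat (f := s)).comp
    (Nat.measurable_floor.comp (measurable_id.div_const d))) (fun _ => hs _) a b

section Trace

variable {N : ℕ} {f : State N → State N} {𝒰 K : Set (State N)} {lam : ℝ} {h : ℕ → ℝ}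
  {c W : ℕ → ℕ → ℝ → State N} {U F g : State N → ℝ} {θ : ℝ → ℝ} {T₁ T₂ : ℝ}
  {ν : ℝ × ℝ → Measure (State N)}

/-- The time averages of the entropy flux of the Young measure are nonincreasing in the space
direction, up to a linear error, and lie below those at a fixed interface. -/
lemma IsEntropyScheme.exists_integral_timeAverage_le (hS : IsEntropyScheme f 𝒰 K lam h c W)
    (hK : IsCompact K) (hK𝒰 : K ⊆ 𝒰) (hlam : 0 < lam) (h_pos : ∀ n, 0 < h n)
    (h_lim : Tendsto h atTop (𝓝 0)) (hp : IsConvexEntropyPair f 𝒰 U F)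
    (hν : IsYoungMeasure K (Ioi (0 : ℝ) ×ˢ Ioi (0 : ℝ)) (fun n p => c n ⌊p.1 / h n⌋₊ p.2) ν)
    (hθ : LocallyBoundedVariationOn θ (Ici 0)) (hθ0 : ∀ t, 0 ≤ t → 0 ≤ θ t) (h0 : 0 ≤ T₁)
    (h12 : T₁ ≤ T₂) :
    ∃ C, 0 ≤ C ∧ (∀ a b δ, 0 < a → a < b → 0 ≤ δ →
        ∫ x in b..b + δ, (timeAverage T₁ T₂ θ F fun t => ν (x, t))
          ≤ (∫ x in a..a + δ, timeAverage T₁ T₂ θ F fun t => ν (x, t)) + δ * (C * (b - a))) ∧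
      ∀ k A, Tendsto (fun n => ∫ t in T₁..T₂, F (W n k t) * θ t) atTop (𝓝 A) →
        ∀ b δ, 0 < b → 0 ≤ δ →
          ∫ x in b..b + δ, (timeAverage T₁ T₂ θ F fun t => ν (x, t))
            ≤ δ * (A + C * (b + δ)) := by
  have hFc := hp.continuousOn_flux.mono hK𝒰
  obtain ⟨MF, hMF⟩ := hK.exists_bound_of_continuousOn hFc
  have hθi := hθ.intervalIntegrable_of_nonneg h0 h12
  obtain ⟨B, hB0, hB⟩ := hθ.exists_bound_Icc h0 h12
  obtain ⟨C, hC0, hC⟩ := hS.exists_flux_le hK hK𝒰 hlam h_pos hp hθ hθ0 h0 h12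
  set e := fluxDefect F c W with he
  have he0 : ∀ n m t, 0 ≤ e n m t := fun n m t =>
    add_nonneg (le_max_left _ _) (le_max_left _ _)
  have hem : ∀ n m, Measurable (e n m) := hS.measurable_fluxDefect hFc
  have heb : ∀ n m t, |e n m t| ≤ 4 * MF := hS.abs_fluxDefect_le hMF
  have hei : ∀ n m, IntervalIntegrable (e n m) volume T₁ T₂ := fun n m =>
    intervalIntegrable_of_bounded (hem n m) (heb n m) _ _
  set E : ℕ → ℕ → ℝ := fun n m => ∫ t in T₁..T₂, e n m t with hE
  have hE0 : ∀ n m, 0 ≤ E n m := fun n m =>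
    intervalIntegral.integral_nonneg h12 fun t _ => he0 n m t
  have hEb : ∀ n m, |E n m| ≤ 4 * MF * |T₂ - T₁| := fun n m => by
    have := intervalIntegral.norm_integral_le_of_norm_le_const (a := T₁) (b := T₂)
      (f := e n m) fun t _ => (Real.norm_eq_abs _).trans_le (heb n m t)
    rwa [Real.norm_eq_abs] at this
  have hEi : ∀ n a b, IntervalIntegrable (fun x : ℝ => E n ⌊x / h n⌋₊) volume a b := fun n a b =>
    intervalIntegrable_comp_floor (hEb n) _ _ _
  have hci : ∀ n m, IntervalIntegrable (fun t => F (c n m t) * θ t) volume T₁ T₂ := fun n m =>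
    hθi.bounded_mul (hS.measurable_comp_cell hFc n m) fun t => hMF _ (hS.cell_mem n m t)
  have hWi : ∀ n m, IntervalIntegrable (fun t => F (W n m t) * θ t) volume T₁ T₂ := fun n m =>
    hθi.bounded_mul (hS.measurable_comp_interface hFc n m) fun t => hMF _ (hS.interface_mem n m t)
  set P : ℕ → ℕ → ℝ := fun n m => ∫ t in T₁..T₂, F (c n m t) * θ t with hP
  set Q : ℕ → ℕ → ℝ := fun n m => ∫ t in T₁..T₂, F (W n m t) * θ t with hQ
  have hPb : ∀ n m, |P n m| ≤ MF * B * |T₂ - T₁| := fun n m => by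
    refine intervalIntegral.norm_integral_le_of_norm_le_const (f := fun t => F (c n m t) * θ t)
      fun t ht => ?_
    rw [uIoc_of_le h12] at ht
    rw [norm_mul]
    exact mul_le_mul (hMF _ (hS.cell_mem n m t)) (hB t ⟨ht.1.le, ht.2⟩) (norm_nonneg _)
      ((norm_nonneg _).trans (hMF _ (hS.cell_mem n m t)))
  have hPi : ∀ n a b, IntervalIntegrable (fun x : ℝ => P n ⌊x / h n⌋₊) volume a b := fun n a b =>
    intervalIntegrable_comp_floor (hPb n) _ _ _
  -- Only one-sided comparisons are needed, from the cell to its left interface here and from the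
  -- right interface to the cell next.
  have hPQ : ∀ n m, P n (m + 1) ≤ Q n m + B * E n m := by
    intro n m
    simp only [hP, hQ, hE]
    rw [← intervalIntegral.integral_const_mul, ← intervalIntegral.integral_add (hWi n m)
      ((hei n m).const_mul B)]
    refine intervalIntegral.integral_mono_on h12 (hci n _) ((hWi n m).add ((hei n m).const_mul B))
      fun t ht => ?_
    have h1 : F (c n (m + 1) t) - F (W n m t) ≤ e n m t :=
      (le_max_right 0 _).trans (le_add_of_nonneg_right (le_max_left _ _))
    have h2 := mul_le_mul_of_nonneg_right h1 (hθ0 t (h0.trans ht.1))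
    have h3 := mul_le_mul_of_nonneg_left ((le_abs_self _).trans (hB t ht)) (he0 n m t)
    linarith
  have hQP : ∀ n m, Q n (m + 1) ≤ P n (m + 1) + B * E n m := by
    intro n m
    simp only [hP, hQ, hE]
    rw [← intervalIntegral.integral_const_mul, ← intervalIntegral.integral_add (hci n _)
      ((hei n m).const_mul B)]
    refine intervalIntegral.integral_mono_on h12 (hWi n _) ((hci n _).add ((hei n m).const_mul B))
      fun t ht => ?_
    have h1 : F (W n (m + 1) t) - F (c n (m + 1) t) ≤ e n m t :=
      (le_max_right 0 _).trans (le_add_of_nonneg_left (le_max_left _ _))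
    have h2 := mul_le_mul_of_nonneg_right h1 (hθ0 t (h0.trans ht.1))
    have h3 := mul_le_mul_of_nonneg_left ((le_abs_self _).trans (hB t ht)) (he0 n m t)
    linarith
  have hshift : ∀ n x, ⌊(x - h n) / h n⌋₊ = ⌊x / h n⌋₊ - 1 := fun n x => by
    rw [sub_div, div_self (h_pos n).ne', Nat.floor_sub_one]
  -- The defect of cell m + 1 carries the index m, hence the shift by one mesh width.
  have hEshift : ∀ n a b X, h n ≤ a → a ≤ b → b ≤ X →
      ∫ x in a..b, E n ⌊(x - h n) / h n⌋₊ ≤ ∫ x in (0 : ℝ)..X, E n ⌊x / h n⌋₊ := by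
    intro n a b X h1 h2 h3
    rw [intervalIntegral.integral_comp_sub_right fun x => E n ⌊x / h n⌋₊]
    exact intervalIntegral.integral_mono_interval (by linarith) (by linarith)
      (by linarith [h_pos n]) (Eventually.of_forall fun x => hE0 n _) (hEi n _ _)
  have hEshift_int : ∀ n a b, IntervalIntegrable (fun x : ℝ => E n ⌊(x - h n) / h n⌋₊) volume a b :=
    fun n a b => by
      simp only [hshift]
      exact intervalIntegrable_comp_floor (s := fun m => E n (m - 1)) (fun m => hEb n _) _ _ _
  have hdef : ∀ X, 0 ≤ X → Tendsto (fun n => ∫ x in (0 : ℝ)..X, E n ⌊x / h n⌋₊) atTop (𝓝 0) :=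
    fun X hX => hS.tendsto_defect hK hK𝒰 hlam h_pos h_lim hp h0 h12 hX
  have hlimP : ∀ a b, 0 ≤ a → a ≤ b → Tendsto (fun n => ∫ x in a..b, P n ⌊x / h n⌋₊) atTop
      (𝓝 (∫ x in a..b, timeAverage T₁ T₂ θ F fun t => ν (x, t))) := fun a b ha hab =>
    (hν.tendsto_average hS hK hFc h0 h12 hθi ha hab).2
  refine ⟨C, hC0, fun a b δ ha hab hδ => ?_, fun k A hA b δ hb hδ => ?_⟩
  · have hupper : Tendsto (fun n => (∫ x in a..a + δ, P n ⌊x / h n⌋₊) + δ * (C * (b - a))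
        + 2 * B * ∫ x in (0 : ℝ)..b + δ, E n ⌊x / h n⌋₊) atTop
        (𝓝 ((∫ x in a..a + δ, timeAverage T₁ T₂ θ F fun t => ν (x, t))
          + δ * (C * (b - a)) + 2 * B * 0)) :=
      ((hlimP a (a + δ) ha.le (by linarith)).add_const _).add
        ((hdef (b + δ) (by linarith)).const_mul _)
    rw [mul_zero, add_zero] at hupper
    refine le_of_tendsto_of_tendsto (hlimP b (b + δ) (by linarith) (by linarith)) hupper ?_
    filter_upwards [h_lim.eventually (gt_mem_nhds ha),
      h_lim.eventually (gt_mem_nhds (sub_pos.2 hab))] with n hna hnb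
    have hh := h_pos n
    -- From the cell at x + (b - a) to its left interface, along interfaces to the right interface
    -- of the cell at x, then into that cell. As `h n < b - a`, the two cells differ and the
    -- interfaces are in this order.
    have hpt : ∀ x ∈ Icc a (a + δ), P n ⌊(x + (b - a)) / h n⌋₊ ≤ P n ⌊x / h n⌋₊ + C * (b - a)
        + B * E n ⌊(x - h n) / h n⌋₊ + B * E n ⌊(x + (b - a) - h n) / h n⌋₊ := by
      intro x hx
      have hx0 : 0 ≤ x := ha.le.trans hx.1
      rw [hshift, hshift]
      obtain ⟨m, hm⟩ : ∃ m, ⌊x / h n⌋₊ = m + 1 := Nat.exists_eq_add_one.2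
        (Nat.floor_pos.2 ((one_le_div hh).2 (hna.le.trans hx.1)))
      have hmm : m + 1 + 1 ≤ ⌊(x + (b - a)) / h n⌋₊ := by
        rw [← hm, ← Nat.floor_add_one (div_nonneg hx0 hh.le)]
        refine Nat.floor_mono ?_
        rw [add_div]
        have : 1 ≤ (b - a) / h n := (one_le_div hh).2 hnb.le
        linarith
      obtain ⟨m', hm'⟩ : ∃ m', ⌊(x + (b - a)) / h n⌋₊ = m' + 1 :=
        Nat.exists_eq_add_one.2 (by omega)
      have e1 := Nat.floor_le (a := (x + (b - a)) / h n) (div_nonneg (by linarith) hh.le)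
      have e2 := Nat.lt_floor_add_one (x / h n)
      rw [hm', le_div_iff₀ hh] at e1
      rw [hm, div_lt_iff₀ hh] at e2
      push_cast at e1 e2
      rw [hm, hm', Nat.add_sub_cancel, Nat.add_sub_cancel]
      have a1 := hPQ n m'
      have a2 := hC n (m + 1) m' (by omega)
      have a3 := hQP n m
      have a4 : C * (((m' : ℝ) - ((m + 1 : ℕ) : ℝ)) * h n) ≤ C * (b - a) := by
        refine mul_le_mul_of_nonneg_left ?_ hC0
        push_cast
        linarith
      linarith
    have hi1 : IntervalIntegrable (fun x : ℝ => P n ⌊(x + (b - a)) / h n⌋₊) volume a (a + δ) := by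
      have := (hPi n b (b + δ)).comp_add_right (b - a)
      rwa [show b - (b - a) = a by ring, show b + δ - (b - a) = a + δ by ring] at this
    have hi2 : IntervalIntegrable (fun x : ℝ => E n ⌊(x + (b - a) - h n) / h n⌋₊) volume a
        (a + δ) := by
      have := (hEshift_int n b (b + δ)).comp_add_right (b - a)
      rwa [show b - (b - a) = a by ring, show b + δ - (b - a) = a + δ by ring] at this
    have hi3 : IntervalIntegrable (fun x : ℝ => P n ⌊x / h n⌋₊ + C * (b - a)) volume a (a + δ) :=
      (hPi n _ _).add intervalIntegrable_const
    have hi4 : IntervalIntegrable (fun x : ℝ => B * E n ⌊(x - h n) / h n⌋₊) volume a (a + δ) :=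
      (hEshift_int n _ _).const_mul B
    have hmono := intervalIntegral.integral_mono_on (by linarith) hi1
      ((hi3.add hi4).add (hi2.const_mul B)) hpt
    rw [intervalIntegral.integral_add (hi3.add hi4) (hi2.const_mul B),
      intervalIntegral.integral_add hi3 hi4,
      intervalIntegral.integral_add (hPi n _ _) intervalIntegrable_const,
      intervalIntegral.integral_const, intervalIntegral.integral_const_mul,
      intervalIntegral.integral_const_mul,
      intervalIntegral.integral_comp_add_right (fun x => P n ⌊x / h n⌋₊),
      intervalIntegral.integral_comp_add_right (fun x => E n ⌊(x - h n) / h n⌋₊),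
      show a + (b - a) = b by ring, show a + δ + (b - a) = b + δ by ring, smul_eq_mul,
      add_sub_cancel_left] at hmono
    have s1 := mul_le_mul_of_nonneg_left
      (hEshift n a (a + δ) (b + δ) hna.le (by linarith) (by linarith)) hB0
    have s2 := mul_le_mul_of_nonneg_left
      (hEshift n b (b + δ) (b + δ) (by linarith) (by linarith) le_rfl) hB0
    linarith
  · have hupper : Tendsto (fun n => δ * (Q n k + C * (b + δ))
        + B * ∫ x in (0 : ℝ)..b + δ, E n ⌊x / h n⌋₊) atTop
        (𝓝 (δ * (A + C * (b + δ)) + B * 0)) :=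
      ((hA.add_const _).const_mul δ).add ((hdef (b + δ) (by linarith)).const_mul _)
    rw [mul_zero, add_zero] at hupper
    refine le_of_tendsto_of_tendsto (hlimP b (b + δ) hb.le (by linarith)) hupper ?_
    have hk : Tendsto (fun n => ((k : ℝ) + 1) * h n) atTop (𝓝 0) := by
      simpa using h_lim.const_mul ((k : ℝ) + 1)
    filter_upwards [hk.eventually (gt_mem_nhds hb)] with n hnb
    -- The interface with index `k` sits at (k + 1) h, which tends to 0 and is eventually to the
    -- left of `b`.
    have hh := h_pos n
    have hhb : h n ≤ b := by
      have := mul_nonneg k.cast_nonneg hh.le (α := ℝ)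
      linarith
    have hpt : ∀ x ∈ Icc b (b + δ), P n ⌊x / h n⌋₊ ≤ Q n k + C * (b + δ)
        + B * E n ⌊(x - h n) / h n⌋₊ := by
      intro x hx
      rw [hshift]
      have hx0 : 0 ≤ x := hb.le.trans hx.1
      have hkm : k + 1 ≤ ⌊x / h n⌋₊ := by
        refine Nat.le_floor ?_
        rw [le_div_iff₀ hh]
        push_cast
        exact hnb.le.trans hx.1
      obtain ⟨m, hm⟩ : ∃ m, ⌊x / h n⌋₊ = m + 1 := Nat.exists_eq_add_one.2 (by omega)
      have e1 := Nat.floor_le (a := x / h n) (div_nonneg hx0 hh.le)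
      rw [hm, le_div_iff₀ hh] at e1
      push_cast at e1
      rw [hm, Nat.add_sub_cancel]
      have a1 := hPQ n m
      have a2 := hC n k m (by omega)
      have a3 : C * (((m : ℝ) - k) * h n) ≤ C * (b + δ) := by
        refine mul_le_mul_of_nonneg_left ?_ hC0
        have := mul_nonneg k.cast_nonneg hh.le (α := ℝ)
        linarith [hx.2]
      linarith
    have hi4 : IntervalIntegrable (fun x : ℝ => B * E n ⌊(x - h n) / h n⌋₊) volume b (b + δ) :=
      (hEshift_int n _ _).const_mul B
    have hmono := intervalIntegral.integral_mono_on (by linarith) (hPi n b (b + δ))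
      (intervalIntegrable_const.add hi4) hpt
    rw [intervalIntegral.integral_add intervalIntegrable_const hi4,
      intervalIntegral.integral_const, intervalIntegral.integral_const_mul, smul_eq_mul,
      add_sub_cancel_left] at hmono
    have s1 := mul_le_mul_of_nonneg_left
      (hEshift n b (b + δ) (b + δ) hhb (by linarith) le_rfl) hB0
    linarith

end Trace

/-! ### Compactness and disintegration on the time axis times the states -/

section Compactness

variable {N : ℕ} {K : Set (State N)} {P : Measure ℝ} {g : State N → ℝ} {M : ℝ}

lemma integral_comp_fst_eq {m : Measure (ℝ × State N)} (hm : m.fst = P) {φ : ℝ → ℝ}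
    (hφ : Integrable φ P) :
    Integrable (fun p : ℝ × State N => φ p.1) m ∧ ∫ p, φ p.1 ∂m = ∫ t, φ t ∂P := by
  have hmp : MeasurePreserving Prod.fst m P := ⟨measurable_fst, hm⟩
  refine ⟨hmp.integrable_comp_of_integrable hφ, ?_⟩
  rw [← hm] at hφ ⊢
  exact (integral_map measurable_fst.aemeasurable hφ.aestronglyMeasurable).symm

/-- Compactness for probability measures on the product of the time axis and a compact set of
states, with a given time marginal. -/
lemma exists_limit_of_fst_eq [IsProbabilityMeasure P] (hK : IsCompact K)
    (m : ℕ → Measure (ℝ × State N)) (hprob : ∀ k, IsProbabilityMeasure (m k))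
    (hfst : ∀ k, (m k).fst = P) (hsupp : ∀ k, m k (Prod.snd ⁻¹' Kᶜ) = 0) :
    ∃ (l : Filter ℕ) (m' : Measure (ℝ × State N)), l.NeBot ∧ l ≤ atTop ∧
      IsProbabilityMeasure m' ∧ m'.fst = P ∧ m' (Prod.snd ⁻¹' Kᶜ) = 0 ∧
      ∀ g : State N → ℝ, Continuous g → ∀ M, (∀ z, |g z| ≤ M) → ∀ φ : ℝ → ℝ, Integrable φ P →
        Tendsto (fun k => ∫ p, g p.2 * φ p.1 ∂(m k)) l (𝓝 (∫ p, g p.2 * φ p.1 ∂m')) := by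
  set μ : ℕ → ProbabilityMeasure (ℝ × State N) := fun k => ⟨m k, hprob k⟩ with hμ
  -- Tightness is automatic: the time marginal is a single measure, and the states lie in `K`.
  have htight : IsTightMeasureSet {x | ∃ q ∈ range μ, (q : Measure (ℝ × State N)) = x} := by
    rw [isTightMeasureSet_iff_exists_isCompact_measure_compl_le]
    intro ε hε
    obtain ⟨A, hA, hAε⟩ := isTightMeasureSet_iff_exists_isCompact_measure_compl_le.1
      (isTightMeasureSet_singleton (μ := P)) ε hε
    refine ⟨A ×ˢ K, hA.prod hK, ?_⟩
    rintro _ ⟨_, ⟨k, rfl⟩, rfl⟩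
    have hsub : (A ×ˢ K)ᶜ ⊆ (Prod.fst ⁻¹' Aᶜ) ∪ (Prod.snd ⁻¹' Kᶜ) := by
      rintro ⟨t, z⟩ hp
      by_contra hn
      simp only [mem_union, mem_preimage, mem_compl_iff, not_or, not_not] at hn
      exact hp ⟨hn.1, hn.2⟩
    calc m k (A ×ˢ K)ᶜ ≤ m k (Prod.fst ⁻¹' Aᶜ) + m k (Prod.snd ⁻¹' Kᶜ) :=
          (measure_mono hsub).trans (measure_union_le _ _)
      _ = P Aᶜ := by
          rw [hsupp, add_zero, ← Measure.fst_apply hA.measurableSet.compl, hfst]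
      _ ≤ ε := hAε P rfl
  obtain ⟨μ', -, hclu⟩ := (isCompact_closure_of_isTightMeasureSet htight).exists_mapClusterPt
    (f := atTop) (u := μ) (by
      rw [le_principal_iff]
      exact mem_map.2 (Eventually.of_forall fun k => subset_closure ⟨k, rfl⟩))
  obtain ⟨l, hl, hlim⟩ := mapClusterPt_iff_ultrafilter.1 hclu
  have hint := ProbabilityMeasure.tendsto_iff_forall_integral_tendsto.1 hlim
  have hfst' : (μ' : Measure (ℝ × State N)).fst = P := by
    refine ext_of_forall_integral_eq_of_IsFiniteMeasure fun φ => ?_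
    have h1 := hint (φ.compContinuous ⟨Prod.fst, continuous_fst⟩)
    have h2 : ∀ k, ∫ p, φ.compContinuous ⟨Prod.fst, continuous_fst⟩ p
        ∂(μ k : Measure (ℝ × State N)) = ∫ t, φ t ∂P := fun k =>
      (integral_comp_fst_eq (hfst k) (φ.integrable P)).2
    simp only [h2] at h1
    rw [tendsto_nhds_unique tendsto_const_nhds h1]
    exact integral_map measurable_fst.aemeasurable φ.continuous.aestronglyMeasurable
  have hsupp' : (μ' : Measure (ℝ × State N)) (Prod.snd ⁻¹' Kᶜ) = 0 := by
    have h1 := ProbabilityMeasure.le_liminf_measure_open_of_tendsto hlim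
      (hK.isClosed.isOpen_compl.preimage continuous_snd)
    have h2 : ∀ k, (μ k : Measure (ℝ × State N)) (Prod.snd ⁻¹' Kᶜ) = 0 := hsupp
    simp only [h2, liminf_const] at h1
    exact le_antisymm h1 zero_le
  refine ⟨l, μ', inferInstance, hl, inferInstance, hfst', hsupp', fun g hg M hM φ hφ => ?_⟩
  have hM0 : 0 ≤ M := (abs_nonneg _).trans (hM 0)
  rw [Metric.tendsto_nhds]
  intro ε hε
  -- Weak convergence covers bounded continuous weights. The common time marginal makes the L¹
  -- approximation error uniform along the sequence, which extends it to integrable weights.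
  obtain ⟨φ', hφ', hφ'i⟩ := hφ.exists_boundedContinuous_integral_sub_le
    (show 0 < ε / (4 * (M + 1)) by positivity)
  have hclose : ∀ q : Measure (ℝ × State N), q.fst = P →
      |(∫ p, g p.2 * φ p.1 ∂q) - ∫ p, g p.2 * φ' p.1 ∂q| ≤ ε / 4 := by
    intro q hq
    have hgm : AEStronglyMeasurable (fun p : ℝ × State N => g p.2) q :=
      (hg.comp continuous_snd).aestronglyMeasurable
    have i1 := ((integral_comp_fst_eq hq hφ).1.bdd_mul hgm (Eventually.of_forall fun p => hM p.2))
    have i2 := ((integral_comp_fst_eq hq hφ'i).1.bdd_mul hgm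
      (Eventually.of_forall fun p => hM p.2))
    have hd := integral_comp_fst_eq hq (φ := fun t => ‖φ t - φ' t‖) (hφ.sub hφ'i).norm
    rw [← integral_sub i1 i2, ← Real.norm_eq_abs]
    refine (norm_integral_le_of_norm_le (hd.1.const_mul M) (Eventually.of_forall fun p => ?_)).trans
      ?_
    · rw [← mul_sub, norm_mul]
      exact mul_le_mul_of_nonneg_right (hM p.2) (norm_nonneg _)
    · rw [integral_const_mul, hd.2]
      refine (mul_le_mul_of_nonneg_left hφ' hM0).trans ?_
      rw [mul_div_assoc', div_le_div_iff₀ (by positivity) (by norm_num)]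
      nlinarith
  have hbc : ∀ p : ℝ × State N, ‖g p.2 * φ' p.1‖ ≤ M * ‖φ'‖ := fun p => by
    rw [norm_mul]
    exact mul_le_mul (hM _) (φ'.norm_coe_le_norm _) (norm_nonneg _) hM0
  have h1 := hint (BoundedContinuousFunction.ofNormedAddCommGroup
    (fun p : ℝ × State N => g p.2 * φ' p.1)
    ((hg.comp continuous_snd).mul (φ'.continuous.comp continuous_fst)) _ hbc)
  filter_upwards [Metric.tendsto_nhds.1 h1 (ε / 4) (by positivity)] with k hk
  have b1 := abs_le.1 (hclose _ (hfst k))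
  have b2 := abs_le.1 (hclose _ hfst')
  rw [Real.dist_eq] at hk ⊢
  have b3 := abs_lt.1 hk
  simp only [BoundedContinuousFunction.coe_ofNormedAddCommGroup] at b3
  have b4 : (μ k : Measure (ℝ × State N)) = m k := rfl
  rw [b4] at b3
  rw [abs_lt]
  constructor <;> linarith [b1.1, b1.2, b2.1, b2.2, b3.1, b3.2]

/-- Disintegration with respect to time. -/
lemma exists_disintegration {m : Measure (ℝ × State N)} [IsProbabilityMeasure m] (hfst : m.fst = P)
    (hsupp : m (Prod.snd ⁻¹' Kᶜ) = 0) :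
    ∃ ρ : ℝ → Measure (State N), (∀ t, IsProbabilityMeasure (ρ t)) ∧ (∀ᵐ t ∂P, ρ t Kᶜ = 0) ∧
      (∀ g : State N → ℝ, Continuous g → StronglyMeasurable fun t => ∫ z, g z ∂(ρ t)) ∧
      ∀ g : State N → ℝ, Continuous g → ∀ M, (∀ z, |g z| ≤ M) → ∀ φ : ℝ → ℝ, Integrable φ P →
        ∫ p, g p.2 * φ p.1 ∂m = ∫ t, (∫ z, g z ∂(ρ t)) * φ t ∂P := by
  have hdis : m.fst.compProd m.condKernel = m := Measure.disintegrate m m.condKernel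
  refine ⟨fun t => m.condKernel t, fun t => inferInstance, ?_, fun g hg => ?_,
    fun g hg M hM φ hφ => ?_⟩
  · have h1 : ∀ᵐ p ∂(m.fst.compProd m.condKernel), p.2 ∈ K := by
      rw [hdis]
      exact hsupp
    have h2 := Measure.ae_ae_of_ae_compProd h1
    rw [hfst] at h2
    exact h2
  · exact hg.stronglyMeasurable.integral_kernel
  · have hi : Integrable (fun p : ℝ × State N => g p.2 * φ p.1) (m.fst.compProd m.condKernel) := by
      rw [hdis]
      exact (integral_comp_fst_eq hfst hφ).1.bdd_mul
        (hg.comp continuous_snd).aestronglyMeasurable (Eventually.of_forall fun p => hM p.2)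
    have h1 := Measure.integral_compProd hi
    rw [hdis, hfst] at h1
    rw [h1]
    exact integral_congr_ae (Eventually.of_forall fun t => integral_mul_const (φ t) g)

lemma ContinuousOn.exists_bounded_extension (hK : IsCompact K) (hg : ContinuousOn g K) :
    ∃ g' : State N → ℝ, Continuous g' ∧ EqOn g' g K ∧ ∃ M, ∀ z, |g' z| ≤ M := by
  obtain ⟨M, hM⟩ := hK.exists_bound_of_continuousOn hg
  obtain ⟨g', hg'c, hg'⟩ := hg.exists_continuous_extension hK.isClosed
  refine ⟨fun z => max (-|M|) (min (g' z) |M|), by fun_prop, fun z hz => ?_, |M|, fun z => ?_⟩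
  · have h1 := abs_le.1 ((hM z hz).trans (le_abs_self M))
    simp only [hg' hz]
    rw [min_eq_left h1.2, max_eq_right h1.1]
  · rw [abs_le]
    exact ⟨le_max_left _ _, max_le (by linarith [abs_nonneg M]) (min_le_right _ _)⟩

/-- The exponential distribution as a reference measure on the positive time axis. -/
noncomputable def expTime : Measure ℝ :=
  (volume.restrict (Ioi (0 : ℝ))).withDensity fun t => ENNReal.ofReal (Real.exp (-t))

lemma measurable_ofReal_exp_neg : Measurable fun t : ℝ => ENNReal.ofReal (Real.exp (-t)) := by
  fun_prop

instance : IsProbabilityMeasure expTime := by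
  refine ⟨?_⟩
  rw [expTime, withDensity_apply _ MeasurableSet.univ, Measure.restrict_univ,
    ← ofReal_integral_eq_lintegral_ofReal (integrableOn_exp_neg_Ioi 0)
      (Eventually.of_forall fun t => (Real.exp_pos _).le), integral_exp_neg_Ioi_zero,
    ENNReal.ofReal_one]

lemma restrict_absolutelyContinuous_expTime : volume.restrict (Ioi (0 : ℝ)) ≪ expTime :=
  withDensity_absolutelyContinuous' measurable_ofReal_exp_neg.aemeasurable
    (Eventually.of_forall fun t => by simp [Real.exp_pos])

/-- The weight on the exponential time axis which represents the weight `θ` on `(T₁, T₂]`. -/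
noncomputable def expWeight (T₁ T₂ : ℝ) (θ : ℝ → ℝ) : ℝ → ℝ :=
  (Ioc T₁ T₂).indicator fun t => Real.exp t * θ t

lemma integral_mul_expWeight {T₁ T₂ : ℝ} (h0 : 0 ≤ T₁) (h12 : T₁ ≤ T₂) (θ a : ℝ → ℝ) :
    ∫ t, a t * expWeight T₁ T₂ θ t ∂expTime = ∫ t in T₁..T₂, a t * θ t := by
  rw [expTime, integral_withDensity_eq_integral_toReal_smul measurable_ofReal_exp_neg
    (Eventually.of_forall fun t => ENNReal.ofReal_lt_top), intervalIntegral.integral_of_le h12]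
  have hsub : Ioc T₁ T₂ ⊆ Ioi (0 : ℝ) := fun t ht => h0.trans_lt ht.1
  rw [← inter_eq_self_of_subset_left hsub, ← Measure.restrict_restrict measurableSet_Ioc,
    ← integral_indicator measurableSet_Ioc]
  refine integral_congr_ae (Eventually.of_forall fun t => ?_)
  simp only [expWeight]
  by_cases ht : t ∈ Ioc T₁ T₂
  · simp only [indicator_of_mem ht, smul_eq_mul, ENNReal.toReal_ofReal (Real.exp_pos _).le]
    rw [Real.exp_neg]
    field_simp
  · simp [indicator_of_notMem ht]

lemma integrable_expWeight {T₁ T₂ : ℝ} (h0 : 0 ≤ T₁) (h12 : T₁ ≤ T₂) {θ : ℝ → ℝ}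
    (hθ : IntervalIntegrable θ volume T₁ T₂) : Integrable (expWeight T₁ T₂ θ) expTime := by
  rw [expTime, integrable_withDensity_iff_integrable_smul' measurable_ofReal_exp_neg
    (Eventually.of_forall fun t => ENNReal.ofReal_lt_top)]
  have hsub : Ioc T₁ T₂ ⊆ Ioi (0 : ℝ) := fun t ht => h0.trans_lt ht.1
  rw [intervalIntegrable_iff_integrableOn_Ioc_of_le h12] at hθ
  have h1 : Integrable ((Ioc T₁ T₂).indicator θ) (volume.restrict (Ioi (0 : ℝ))) := by
    rw [integrable_indicator_iff measurableSet_Ioc, IntegrableOn,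
      Measure.restrict_restrict measurableSet_Ioc, inter_eq_self_of_subset_left hsub]
    exact hθ
  refine h1.congr (Eventually.of_forall fun t => ?_)
  simp only [expWeight]
  by_cases ht : t ∈ Ioc T₁ T₂
  · simp only [indicator_of_mem ht, smul_eq_mul, ENNReal.toReal_ofReal (Real.exp_pos _).le]
    rw [Real.exp_neg]
    field_simp
  · simp [indicator_of_notMem ht]

end Compactness

/-! ### The trace measure at the boundary -/

section TraceMeasure

variable {N : ℕ} {f : State N → State N} {𝒰 K : Set (State N)} {lam : ℝ} {h : ℕ → ℝ}
  {c W : ℕ → ℕ → ℝ → State N} {ν : ℝ × ℝ → Measure (State N)}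

/-- There is a Young measure at the boundary which represents every limit of the averages of the
Young measure over thin layers. -/
lemma IsYoungMeasure.exists_boundary_measure (hS : IsEntropyScheme f 𝒰 K lam h c W)
    (hK : IsCompact K)
    (hν : IsYoungMeasure K (Ioi (0 : ℝ) ×ˢ Ioi (0 : ℝ)) (fun n p => c n ⌊p.1 / h n⌋₊ p.2) ν) :
    ∃ ν₀ : ℝ → Measure (State N), IsYoungFamily K (Ioi (0 : ℝ)) ν₀ ∧
      ∀ g : State N → ℝ, ContinuousOn g K → ∀ T₁ T₂ : ℝ, 0 ≤ T₁ → T₁ ≤ T₂ → ∀ θ : ℝ → ℝ,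
        IntervalIntegrable θ volume T₁ T₂ → ∀ L,
        Tendsto (fun ε => ε⁻¹ * ∫ x in (0 : ℝ)..ε, timeAverage T₁ T₂ θ g fun t => ν (x, t))
          (𝓝[>] 0) (𝓝 L) → timeAverage T₁ T₂ θ g ν₀ = L := by
  set ε : ℕ → ℝ := fun k => 1 / ((k : ℝ) + 1) with hε
  have hε0 : ∀ k, 0 < ε k := fun k => Nat.one_div_pos_of_nat
  set β : ℕ → Measure ℝ := fun k => ENNReal.ofReal (ε k)⁻¹ • volume.restrict (Ioc 0 (ε k)) with hβ
  have hβ1 : ∀ k, IsProbabilityMeasure (β k) := fun k => ⟨by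
    simp only [hβ, Measure.smul_apply, Measure.restrict_apply_univ, Real.volume_Ioc, sub_zero,
      smul_eq_mul]
    rw [← ENNReal.ofReal_mul (inv_pos.2 (hε0 k)).le, inv_mul_cancel₀ (hε0 k).ne',
      ENNReal.ofReal_one]⟩
  have hβi : ∀ k (q : ℝ → ℝ), ∫ x, q x ∂(β k) = (ε k)⁻¹ * ∫ x in (0 : ℝ)..ε k, q x := fun k q => by
    simp only [hβ]
    rw [integral_smul_measure, ENNReal.toReal_ofReal (inv_pos.2 (hε0 k)).le,
      intervalIntegral.integral_of_le (hε0 k).le, smul_eq_mul]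
  set S : ℕ → ℝ × ℝ → ℝ × State N := fun n p => (p.2, c n ⌊p.1 / h n⌋₊ p.2) with hSdef
  have hSm : ∀ n, Measurable (S n) := fun n => by
    have h1 : Measurable fun q : ℕ × ℝ => c n q.1 q.2 :=
      measurable_from_prod_countable_right fun m => hS.measurable_cell n m
    exact measurable_snd.prodMk
      (h1.comp ((Nat.measurable_floor.comp (measurable_fst.div_const _)).prodMk measurable_snd))
  -- The scheme itself is pushed forward, instead of averaging `ν`, which is defined only up to null
  -- sets; the averages of `ν` reappear as limits in `n`.
  set m : ℕ → ℕ → Measure (ℝ × State N) := fun k n => ((β k).prod expTime).map (S n) with hm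
  have hm1 : ∀ k n, IsProbabilityMeasure (m k n) := fun k n =>
    Measure.isProbabilityMeasure_map (hSm n).aemeasurable
  have hmfst : ∀ k n, (m k n).fst = expTime := fun k n => by
    have h1 : Measurable fun p : ℝ × ℝ => c n ⌊p.1 / h n⌋₊ p.2 := measurable_snd.comp (hSm n)
    have h2 := Measure.fst_map_prodMk (X := fun p : ℝ × ℝ => p.2) (μ := (β k).prod expTime) h1
    have h3 : ((β k).prod expTime).map (fun p : ℝ × ℝ => p.2) = expTime := by
      have := Measure.snd_prod (μ := β k) (ν := expTime)
      exact this
    exact h2.trans h3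
  have hmsupp : ∀ k n, m k n (Prod.snd ⁻¹' Kᶜ) = 0 := fun k n => by
    simp only [hm]
    rw [Measure.map_apply (hSm n) (hK.isClosed.measurableSet.compl.preimage measurable_snd)]
    have : S n ⁻¹' (Prod.snd ⁻¹' Kᶜ) = ∅ := by
      ext p
      simp [hSdef, hS.cell_mem]
    rw [this, measure_empty]
  -- The order of the limits matters: first h → 0 at fixed layer width, then the width to 0.
  choose l₁ m₁ hl₁ne hl₁ hm₁ hm₁fst hm₁supp hm₁lim using fun k =>
    exists_limit_of_fst_eq hK (m k) (hm1 k) (hmfst k) (hmsupp k)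
  obtain ⟨l, m', hlne, hl, hm', hm'fst, hm'supp, hm'lim⟩ :=
    exists_limit_of_fst_eq hK m₁ hm₁ hm₁fst hm₁supp
  obtain ⟨ρ, hρ1, hρK, hρm, hρint⟩ := exists_disintegration hm'fst hm'supp
  have hρK' : ∀ᵐ t ∂(volume.restrict (Ioi (0 : ℝ))), ρ t Kᶜ = 0 :=
    restrict_absolutelyContinuous_expTime.ae_le hρK
  refine ⟨ρ, ⟨hρK'.mono fun t ht => ⟨hρ1 t, ht⟩, fun g hg => ?_⟩,
    fun g hg T₁ T₂ h0 h12 θ hθ L hL => ?_⟩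
  · obtain ⟨g', hg'c, hg'⟩ := hg.exists_continuous_extension hK.isClosed
    exact (hρm g' hg'c).aestronglyMeasurable.congr
      (hρK'.mono fun t ht => integral_congr_of_eqOn ht hg')
  · obtain ⟨g', hg'c, hg', M, hM⟩ := hg.exists_bounded_extension hK
    have hφ := integrable_expWeight h0 h12 hθ
    have hsub : Ioc T₁ T₂ ⊆ Ioi (0 : ℝ) := fun t ht => h0.trans_lt ht.1
    have e0 : timeAverage T₁ T₂ θ g ρ = ∫ p, g' p.2 * expWeight T₁ T₂ θ p.1 ∂m' := by
      rw [hρint g' hg'c M hM _ hφ, integral_mul_expWeight h0 h12, timeAverage,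
        intervalIntegral.integral_of_le h12, intervalIntegral.integral_of_le h12]
      refine integral_congr_ae ?_
      filter_upwards [ae_restrict_of_ae_restrict_of_subset hsub hρK'] with t ht
      rw [integral_congr_of_eqOn ht hg']
    have e1 : ∀ k n, ∫ p, g' p.2 * expWeight T₁ T₂ θ p.1 ∂(m k n)
        = (ε k)⁻¹ * ∫ x in (0 : ℝ)..ε k, ∫ t in T₁..T₂, g (c n ⌊x / h n⌋₊ t) * θ t := by
      intro k n
      have hi : Integrable (fun p : ℝ × State N => g' p.2 * expWeight T₁ T₂ θ p.1) (m k n) :=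
        (integral_comp_fst_eq (hmfst k n) hφ).1.bdd_mul
          (hg'c.comp continuous_snd).aestronglyMeasurable (Eventually.of_forall fun p => hM p.2)
      have hi2 : Integrable (fun p : ℝ × ℝ => g' (c n ⌊p.1 / h n⌋₊ p.2)
          * expWeight T₁ T₂ θ p.2) ((β k).prod expTime) :=
        (integrable_map_measure hi.aestronglyMeasurable (hSm n).aemeasurable).1 hi
      have h1 : ∫ p, g' p.2 * expWeight T₁ T₂ θ p.1 ∂(m k n)
          = ∫ p : ℝ × ℝ, g' (c n ⌊p.1 / h n⌋₊ p.2) * expWeight T₁ T₂ θ p.2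
            ∂((β k).prod expTime) :=
        integral_map (hSm n).aemeasurable hi.aestronglyMeasurable
      rw [h1, integral_prod _ hi2, ← hβi]
      refine integral_congr_ae (Eventually.of_forall fun x => ?_)
      simp only
      rw [integral_mul_expWeight h0 h12 θ fun t => g' (c n ⌊x / h n⌋₊ t)]
      refine intervalIntegral.integral_congr fun t _ => ?_
      simp only [hg' (hS.cell_mem _ _ _)]
    have e2 : ∀ k, ∫ p, g' p.2 * expWeight T₁ T₂ θ p.1 ∂(m₁ k)
        = (ε k)⁻¹ * ∫ x in (0 : ℝ)..ε k, timeAverage T₁ T₂ θ g fun t => ν (x, t) := by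
      intro k
      have h1 := hm₁lim k g' hg'c M hM _ hφ
      have h2 := ((hν.tendsto_average hS hK hg h0 h12 hθ le_rfl (hε0 k).le).2.const_mul
        (ε k)⁻¹).mono_left (hl₁ k)
      simp only [← e1] at h2
      have := hl₁ne k
      exact tendsto_nhds_unique h1 h2
    have h3 := hm'lim g' hg'c M hM _ hφ
    simp only [e2] at h3
    have hεlim : Tendsto ε atTop (𝓝[>] 0) :=
      tendsto_nhdsWithin_iff.2 ⟨tendsto_one_div_add_atTop_nhds_zero_nat,
        Eventually.of_forall hε0⟩
    rw [e0]
    exact tendsto_nhds_unique h3 ((hL.comp hεlim).mono_left hl)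

end TraceMeasure

/-! ### Layers of the interface Young measure -/

lemma IsYoungMeasure.tendsto_timeAverage {N : ℕ} {K : Set (State N)} {w : ℕ → ℝ → State N}
    {ρ : ℝ → Measure (State N)} {g : State N → ℝ} {θ : ℝ → ℝ} {T₁ T₂ : ℝ}
    (hρ : IsYoungMeasure K (Ioi (0 : ℝ)) w ρ) (hg : ContinuousOn g K) (h0 : 0 ≤ T₁)
    (h12 : T₁ ≤ T₂) (hθ : IntervalIntegrable θ volume T₁ T₂) :
    Tendsto (fun n => ∫ t in T₁..T₂, g (w n t) * θ t) atTop (𝓝 (timeAverage T₁ T₂ θ g ρ)) := by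
  rw [intervalIntegrable_iff_integrableOn_Ioc_of_le h12] at hθ
  have h1 := (hρ.mono (Ω' := Ioc T₁ T₂) (fun t ht => h0.trans_lt ht.1) measurableSet_Ioc).tendsto
    g hg θ hθ
  simpa only [timeAverage, intervalIntegral.integral_of_le h12] using h1

/-- The layers of a Young measure associated with functions which are constant, in the first
variable, on the cells `[k + 1 / 2, k + 3 / 2)`. -/
lemma IsYoungMeasure.exists_layers {N : ℕ} {K : Set (State N)} {W : ℕ → ℕ → ℝ → State N}
    {π : ℝ × ℝ → Measure (State N)} (hK : IsCompact K) (hW : ∀ n k, Measurable (W n k))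
    (hWK : ∀ n k t, W n k t ∈ K)
    (hπ : IsYoungMeasure K (Ioi (1 / 2 : ℝ) ×ˢ Ioi (0 : ℝ))
      (fun n p => W n ⌊p.1 - 1 / 2⌋₊ p.2) π) :
    ∃ ρ : ℕ → ℝ → Measure (State N),
      (∀ᵐ p ∂(volume.restrict (Ioi (1 / 2 : ℝ) ×ˢ Ioi (0 : ℝ))), ρ ⌊p.1 - 1 / 2⌋₊ p.2 = π p) ∧
      ∀ k, IsYoungMeasure K (Ioi (0 : ℝ)) (fun n => W n k) (ρ k) := by
  -- The intersection only removes the endpoint 1/2 of the first strip.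
  set A : ℕ → Set ℝ := fun k => Ico ((k : ℝ) + 1 / 2) ((k : ℝ) + 3 / 2) ∩ Ioi (1 / 2) with hA
  have hAm : ∀ k, MeasurableSet (A k) := fun k => measurableSet_Ico.inter measurableSet_Ioi
  have hAfl : ∀ k, ∀ y ∈ A k, ⌊y - 1 / 2⌋₊ = k := fun k y hy => by
    have hy2 : (1 : ℝ) / 2 < y := hy.2
    rw [Nat.floor_eq_iff (by linarith)]
    constructor <;> linarith [hy.1.1, hy.1.2]
  have hA1 : ∀ k, volume (A k) = 1 := fun k => by
    have h1 : volume (Ico ((k : ℝ) + 1 / 2) ((k : ℝ) + 3 / 2)) = 1 := by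
      rw [Real.volume_Ico, show (k : ℝ) + 3 / 2 - (k + 1 / 2) = 1 by ring, ENNReal.ofReal_one]
    have h2 : volume (Ioo ((k : ℝ) + 1 / 2) ((k : ℝ) + 3 / 2)) = 1 := by
      rw [Real.volume_Ioo, show (k : ℝ) + 3 / 2 - (k + 1 / 2) = 1 by ring, ENNReal.ofReal_one]
    refine le_antisymm (h1 ▸ measure_mono inter_subset_left) (h2 ▸ measure_mono fun y hy => ?_)
    refine ⟨Ioo_subset_Ico_self hy, ?_⟩
    have := k.cast_nonneg (α := ℝ)
    have h3 : (k : ℝ) + 1 / 2 < y := hy.1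
    change (1 : ℝ) / 2 < y
    linarith
  have hlayer : ∀ k, ∃ ρ : ℝ → Measure (State N),
      (∀ᵐ p ∂(volume.restrict (A k ×ˢ Ioi (0 : ℝ))), π p = ρ p.2) ∧
        IsYoungMeasure K (Ioi (0 : ℝ)) (fun n => W n k) ρ := fun k => by
    have h1 := hπ.mono (Ω' := A k ×ˢ Ioi (0 : ℝ)) (prod_mono inter_subset_right subset_rfl)
      ((hAm k).prod measurableSet_Ioi)
    have h2 := h1.congr (u' := fun n p => W n k p.2) ((hAm k).prod measurableSet_Ioi)
      fun n p hp => by rw [hAfl k _ hp.1]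
    exact h2.exists_layer hK (hA1 k) (fun n => hW n k) fun n t => hWK n k t
  choose ρ hρae hρ using hlayer
  refine ⟨ρ, ?_, hρ⟩
  have hunion : Ioi (1 / 2 : ℝ) ×ˢ Ioi (0 : ℝ) = ⋃ k, A k ×ˢ Ioi (0 : ℝ) := by
    rw [← iUnion_prod_const]
    congr 1
    ext y
    refine ⟨fun hy => mem_iUnion.2 ⟨⌊y - 1 / 2⌋₊, ⟨?_, hy⟩⟩, fun hy => ?_⟩
    · have hy' : (1 : ℝ) / 2 < y := hy
      have h1 := Nat.floor_le (a := y - 1 / 2) (by linarith)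
      have h2 := Nat.lt_floor_add_one (y - 1 / 2)
      constructor <;> linarith
    · obtain ⟨k, hk⟩ := mem_iUnion.1 hy
      exact hk.2
  rw [hunion, ae_restrict_iUnion_iff]
  intro k
  filter_upwards [hρae k, ae_restrict_mem ((hAm k).prod measurableSet_Ioi)] with p hp hmem
  rw [hAfl k _ hmem.1, hp]

/-! ### The theorem -/

theorem theorem2p4 (N : ℕ) (𝒰 : Set (State N)) (h𝒰_open : IsOpen 𝒰) (h𝒰_convex : Convex ℝ 𝒰)
    (f : State N → State N) (hf : ContDiffOn ℝ ∞ f 𝒰)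
    (hentropy : ∃ U F : State N → ℝ, IsStrictlyConvexEntropyPair f 𝒰 U F)
    -- the Riemann solver, for data in `𝒟`
    (𝒟 : Set (State N)) (Λ : ℝ) (R : State N → State N → State N)
    (hR : IsRiemannSolver f 𝒰 𝒟 Λ R) (hR_meas : Measurable (Function.uncurry R))
    -- the mesh ratio, with the stability condition
    (lam : ℝ) (hlam : 0 < lam) (hCFL : lam * Λ < 1 / 2)
    -- the boundary data, the mesh sizes, and the initial cell values
    (uB : ℝ → State N) (huB : Measurable uB)
    (h : ℕ → ℝ) (h_pos : ∀ n, 0 < h n) (h_lim : Tendsto h atTop (𝓝 0))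
    (uI : ℕ → ℕ → State N)
    -- the uniform bounds
    (K : Set (State N)) (hK : IsCompact K) (hK𝒰 : K ⊆ 𝒰)
    (hu : ∀ n x t, 0 ≤ x → 0 ≤ t → godunov f R lam (h n) (uI n) uB x t ∈ K ∩ 𝒟)
    (hw : ∀ n y t, 1 / 2 ≤ y → 0 ≤ t → godunovInterface f R lam (h n) (uI n) uB y t ∈ K)
    -- the Young measures of `uʰ` and `wʰ`
    (ν π : ℝ × ℝ → Measure (State N))
    (hν : IsYoungMeasure 𝒰 (Ioi (0 : ℝ) ×ˢ Ioi (0 : ℝ))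
      (fun n p => godunov f R lam (h n) (uI n) uB p.1 p.2) ν)
    (hπ : IsYoungMeasure 𝒰 (Ioi (1 / 2 : ℝ) ×ˢ Ioi (0 : ℝ))
      (fun n p => godunovInterface f R lam (h n) (uI n) uB p.1 p.2) π) :
    -- a version `π'` of `π`, defined for all `y ≥ 1 / 2`, and the trace `ν₀` of `ν` at `x = 0`
    ∃ (π' : ℝ → ℝ → Measure (State N)) (ν₀ : ℝ → Measure (State N)),
      (∀ᵐ p ∂(volume.restrict (Ioi (1 / 2 : ℝ) ×ˢ Ioi (0 : ℝ))), π' p.1 p.2 = π p) ∧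
      (∀ y, 1 / 2 ≤ y → IsYoungFamily K (Ioi (0 : ℝ)) (π' y)) ∧
      (∀ᵐ t ∂(volume.restrict (Ioi (0 : ℝ))), ∀ k : ℕ, 1 ≤ k →
        ∀ y ∈ Ico ((k : ℝ) - 1 / 2) ((k : ℝ) + 1 / 2),
        ∀ y' ∈ Ico ((k : ℝ) - 1 / 2) ((k : ℝ) + 1 / 2), π' y t = π' y' t) ∧
      IsYoungFamily K (Ioi (0 : ℝ)) ν₀ ∧
      ∀ U F : State N → ℝ, IsConvexEntropyPair f 𝒰 U F →
        ∀ T₁ T₂ : ℝ, 0 ≤ T₁ → T₁ < T₂ →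
        ∀ θ : ℝ → ℝ, LocallyBoundedVariationOn θ (Ici 0) →
          -- the boundary value at `y = 1 / 2`
          Tendsto (fun n => ∫ t in T₁..T₂,
              F (R (uB t) (godunovScaled f R lam (h n) (uI n) uB 1 t)) * θ t) atTop
            (𝓝 (timeAverage T₁ T₂ θ F (π' (1 / 2)))) ∧
          ((∀ t, 0 ≤ t → 0 ≤ θ t) →
            -- `ν₀` is the trace of `ν` (essential limit as `x → 0+`)
            Tendsto (fun x => timeAverage T₁ T₂ θ F (fun t => ν (x, t)))
              (𝓝[>] (0 : ℝ) ⊓ ae volume) (𝓝 (timeAverage T₁ T₂ θ F ν₀)) ∧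
            -- the chain of inequalities
            (∀ y, 1 / 2 ≤ y →
              timeAverage T₁ T₂ θ F (π' y) ≤ timeAverage T₁ T₂ θ F (π' (1 / 2)) ∧
              timeAverage T₁ T₂ θ F (π' (y + 1)) ≤ timeAverage T₁ T₂ θ F (π' y) ∧
              timeAverage T₁ T₂ θ F ν₀ ≤ timeAverage T₁ T₂ θ F (π' (y + 1))) ∧
            -- the limit `y → ∞`
            ∃ L : ℝ, Tendsto (fun y => timeAverage T₁ T₂ θ F (π' y)) atTop (𝓝 L) ∧
              timeAverage T₁ T₂ θ F ν₀ ≤ L) := by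
  set c : ℕ → ℕ → ℝ → State N := fun n => godunovCell f R lam (h n) (uI n) uB with hc
  set W : ℕ → ℕ → ℝ → State N := fun n j t => R (c n j t) (c n (j + 1) t) with hW
  have hS : IsEntropyScheme f 𝒰 K lam h c W :=
    isEntropyScheme_godunov h𝒰_open h𝒰_convex hf hentropy hR hR_meas hlam hCFL huB h_pos hK hK𝒰
      hu hw
  have hKne : K.Nonempty := ⟨_, hS.cell_mem 0 0 0⟩
  have hν' : IsYoungMeasure K (Ioi (0 : ℝ) ×ˢ Ioi (0 : ℝ)) (fun n p => c n ⌊p.1 / h n⌋₊ p.2) ν :=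
    (hν.congr (measurableSet_Ioi.prod measurableSet_Ioi) fun n p hp =>
      godunov_eq_cell (h_pos n) p.1 (le_of_lt hp.2)).of_mem_compact
      (measurableSet_Ioi.prod measurableSet_Ioi) hK hKne fun n p _ => hS.cell_mem _ _ _
  have hπ' : IsYoungMeasure K (Ioi (1 / 2 : ℝ) ×ˢ Ioi (0 : ℝ))
      (fun n p => W n ⌊p.1 - 1 / 2⌋₊ p.2) π :=
    (hπ.congr (measurableSet_Ioi.prod measurableSet_Ioi) fun n p hp =>
      godunovInterface_eq_cell (h_pos n) (le_of_lt hp.1) (le_of_lt hp.2)).of_mem_compact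
      (measurableSet_Ioi.prod measurableSet_Ioi) hK hKne fun n p _ => hS.interface_mem _ _ _
  obtain ⟨ρ, hρae, hρ⟩ := hπ'.exists_layers hK hS.measurable_interface hS.interface_mem
  obtain ⟨ν₀, hν₀, hν₀lim⟩ := hν'.exists_boundary_measure hS hK
  refine ⟨fun y => ρ ⌊y - 1 / 2⌋₊, ν₀, hρae, fun y _ => (hρ _).toIsYoungFamily,
    Eventually.of_forall fun t k hk y hy y' hy' => ?_, hν₀, fun U F hp T₁ T₂ h0 h12 θ hθ => ?_⟩
  · have hk1 : (1 : ℝ) ≤ k := by exact_mod_cast hk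
    have hfl : ∀ y ∈ Ico ((k : ℝ) - 1 / 2) ((k : ℝ) + 1 / 2), ⌊y - 1 / 2⌋₊ = k - 1 :=
      fun y hy => by
        rw [Nat.floor_eq_iff (by linarith [hy.1]), Nat.cast_sub hk, Nat.cast_one]
        constructor <;> linarith [hy.1, hy.2]
    simp only [hfl y hy, hfl y' hy']
  have hFc := hp.continuousOn_flux.mono hK𝒰
  have hθi := hθ.intervalIntegrable_of_nonneg h0 h12.le
  have hlim : ∀ k, Tendsto (fun n => ∫ t in T₁..T₂, F (W n k t) * θ t) atTop
      (𝓝 (timeAverage T₁ T₂ θ F (ρ k))) := fun k =>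
    (hρ k).tendsto_timeAverage hFc h0 h12.le hθi
  have hhalf : ⌊(1 / 2 : ℝ) - 1 / 2⌋₊ = 0 := by simp
  refine ⟨?_, fun hθ0 => ?_⟩
  -- The interface of index 0 lies between the boundary cell, which carries `uB`, and the first
  -- interior cell. Only weak convergence is used, so `θ` may change sign here.
  · simp only [hhalf]
    refine (hlim 0).congr fun n => intervalIntegral.integral_congr fun t ht => ?_
    rw [uIcc_of_le h12.le] at ht
    have ht0 : 0 ≤ t := h0.trans ht.1
    have h1 : c n 0 t = uB t := godunovCell_zero (h_pos n) ht0
    have h2 : godunovScaled f R lam (h n) (uI n) uB 1 t = c n 1 t := by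
      rw [godunovScaled, godunov_eq_cell (h_pos n) _ ht0, one_mul, div_self (h_pos n).ne',
        Nat.floor_one]
    simp only [hW, zero_add, h1, h2]
  obtain ⟨C, hC0, hC1, hC2⟩ := hS.exists_integral_timeAverage_le hK hK𝒰 hlam h_pos h_lim hp hν' hθ
    hθ0 h0 h12.le
  obtain ⟨M, hM⟩ := hν'.toIsYoungFamily.ae_abs_timeAverage_le hK hFc h0 h12.le hθi
  have hIi : ∀ X, 0 ≤ X → IntervalIntegrable
      (fun x => timeAverage T₁ T₂ θ F fun t => ν (x, t)) volume 0 X := fun X hX =>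
    (hν'.tendsto_average hS hK hFc h0 h12.le hθi le_rfl hX).1
  obtain ⟨L, hL⟩ := exists_ess_limit hIi hM hC0 hC1
  -- The essential limit exists, so the layer averages converge to it, and `ν₀` represents every
  -- such limit.
  have hLeq : timeAverage T₁ T₂ θ F ν₀ = L :=
    hν₀lim F hFc T₁ T₂ h0 h12.le θ hθi L (tendsto_average_of_ess_limit hIi hL)
  have hLle : ∀ k, timeAverage T₁ T₂ θ F ν₀ ≤ timeAverage T₁ T₂ θ F (ρ k) := fun k =>
    hLeq.trans_le (ess_limit_le_of_integral_le hIi hL hC0 (hC2 k _ (hlim k)))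
  -- The number of cells between two fixed interfaces does not grow, so the error of order (k - j) h
  -- disappears.
  have hanti : Antitone fun k => timeAverage T₁ T₂ θ F (ρ k) := by
    obtain ⟨C', -, hC'⟩ := hS.exists_flux_le hK hK𝒰 hlam h_pos hp hθ hθ0 h0 h12.le
    intro j k hjk
    have hup : Tendsto (fun n => (∫ t in T₁..T₂, F (W n j t) * θ t)
        + C' * (((k : ℝ) - j) * h n)) atTop (𝓝 (timeAverage T₁ T₂ θ F (ρ j) + 0)) := by
      refine (hlim j).add ?_
      simpa using (h_lim.const_mul ((k : ℝ) - j)).const_mul C'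
    rw [add_zero] at hup
    exact le_of_tendsto_of_tendsto' (hlim k) hup fun n => hC' n j k hjk
  refine ⟨hLeq ▸ hL, fun y hy => ?_, ?_⟩
  · have hsucc : ⌊y + 1 - 1 / 2⌋₊ = ⌊y - 1 / 2⌋₊ + 1 := by
      rw [show y + 1 - 1 / 2 = y - 1 / 2 + 1 by ring, Nat.floor_add_one (by linarith)]
    simp only [hhalf, hsucc]
    exact ⟨hanti (Nat.zero_le _), hanti (Nat.le_succ _), hLle _⟩
  · have hbdd : BddBelow (range fun k => timeAverage T₁ T₂ θ F (ρ k)) :=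
      ⟨_, forall_mem_range.2 hLle⟩
    refine ⟨⨅ k, timeAverage T₁ T₂ θ F (ρ k), ?_, le_ciInf hLle⟩
    exact (tendsto_atTop_ciInf hanti hbdd).comp
      (tendsto_nat_floor_atTop.comp (tendsto_atTop_add_const_right _ (-(1 / 2)) tendsto_id))
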